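/- Let $G=(V,E)$ be a finite, connected, undirected, unweighted graph with vertices numbered $0,\dots,|V|-1$. A \emph{hub labeling} of $G$ assigns to every vertex $v$ two vertex sets $L^+(v),L^-(v)$, stored together with the distances $dist(v,x)$ for $x\in L^+(v)$ and $dist(x,v)$ for $x\in L^-(v)$, such that for every ordered pair $(u,v)$ of vertices $$dist(u,v)=\min\{dist(u,x)+dist(x,v) : x\in L^+(u)\cap L^-(v)\}.$$ Its maximum label size is $\max_{v}\max\{|L^+(v)|,|L^-(v)|\}$. The Harary index and the reciprocal complementary Wiener index of $G$ are $$\sum_{u\neq v}\frac1{dist(u,v)}\qquad\text{and}\qquad\sum_{u\neq v}\frac1{diam(G)+1-dist(u,v)},$$ where the sums range over the ordered pairs of distinct vertices and $diam(G)$ is the diameter. Given a hub labeling of $G$ with maximum label size at most $k$, both indices can be computed exactly, as fractions of integers, in $2^{O(k)}\cdot|V|^{1+o(1)}$ time. That is, there is a single algorithm (a program for a random access machine with logarithmic cost) which on every such input outputs both indices, and for every $\varepsilon>0$ there is a constant $C$ such that, for all $G$, $k$ and all hub labelings of $G$ with maximum label size at most $k$, its running time is at most $2^{Ck}\,|V|^{1+\varepsilon}$.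 -/

import Mathlib

/-! ### Hub labelings and the two indices -/

/-- A hub labeling of a graph: every vertex `v` gets two vertex sets `out v` and `inn v` such that,
for every ordered pair `(u, v)`, the distance from `u` to `v` is the minimum of
`dist u x + dist x v` over the common hubs `x ∈ out u ∩ inn v`. -/
structure HubLabeling {V : Type*} (G : SimpleGraph V) where
  out : V → Finset V
  inn : V → Finset V
  isLeast_dist : ∀ u v : V,
    IsLeast {m : ℕ | ∃ x, x ∈ out u ∧ x ∈ inn v ∧ m = G.dist u x + G.dist x v} (G.dist u v)

/-- The maximum label size of a hub labeling. -/
def HubLabeling.maxLabelSize {V : Type*} [Fintype V] {G : SimpleGraph V}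
    (L : HubLabeling G) : ℕ :=
  Finset.univ.sup fun v => max (L.out v).card (L.inn v).card

/-- The Harary index: the sum of `1 / dist u v` over the ordered pairs of distinct vertices. -/
noncomputable def hararyIndex {V : Type*} [Fintype V] [DecidableEq V] (G : SimpleGraph V) : ℚ :=
  ∑ p ∈ (Finset.univ : Finset V).offDiag, 1 / (G.dist p.1 p.2 : ℚ)

/-- The reciprocal complementary Wiener index: the sum of `1 / (diam + 1 - dist u v)` over the
ordered pairs of distinct vertices. -/
noncomputable def rcwIndex {V : Type*} [Fintype V] [DecidableEq V] (G : SimpleGraph V) : ℚ :=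
  ∑ p ∈ (Finset.univ : Finset V).offDiag, 1 / ((G.diam : ℚ) + 1 - (G.dist p.1 p.2 : ℚ))

/-! ### Random access machine programs with logarithmic cost

A machine has natural-number variables and finitely many (as many as the program mentions)
unbounded arrays of natural numbers with indirect addressing. Every operation is charged by the
bit lengths of all the numbers and addresses that it handles; multiplication and division are
charged the product of the bit lengths. -/

namespace RAM

/-- The contents of the memory. -/
structure State where
  var : ℕ → ℕ
  arr : ℕ → ℕ → ℕ

/-- Arithmetic expressions; `get a i` reads cell `i` of array `a`, and the comparisons have
value `1` or `0`. -/
inductive Expr where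
  | const (c : ℕ)
  | var (x : ℕ)
  | get (a : ℕ) (i : Expr)
  | add (e f : Expr)
  | sub (e f : Expr)
  | mul (e f : Expr)
  | div (e f : Expr)
  | mod (e f : Expr)
  | eq (e f : Expr)
  | lt (e f : Expr)

/-- The value of an expression (subtraction is truncated). -/
def Expr.eval (s : State) : Expr → ℕ
  | const c => c
  | var x => s.var x
  | get a i => s.arr a (i.eval s)
  | add e f => e.eval s + f.eval s
  | sub e f => e.eval s - f.eval s
  | mul e f => e.eval s * f.eval s
  | div e f => e.eval s / f.eval s
  | mod e f => e.eval s % f.eval s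
  | eq e f => if e.eval s = f.eval s then 1 else 0
  | lt e f => if e.eval s < f.eval s then 1 else 0

/-- Charge of an operation that is linear in the bit lengths of its operands. -/
def linCost (a b : ℕ) : ℕ := Nat.size a + Nat.size b + 1

/-- Charge of an operation that is quadratic in the bit lengths of its operands. -/
def quadCost (a b : ℕ) : ℕ := (Nat.size a + 1) * (Nat.size b + 1)

/-- The cost of evaluating an expression. -/
def Expr.cost (s : State) : Expr → ℕ
  | const c => Nat.size c + 1
  | var x => Nat.size (s.var x) + 1
  | get a i => i.cost s + linCost (i.eval s) (s.arr a (i.eval s))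
  | add e f => e.cost s + f.cost s + linCost (e.eval s) (f.eval s)
  | sub e f => e.cost s + f.cost s + linCost (e.eval s) (f.eval s)
  | mul e f => e.cost s + f.cost s + quadCost (e.eval s) (f.eval s)
  | div e f => e.cost s + f.cost s + quadCost (e.eval s) (f.eval s)
  | mod e f => e.cost s + f.cost s + quadCost (e.eval s) (f.eval s)
  | eq e f => e.cost s + f.cost s + linCost (e.eval s) (f.eval s)
  | lt e f => e.cost s + f.cost s + linCost (e.eval s) (f.eval s)

/-- Programs; `put a i e` writes the value of `e` into cell `i` of array `a`. -/
inductive Prog where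
  | skip
  | assign (x : ℕ) (e : Expr)
  | put (a : ℕ) (i e : Expr)
  | seq (P Q : Prog)
  | ite (c : Expr) (P Q : Prog)
  | loop (c : Expr) (P : Prog)

/-- Overwrite a variable. -/
def State.setVar (s : State) (x v : ℕ) : State :=
  { s with var := Function.update s.var x v }

/-- Overwrite a cell of an array. -/
def State.setArr (s : State) (a i v : ℕ) : State :=
  { s with arr := Function.update s.arr a (Function.update (s.arr a) i v) }

/-- `Exec P s t s'`: started in `s`, the program `P` halts in `s'` after time `t`. In the branching
constructs a condition holds when its value is nonzero. -/
inductive Exec : Prog → State → ℕ → State → Prop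
  | skip (s : State) : Exec .skip s 1 s
  | assign (x : ℕ) (e : Expr) (s : State) :
      Exec (.assign x e) s (e.cost s + Nat.size (e.eval s) + 1) (s.setVar x (e.eval s))
  | put (a : ℕ) (i e : Expr) (s : State) :
      Exec (.put a i e) s (i.cost s + e.cost s + linCost (i.eval s) (e.eval s))
        (s.setArr a (i.eval s) (e.eval s))
  | seq {P Q : Prog} {s s₁ s₂ : State} {t₁ t₂ : ℕ} :
      Exec P s t₁ s₁ → Exec Q s₁ t₂ s₂ → Exec (.seq P Q) s (t₁ + t₂) s₂
  | ite_true {c : Expr} {P Q : Prog} {s s₁ : State} {t : ℕ} :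
      c.eval s ≠ 0 → Exec P s t s₁ → Exec (.ite c P Q) s (c.cost s + 1 + t) s₁
  | ite_false {c : Expr} {P Q : Prog} {s s₁ : State} {t : ℕ} :
      c.eval s = 0 → Exec Q s t s₁ → Exec (.ite c P Q) s (c.cost s + 1 + t) s₁
  | loop_true {c : Expr} {P : Prog} {s s₁ s₂ : State} {t₁ t₂ : ℕ} :
      c.eval s ≠ 0 → Exec P s t₁ s₁ → Exec (.loop c P) s₁ t₂ s₂ →
      Exec (.loop c P) s (c.cost s + 1 + t₁ + t₂) s₂
  | loop_false {c : Expr} {P : Prog} {s : State} :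
      c.eval s = 0 → Exec (.loop c P) s (c.cost s + 1) s

/-- The initial state: the input word is in array `0`, everything else is zero. -/
def init (w : List ℕ) : State where
  var := fun _ => 0
  arr := fun a i => if a = 0 then w.getD i 0 else 0

end RAM

/-! ### The input -/

/-- One label as a sequence of numbers: its size, then each hub with its distance. -/
def encodeLabel {n : ℕ} (d : Fin n → ℕ) (l : List (Fin n)) : List ℕ :=
  l.length :: l.flatMap fun x : Fin n => [x.val, d x]

/-- `w` is an input word for the hub labeling `L` of a graph with vertices `0, …, n - 1`: the
number `n`, then for every vertex `v` in turn the out-label with the distances `dist v x` and the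
in-label with the distances `dist x v`, the hubs of each label being listed in any order. -/
def HubLabeling.Encodes {n : ℕ} {G : SimpleGraph (Fin n)} (L : HubLabeling G)
    (w : List ℕ) : Prop :=
  ∃ lo li : Fin n → List (Fin n),
    (∀ v, (lo v).Nodup ∧ (lo v).toFinset = L.out v) ∧
    (∀ v, (li v).Nodup ∧ (li v).toFinset = L.inn v) ∧
    w = n :: (List.finRange n).flatMap fun v =>
      encodeLabel (fun x => G.dist v x) (lo v) ++ encodeLabel (fun x => G.dist x v) (li v)

/-! ### Step counting with bounded memory -/

namespace RAM

/-! Both indices are linear in the numbers $N_e$ of ordered pairs at distance $e$, so it suffices to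
find these. With $X=n^2+1>N_e$ they are the base-$X$ digits of $\sum_{u,v}X^{dist(u,v)}=\sum_e
N_eX^e$, and the number of digits reveals the diameter. Powers turn sums into products: on a family
of sources and targets with $dist(u,v)=a_u+b_v$ throughout, the double sum is a product of two
single sums (`pairSum_eq_mul`), which needs only one pass over the items.

To cut the set of all pairs into such families, the sorted labels of all pairs are merged
simultaneously. Merging one pair is a sequence of comparisons: is the next hub of $u$ at most that
of $v$; if so, is it smaller; if they are equal, is this common hub at least as good as the best one
so far? The last question, $d_u+d_v\le a_u+a_v$, separates into $d_u-a_u\le a_v-d_v$. So every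
comparison reads key$(u)$ < key$(v)$ with keys that depend on one side only (`pair_low`,
`pair_high`). A task is a set of items all of whose pairs are in the same phase. A median key $c$
splits it into two tasks of at most half the size, for the pairs on the same side of $c$, and two
tasks in which $c$ separates the keys, so that the comparison is decided (`pairSum_split`). A pair
undergoes at most $6k+3$ comparisons.

Up to factors for the length of single operations, this gives $T(m,r)\le 2T(m/2,r)+2T(m,r-1)+O(m)$,
and $A^r m^{1+\delta}$ is a potential for it once $2^{-\delta}+3/A\le1$ (`potential_split`). The
total is $A^{6k+3}(2n)^{1+\delta}$. The program contains neither $\delta$ nor $A$; they occur in the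
analysis only, so one program serves every $\varepsilon$.

The numbers $X^e$ have up to about $D\log n$ bits, where $D$ is the diameter, and $D$ also enters
the step counts. This is harmless because $D<2^{4k+1}$ (`HubLabeling.diam_lt_two_pow`): along a
shortest path the hubs project to positions between the two ends, and a halving argument forces an
average label size of order $\log D$ (`hub_separation_card_le`).

The logarithmic cost is separated from the algorithm: steps are counted while all stored numbers
stay below $2^B$, and each step costs at most a constant times $B^2$ (`StepExec.exec`). -/

instance : Add Expr := ⟨Expr.add⟩
instance : Sub Expr := ⟨Expr.sub⟩
instance : Mul Expr := ⟨Expr.mul⟩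
instance : Div Expr := ⟨Expr.div⟩
instance : Mod Expr := ⟨Expr.mod⟩
instance (c : ℕ) : OfNat Expr c := ⟨Expr.const c⟩

@[simp] theorem eval_zero (s : State) : (0 : Expr).eval s = 0 := (rfl)
@[simp] theorem eval_one (s : State) : (1 : Expr).eval s = 1 := (rfl)
@[simp] theorem eval_two (s : State) : (2 : Expr).eval s = 2 := (rfl)
@[simp] theorem eval_four (s : State) : (4 : Expr).eval s = 4 := (rfl)
@[simp] theorem eval_var (s : State) (x : ℕ) : (Expr.var x).eval s = s.var x := (rfl)
@[simp] theorem eval_get (s : State) (a : ℕ) (i : Expr) :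
    (Expr.get a i).eval s = s.arr a (i.eval s) := (rfl)
@[simp] theorem eval_add (s : State) (e f : Expr) : (e + f).eval s = e.eval s + f.eval s := (rfl)
@[simp] theorem eval_sub (s : State) (e f : Expr) : (e - f).eval s = e.eval s - f.eval s := (rfl)
@[simp] theorem eval_mul (s : State) (e f : Expr) : (e * f).eval s = e.eval s * f.eval s := (rfl)
@[simp] theorem eval_div (s : State) (e f : Expr) : (e / f).eval s = e.eval s / f.eval s := (rfl)
@[simp] theorem eval_mod (s : State) (e f : Expr) : (e % f).eval s = e.eval s % f.eval s := (rfl)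
@[simp] theorem eval_eq (s : State) (e f : Expr) :
    (Expr.eq e f).eval s = if e.eval s = f.eval s then 1 else 0 := (rfl)
@[simp] theorem eval_lt (s : State) (e f : Expr) :
    (Expr.lt e f).eval s = if e.eval s < f.eval s then 1 else 0 := (rfl)

@[simp] theorem setVar_var (s : State) (x v y : ℕ) :
    (s.setVar x v).var y = if y = x then v else s.var y := by
  simp [State.setVar, Function.update_apply]

@[simp] theorem setVar_arr (s : State) (x v : ℕ) : (s.setVar x v).arr = s.arr := (rfl)

@[simp] theorem setArr_var (s : State) (a i v : ℕ) : (s.setArr a i v).var = s.var := (rfl)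

@[simp] theorem setArr_arr (s : State) (a i v b j : ℕ) :
    (s.setArr a i v).arr b j = if b = a ∧ j = i then v else s.arr b j := by
  by_cases h : b = a
  · subst h; simp [State.setArr, Function.update_apply]
  · simp [State.setArr, h]

/-- Every number in the memory is less than `K`. -/
def Bdd (K : ℕ) (s : State) : Prop := (∀ x, s.var x < K) ∧ ∀ a i, s.arr a i < K

theorem Bdd.setVar {K : ℕ} {s : State} (h : Bdd K s) (x : ℕ) {v : ℕ} (hv : v < K) :
    Bdd K (s.setVar x v) := by
  refine ⟨fun y => ?_, h.2⟩
  rw [setVar_var]; split_ifs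
  exacts [hv, h.1 y]

theorem Bdd.setArr {K : ℕ} {s : State} (h : Bdd K s) (a i : ℕ) {v : ℕ} (hv : v < K) :
    Bdd K (s.setArr a i v) := by
  refine ⟨h.1, fun b j => ?_⟩
  rw [setArr_arr]; split_ifs
  exacts [hv, h.2 b j]

/-- `StepExec K P s N s'`: started in `s`, the program `P` halts in `s'` after `N` steps, and every
number that it stores is less than `K`. -/
inductive StepExec (K : ℕ) : Prog → State → ℕ → State → Prop
  | skip (s : State) : StepExec K .skip s 1 s
  | assign (x : ℕ) (e : Expr) (s : State) : e.eval s < K →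
      StepExec K (.assign x e) s 1 (s.setVar x (e.eval s))
  | put (a : ℕ) (i e : Expr) (s : State) : e.eval s < K →
      StepExec K (.put a i e) s 1 (s.setArr a (i.eval s) (e.eval s))
  | seq {P Q : Prog} {s s₁ s₂ : State} {t₁ t₂ : ℕ} :
      StepExec K P s t₁ s₁ → StepExec K Q s₁ t₂ s₂ → StepExec K (.seq P Q) s (t₁ + t₂) s₂
  | ite_true {c : Expr} {P Q : Prog} {s s₁ : State} {t : ℕ} :
      c.eval s ≠ 0 → StepExec K P s t s₁ → StepExec K (.ite c P Q) s (1 + t) s₁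
  | ite_false {c : Expr} {P Q : Prog} {s s₁ : State} {t : ℕ} :
      c.eval s = 0 → StepExec K Q s t s₁ → StepExec K (.ite c P Q) s (1 + t) s₁
  | loop_true {c : Expr} {P : Prog} {s s₁ s₂ : State} {t₁ t₂ : ℕ} :
      c.eval s ≠ 0 → StepExec K P s t₁ s₁ → StepExec K (.loop c P) s₁ t₂ s₂ →
      StepExec K (.loop c P) s (1 + t₁ + t₂) s₂
  | loop_false {c : Expr} {P : Prog} {s : State} :
      c.eval s = 0 → StepExec K (.loop c P) s 1 s

/-- A bound for the bit length of the value of an expression, relative to that of the memory. -/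
def Expr.width : Expr → ℕ
  | const c => Nat.size c
  | var _ => 1
  | get _ _ => 1
  | add e f => e.width + f.width + 1
  | sub e f => e.width + f.width + 1
  | mul e f => e.width + f.width + 1
  | div e f => e.width + f.width + 1
  | mod e f => e.width + f.width + 1
  | eq e f => e.width + f.width + 1
  | lt e f => e.width + f.width + 1

/-- A bound for the cost of an expression, relative to the squared bit length of the memory. -/
def Expr.weight : Expr → ℕ
  | const c => Nat.size c + 1
  | var _ => 2
  | get _ i => i.weight + (i.width + 1) * (1 + 1)
  | add e f => e.weight + f.weight + (e.width + 1) * (f.width + 1)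
  | sub e f => e.weight + f.weight + (e.width + 1) * (f.width + 1)
  | mul e f => e.weight + f.weight + (e.width + 1) * (f.width + 1)
  | div e f => e.weight + f.weight + (e.width + 1) * (f.width + 1)
  | mod e f => e.weight + f.weight + (e.width + 1) * (f.width + 1)
  | eq e f => e.weight + f.weight + (e.width + 1) * (f.width + 1)
  | lt e f => e.weight + f.weight + (e.width + 1) * (f.width + 1)

/-- A bound for the cost of one step of a program, relative to the squared bit length of the
memory. -/
def Prog.weight : Prog → ℕ
  | skip => 1
  | assign _ e => e.weight + e.width + 1
  | put _ i e => i.weight + e.weight + (i.width + 1) * (e.width + 1)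
  | seq P Q => P.weight + Q.weight
  | ite c P Q => c.weight + 1 + P.weight + Q.weight
  | loop c P => c.weight + 1 + P.weight

/-! ### Bit lengths of values and the logarithmic cost of a step. -/

theorem size_add_le (a b : ℕ) : Nat.size (a + b) ≤ Nat.size a + Nat.size b + 1 := by
  rw [Nat.size_le]
  have ha := Nat.lt_size_self a
  have hb := Nat.lt_size_self b
  have h1 : 2 ^ a.size ≤ 2 ^ (a.size + b.size) := Nat.pow_le_pow_right (by norm_num) (by omega)
  have h2 : 2 ^ b.size ≤ 2 ^ (a.size + b.size) := Nat.pow_le_pow_right (by norm_num) (by omega)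
  rw [pow_succ]; omega

theorem size_mul_le (a b : ℕ) : Nat.size (a * b) ≤ Nat.size a + Nat.size b := by
  rw [Nat.size_le, pow_add]
  exact Nat.mul_lt_mul'' (Nat.lt_size_self a) (Nat.lt_size_self b)

/-- Each operation yields at most the sum of the operand lengths plus one bit; as `1 ≤ B`, the extra
bit is absorbed by one more multiple of `B`. -/
theorem size_eval_le {B : ℕ} (hB : 1 ≤ B) {s : State} (h : Bdd (2 ^ B) s) (e : Expr) :
    Nat.size (e.eval s) ≤ e.width * B := by
  have one : ∀ c : Prop, ∀ [Decidable c], Nat.size (if c then 1 else 0) ≤ 1 := by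
    intro c _; split_ifs <;> simp
  induction e with
  | const c => exact Nat.le_mul_of_pos_right _ hB
  | var x => simpa [Expr.width, Nat.size_le] using h.1 x
  | get a i => simpa [Expr.width, Nat.size_le] using h.2 a _
  | add e f he hf =>
    have := size_add_le (e.eval s) (f.eval s)
    simp only [Expr.width, Expr.eval]; nlinarith
  | mul e f he hf =>
    have := size_mul_le (e.eval s) (f.eval s)
    simp only [Expr.width, Expr.eval]; nlinarith
  | sub e f he hf =>
    have := Nat.size_le_size (Nat.sub_le (e.eval s) (f.eval s))
    simp only [Expr.width, Expr.eval]; nlinarith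
  | div e f he hf =>
    have := Nat.size_le_size (Nat.div_le_self (e.eval s) (f.eval s))
    simp only [Expr.width, Expr.eval]; nlinarith
  | mod e f he hf =>
    have := Nat.size_le_size (Nat.mod_le (e.eval s) (f.eval s))
    simp only [Expr.width, Expr.eval]; nlinarith
  | eq e f he hf =>
    have := one (e.eval s = f.eval s)
    simp only [Expr.width, Expr.eval]; nlinarith
  | lt e f he hf =>
    have := one (e.eval s < f.eval s)
    simp only [Expr.width, Expr.eval]; nlinarith

theorem quad_le {B a b x y : ℕ} (hB : 1 ≤ B) (ha : a ≤ x * B) (hb : b ≤ y * B) :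
    (a + 1) * (b + 1) ≤ (x + 1) * (y + 1) * B ^ 2 := by
  calc (a + 1) * (b + 1) ≤ ((x + 1) * B) * ((y + 1) * B) := by
        apply Nat.mul_le_mul <;> nlinarith
    _ = _ := by ring

theorem lin_le {B a b x y : ℕ} (hB : 1 ≤ B) (ha : a ≤ x * B) (hb : b ≤ y * B) :
    a + b + 1 ≤ (x + 1) * (y + 1) * B ^ 2 := by
  refine le_trans ?_ (quad_le hB ha hb)
  nlinarith [Nat.zero_le (a * b)]

/-- Multiplication and division are charged a product of two lengths, hence the square of `B`; the
linear charges are dominated by the same bound. -/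
theorem cost_le {B : ℕ} (hB : 1 ≤ B) {s : State} (h : Bdd (2 ^ B) s) (e : Expr) :
    e.cost s ≤ e.weight * B ^ 2 := by
  have hB2 : 1 ≤ B ^ 2 := Nat.one_le_pow _ _ hB
  have hBB : B ≤ B ^ 2 := by nlinarith
  have sz := fun e => size_eval_le hB h e
  induction e with
  | const c => exact Nat.le_mul_of_pos_right _ hB2
  | var x =>
    have := sz (.var x)
    simp only [Expr.width, Expr.eval, Expr.cost, Expr.weight] at *
    omega
  | get a i hi =>
    have := lin_le hB (sz i) (sz (.get a i))
    simp only [Expr.cost, Expr.weight, linCost, Expr.width, Expr.eval] at *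
    rw [add_mul]; omega
  | add e f he hf | sub e f he hf | eq e f he hf | lt e f he hf =>
    have := lin_le hB (sz e) (sz f)
    simp only [Expr.cost, Expr.weight, linCost] at *
    rw [add_mul, add_mul]; omega
  | mul e f he hf | div e f he hf | mod e f he hf =>
    have := quad_le hB (sz e) (sz f)
    simp only [Expr.cost, Expr.weight, quadCost] at *
    rw [add_mul (e.weight + f.weight), add_mul e.weight]; omega

theorem StepExec.bdd {K : ℕ} {P : Prog} {s s' : State} {N : ℕ} (h : StepExec K P s N s')
    (hs : Bdd K s) : Bdd K s' := by
  induction h with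
  | skip | loop_false => exact hs
  | assign x e s he => exact hs.setVar _ he
  | put a i e s he => exact hs.setArr _ _ he
  | seq _ _ ih₁ ih₂ => exact ih₂ (ih₁ hs)
  | ite_true _ _ ih | ite_false _ _ ih => exact ih hs
  | loop_true _ _ _ ih₁ ih₂ => exact ih₂ (ih₁ hs)

/-- The bridge from step counts to logarithmic cost. The bound `W` replaces `P.weight` so that one
constant serves for all subprograms, in particular for every round of a loop. -/
theorem StepExec.exec {B : ℕ} (hB : 1 ≤ B) {P : Prog} {s s' : State} {N W : ℕ}
    (h : StepExec (2 ^ B) P s N s') (hs : Bdd (2 ^ B) s) (hW : P.weight ≤ W) :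
    ∃ t, Exec P s t s' ∧ t ≤ N * (W * B ^ 2) := by
  have hB2 : 1 ≤ B ^ 2 := Nat.one_le_pow _ _ hB
  have hBB : B ≤ B ^ 2 := by nlinarith
  have mono : ∀ {x : ℕ}, x ≤ W → x * B ^ 2 ≤ W * B ^ 2 := fun h => Nat.mul_le_mul_right _ h
  induction h with
  | skip s =>
    refine ⟨1, .skip s, ?_⟩
    have := mono hW
    simp only [Prog.weight] at this
    omega
  | assign x e s he =>
    refine ⟨_, .assign x e s, ?_⟩
    have h1 := cost_le hB hs e
    have h2 := size_eval_le hB hs e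
    have h3 : e.width * B ≤ e.width * B ^ 2 := Nat.mul_le_mul_left _ hBB
    have := mono hW
    simp only [Prog.weight, add_mul] at this
    omega
  | put a i e s he =>
    refine ⟨_, .put a i e s, ?_⟩
    have h1 := cost_le hB hs e
    have h2 := cost_le hB hs i
    have h3 := lin_le hB (size_eval_le hB hs i) (size_eval_le hB hs e)
    have := mono hW
    simp only [Prog.weight] at this
    rw [add_mul, add_mul] at this
    simp only [linCost]
    omega
  | seq h₁ h₂ ih₁ ih₂ =>
    simp only [Prog.weight] at hW
    obtain ⟨t₁, e₁, b₁⟩ := ih₁ hs (by omega)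
    obtain ⟨t₂, e₂, b₂⟩ := ih₂ (h₁.bdd hs) (by omega)
    refine ⟨_, .seq e₁ e₂, ?_⟩
    rw [add_mul]; omega
  | @ite_true c P Q s s₁ t hc h ih =>
    have := mono hW
    simp only [Prog.weight, add_mul] at hW this
    obtain ⟨t₁, e₁, b₁⟩ := ih hs (by omega)
    refine ⟨_, .ite_true hc e₁, ?_⟩
    have h1 := cost_le hB hs c
    rw [add_mul]; omega
  | @ite_false c P Q s s₁ t hc h ih =>
    have := mono hW
    simp only [Prog.weight, add_mul] at hW this
    obtain ⟨t₁, e₁, b₁⟩ := ih hs (by omega)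
    refine ⟨_, .ite_false hc e₁, ?_⟩
    have h1 := cost_le hB hs c
    rw [add_mul]; omega
  | @loop_true c P s s₁ s₂ t₁ t₂ hc h₁ h₂ ih₁ ih₂ =>
    have := mono hW
    obtain ⟨t₂, e₂, b₂⟩ := ih₂ (h₁.bdd hs) hW
    simp only [Prog.weight, add_mul] at hW this
    obtain ⟨t₁, e₁, b₁⟩ := ih₁ hs (by omega)
    refine ⟨_, .loop_true hc e₁ e₂, ?_⟩
    have h1 := cost_le hB hs c
    rw [add_mul, add_mul]; omega
  | @loop_false c P s hc =>
    have := mono hW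
    simp only [Prog.weight, add_mul] at this
    refine ⟨_, .loop_false hc, ?_⟩
    have h1 := cost_le hB hs c
    omega

/-- The variables that a program writes. -/
def Prog.modVars : Prog → List ℕ
  | skip => []
  | assign x _ => [x]
  | put _ _ _ => []
  | seq P Q => P.modVars ++ Q.modVars
  | ite _ P Q => P.modVars ++ Q.modVars
  | loop _ P => P.modVars

/-- The arrays that a program writes. -/
def Prog.modArrs : Prog → List ℕ
  | skip => []
  | assign _ _ => []
  | put a _ _ => [a]
  | seq P Q => P.modArrs ++ Q.modArrs
  | ite _ P Q => P.modArrs ++ Q.modArrs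
  | loop _ P => P.modArrs

/-- Two states agree except on what the program writes. -/
def Agree (P : Prog) (s s' : State) : Prop :=
  (∀ x ∉ P.modVars, s'.var x = s.var x) ∧ ∀ a ∉ P.modArrs, s'.arr a = s.arr a

/-! ### Frame properties: what a program does not write stays unchanged. -/

theorem Agree.trans {P : Prog} {s s₁ s₂ : State} (h : Agree P s s₁) (h' : Agree P s₁ s₂) :
    Agree P s s₂ :=
  ⟨fun x hx => (h'.1 x hx).trans (h.1 x hx), fun a ha => (h'.2 a ha).trans (h.2 a ha)⟩

theorem Agree.refl (P : Prog) (s : State) : Agree P s s := ⟨fun _ _ => rfl, fun _ _ => rfl⟩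

theorem Agree.seq_left {P Q : Prog} {s s' : State} (h : Agree P s s') :
    Agree (.seq P Q) s s' :=
  ⟨fun x hx => h.1 x (by simp [Prog.modVars] at hx; tauto),
    fun x hx => h.2 x (by simp [Prog.modArrs] at hx; tauto)⟩

theorem Agree.seq_right {P Q : Prog} {s s' : State} (h : Agree Q s s') :
    Agree (.seq P Q) s s' :=
  ⟨fun x hx => h.1 x (by simp [Prog.modVars] at hx; tauto),
    fun x hx => h.2 x (by simp [Prog.modArrs] at hx; tauto)⟩

theorem StepExec.agree {K : ℕ} {P : Prog} {s s' : State} {N : ℕ} (h : StepExec K P s N s') :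
    Agree P s s' := by
  induction h with
  | skip | loop_false => exact .refl _ _
  | assign x e s he =>
    refine ⟨fun y hy => ?_, fun _ _ => rfl⟩
    simp only [Prog.modVars, List.mem_singleton] at hy
    simp [hy]
  | put a i e s he =>
    refine ⟨fun y hy => rfl, fun b hb => ?_⟩
    simp only [Prog.modArrs, List.mem_singleton] at hb
    ext j
    simp [hb]
  | seq _ _ ih₁ ih₂ => exact ih₁.seq_left.trans ih₂.seq_right
  | ite_true _ _ ih => exact ih.seq_left
  | ite_false _ _ ih => exact ih.seq_right
  | loop_true _ _ _ ih₁ ih₂ => exact Agree.trans (P := .loop _ _) ih₁ ih₂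

theorem Agree.of_subset {P Q : Prog} {s s' : State} (h : Agree P s s')
    (hv : P.modVars ⊆ Q.modVars) (ha : P.modArrs ⊆ Q.modArrs) : Agree Q s s' :=
  ⟨fun x hx => h.1 x fun h' => hx (hv h'), fun a hx => h.2 a fun h' => hx (ha h')⟩

theorem Agree.setVar {P : Prog} {s s' : State} (h : Agree P s s') {x : ℕ} (v : ℕ)
    (hx : x ∈ P.modVars) : Agree P s (s'.setVar x v) := by
  refine ⟨fun y hy => ?_, h.2⟩
  rw [setVar_var, if_neg (by rintro rfl; exact hy hx), h.1 y hy]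

theorem Agree.setArr {P : Prog} {s s' : State} (h : Agree P s s') {a : ℕ} (i v : ℕ)
    (hx : a ∈ P.modArrs) : Agree P s (s'.setArr a i v) := by
  refine ⟨h.1, fun b hb => ?_⟩
  ext j
  rw [setArr_arr, if_neg (by rintro ⟨rfl, -⟩; exact hb hx), h.2 b hb]

/-- Started in `s` with memory bounded by `K`, the program halts within `T` steps in a state
satisfying `Q`, storing only numbers less than `K`. -/
def Runs (K : ℕ) (P : Prog) (s : State) (T : ℕ) (Q : State → Prop) : Prop :=
  Bdd K s → ∃ N s', StepExec K P s N s' ∧ N ≤ T ∧ Q s'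

/-! ### Rules for total correctness with step bounds. -/

theorem Runs.mono {K : ℕ} {P : Prog} {s : State} {T T' : ℕ} {Q Q' : State → Prop}
    (h : Runs K P s T Q) (hT : T ≤ T') (hQ : ∀ s', Bdd K s' → Agree P s s' → Q s' → Q' s') :
    Runs K P s T' Q' := fun hs => by
  obtain ⟨N, s', h1, h2, h3⟩ := h hs
  exact ⟨N, s', h1, h2.trans hT, hQ s' (h1.bdd hs) h1.agree h3⟩

theorem Runs.of_le {K : ℕ} {P : Prog} {s : State} {T T' : ℕ} {Q : State → Prop}
    (h : Runs K P s T Q) (hT : T ≤ T') : Runs K P s T' Q := h.mono hT fun _ _ _ h => h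

theorem Runs.seq {K : ℕ} {P P' : Prog} {s : State} {T T' : ℕ} {Q R : State → Prop}
    (h : Runs K P s T Q) (h' : ∀ s', Bdd K s' → Agree P s s' → Q s' → Runs K P' s' T' R) :
    Runs K (.seq P P') s (T + T') R := fun hs => by
  obtain ⟨N, s₁, h1, h2, h3⟩ := h hs
  obtain ⟨N', s₂, h1', h2', h3'⟩ := h' s₁ (h1.bdd hs) h1.agree h3 (h1.bdd hs)
  exact ⟨_, s₂, .seq h1 h1', by omega, h3'⟩

theorem Runs.skip {K : ℕ} {s : State} {Q : State → Prop} (h : Q s) : Runs K .skip s 1 Q :=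
  fun _ => ⟨1, s, .skip s, le_rfl, h⟩

theorem Runs.assign {K : ℕ} {s : State} {x : ℕ} {e : Expr} {Q : State → Prop}
    (h : Bdd K s → e.eval s < K) (h' : Q (s.setVar x (e.eval s))) :
    Runs K (.assign x e) s 1 Q :=
  fun hs => ⟨1, _, .assign x e s (h hs), le_rfl, h'⟩

theorem Runs.assign_seq {K : ℕ} {s : State} {x T : ℕ} {e : Expr} {P : Prog} {Q : State → Prop}
    (h : Bdd K s → e.eval s < K) (h' : Runs K P (s.setVar x (e.eval s)) T Q) :
    Runs K (.seq (.assign x e) P) s (T + 1) Q := fun hs => by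
  obtain ⟨N, s', h1, h2, h3⟩ := h' (hs.setVar _ (h hs))
  exact ⟨_, s', .seq (.assign x e s (h hs)) h1, by omega, h3⟩

theorem Runs.put_seq {K : ℕ} {s : State} {a T : ℕ} {i e : Expr} {P : Prog} {Q : State → Prop}
    (h : Bdd K s → e.eval s < K) (h' : Runs K P (s.setArr a (i.eval s) (e.eval s)) T Q) :
    Runs K (.seq (.put a i e) P) s (T + 1) Q := fun hs => by
  obtain ⟨N, s', h1, h2, h3⟩ := h' (hs.setArr _ _ (h hs))
  exact ⟨_, s', .seq (.put a i e s (h hs)) h1, by omega, h3⟩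

theorem Runs.ite {K : ℕ} {s : State} {T : ℕ} {c : Expr} {P P' : Prog} {Q : State → Prop}
    (h : c.eval s ≠ 0 → Runs K P s T Q) (h' : c.eval s = 0 → Runs K P' s T Q) :
    Runs K (.ite c P P') s (T + 1) Q := fun hs => by
  by_cases hc : c.eval s = 0
  · obtain ⟨N, s', h1, h2, h3⟩ := h' hc hs
    exact ⟨_, s', .ite_false hc h1, by omega, h3⟩
  · obtain ⟨N, s', h1, h2, h3⟩ := h hc hs
    exact ⟨_, s', .ite_true hc h1, by omega, h3⟩

/-- A loop whose invariant carries a bound for the number of remaining rounds. -/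
theorem Runs.loop {K b : ℕ} {c : Expr} {P : Prog} (I : ℕ → State → Prop) {s₀ : State} {d : ℕ}
    (h0 : I d s₀)
    (hb : ∀ d s, I d s → Agree P s₀ s → Bdd K s → c.eval s ≠ 0 →
      Runs K P s b fun s' => ∃ d' < d, I d' s') :
    Runs K (.loop c P) s₀ (d * (b + 1) + 1)
      fun s => c.eval s = 0 ∧ (∃ d', I d' s) ∧ Agree P s₀ s := by
  suffices H : ∀ d s, I d s → Agree P s₀ s → Runs K (.loop c P) s (d * (b + 1) + 1)
      fun s => c.eval s = 0 ∧ (∃ d', I d' s) ∧ Agree P s₀ s from H d s₀ h0 (.refl _ _)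
  intro d
  induction d using Nat.strong_induction_on with
  | _ d ih =>
    intro s hI ha hs
    by_cases hc : c.eval s = 0
    · exact ⟨1, s, .loop_false hc, by omega, hc, ⟨d, hI⟩, ha⟩
    · obtain ⟨N, s', h1, h2, d', hd', h3⟩ := hb d s hI ha hs hc hs
      obtain ⟨N', s'', h1', h2', h3'⟩ := ih d' hd' s' h3 (ha.trans h1.agree) (h1.bdd hs)
      refine ⟨_, s'', .loop_true hc h1 h1', ?_, h3'⟩
      have : (d' + 1) * (b + 1) ≤ d * (b + 1) := Nat.mul_le_mul_right _ hd'
      nlinarith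

/-- A loop with exactly `m` rounds. -/
theorem Runs.for {K b m : ℕ} {c : Expr} {P : Prog} (I : ℕ → State → Prop) {s₀ : State}
    (h0 : I 0 s₀) (hc : ∀ i s, i ≤ m → I i s → Agree P s₀ s → (c.eval s ≠ 0 ↔ i < m))
    (hb : ∀ i s, i < m → I i s → Agree P s₀ s → Bdd K s → Runs K P s b (I (i + 1))) :
    Runs K (.loop c P) s₀ (m * (b + 1) + 1) fun s => I m s ∧ Agree P s₀ s := by
  refine (Runs.loop (fun d s => ∃ i, i + d = m ∧ I i s) (d := m) ⟨0, by omega, h0⟩ ?_).mono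
    le_rfl ?_
  · rintro d s ⟨i, hi, hI⟩ ha hs hne
    have := (hc i s (by omega) hI ha).1 hne
    exact (hb i s this hI ha hs).mono le_rfl fun s' _ _ h => ⟨d - 1, by omega, i + 1, by omega, h⟩
  · rintro s - - ⟨h1, ⟨d, i, hi, hI⟩, ha⟩
    have := mt (hc i s (by omega) hI ha).2 (by simpa using h1)
    obtain rfl : i = m := by omega
    exact ⟨hI, ha⟩

/-- A loop whose running time is bounded by a real potential. -/
theorem Runs.loop_potential {K : ℕ} {c : Expr} {P : Prog} (I : ℝ → State → Prop) {s₀ : State}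
    {φ : ℝ} (h0 : I φ s₀) (hpos : ∀ x s, I x s → 0 ≤ x)
    (hb : ∀ x s, I x s → Agree P s₀ s → Bdd K s → c.eval s ≠ 0 →
      ∃ T, Runs K P s T fun s' => ∃ y, y + T + 1 ≤ x ∧ I y s') :
    Runs K (.loop c P) s₀ (⌊φ⌋₊ + 1)
      fun s => c.eval s = 0 ∧ (∃ y, I y s) ∧ Agree P s₀ s := by
  suffices H : ∀ d : ℕ, ∀ x s, ⌊x⌋₊ = d → I x s → Agree P s₀ s →
      Runs K (.loop c P) s (⌊x⌋₊ + 1)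
      fun s => c.eval s = 0 ∧ (∃ y, I y s) ∧ Agree P s₀ s from H _ φ s₀ rfl h0 (.refl _ _)
  intro d
  induction d using Nat.strong_induction_on with
  | _ d ih =>
    intro x s hx hI ha hs
    by_cases hc : c.eval s = 0
    · exact ⟨1, s, .loop_false hc, by omega, hc, ⟨x, hI⟩, ha⟩
    · obtain ⟨T, hT⟩ := hb x s hI ha hs hc
      obtain ⟨N, s', h1, h2, y, hy, h3⟩ := hT hs
      have hy0 := hpos _ _ h3
      -- The cost `T + 1` of a round is an integer, so it can be taken out of the floor; the floors
      -- then bound the steps and serve for the induction.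
      have hfl : ⌊y⌋₊ + (T + 1) ≤ ⌊x⌋₊ := by
        rw [← Nat.floor_add_natCast hy0]
        apply Nat.floor_le_floor
        push_cast; linarith
      obtain ⟨N', s'', h1', h2', h3'⟩ :=
        ih ⌊y⌋₊ (by omega) y s' rfl h3 (ha.trans h1.agree) (h1.bdd hs)
      exact ⟨_, s'', .loop_true hc h1 h1', by omega, h3'⟩

end RAM

/-! ### Merging hub labels -/

/-- Numerical hub labels of `2 * n` owners: the even owner `2 * v` carries the out-label and the odd
owner `2 * v + 1` the in-label of the vertex `v`. The target `T o o'` is determined by the common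
hubs of an even owner `o` and an odd owner `o'`. -/
structure HubData (n D : ℕ) where
  lab : ℕ → Finset ℕ
  dd : ℕ → ℕ → ℕ
  T : ℕ → ℕ → ℕ
  D_lt : D < n
  lab_lt : ∀ {o x}, x ∈ lab o → x < n
  dd_le : ∀ {o x}, x ∈ lab o → dd o x ≤ D
  T_le : ∀ {o o'}, o < 2 * n → o' < 2 * n → o % 2 = 0 → o' % 2 = 1 → T o o' ≤ D
  T_le_add : ∀ {o o' x}, o < 2 * n → o' < 2 * n → o % 2 = 0 → o' % 2 = 1 →
    x ∈ lab o → x ∈ lab o' → T o o' ≤ dd o x + dd o' x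
  exists_hub : ∀ {o o'}, o < 2 * n → o' < 2 * n → o % 2 = 0 → o' % 2 = 1 →
    ∃ x ∈ lab o, x ∈ lab o' ∧ dd o x + dd o' x = T o o'

/-- A partly merged label: the owner, the first hub that has not been considered, and the distance
to the best common hub so far. -/
structure Item where
  o : ℕ
  c : ℕ
  a : ℕ

/-- The sum of `g` over the pairs of an even and an odd owner. -/
def pairSum (g : ℕ → ℕ → ℕ) (l : List Item) : ℕ :=
  (l.map fun i => (l.map fun j => if i.o % 2 = 0 ∧ j.o % 2 = 1 then g i.o j.o else 0).sum).sum

/-! ### Sums over pairs of items and their decomposition. -/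

theorem sum_map_filter {α : Type*} (l : List α) (p : α → Bool) (f : α → ℕ) :
    ((l.filter p).map f).sum = (l.map fun x => if p x then f x else 0).sum := by
  induction l with
  | nil => rfl
  | cons x l ih => by_cases h : p x <;> simp [h, ih]

/-- Rewriting a filtered sum as a sum over the whole list lets the decomposition of a task be
checked pair by pair. -/
theorem pairSum_filter_map (g : ℕ → ℕ → ℕ) (l : List Item) (p : Item → Bool) (f : Item → Item)
    (hf : ∀ i, (f i).o = i.o) :
    pairSum g ((l.filter p).map f) = (l.map fun i => (l.map fun j =>
      if p i ∧ p j ∧ i.o % 2 = 0 ∧ j.o % 2 = 1 then g i.o j.o else 0).sum).sum := by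
  unfold pairSum
  simp only [List.map_map, Function.comp_def, hf, sum_map_filter]
  congr 1
  refine List.map_congr_left fun i _ => ?_
  by_cases hi : p i
  · simp only [hi, if_true]
    congr 1
    refine List.map_congr_left fun j _ => ?_
    by_cases hj : p j <;> simp [hj]
  · simp [hi]

/-- The even owners with key at most `c` and the odd owners with key at least `c`. -/
def lowPart (key : Item → ℕ) (c : ℕ) (i : Item) : Bool :=
  (i.o % 2 = 0 ∧ key i ≤ c) ∨ (i.o % 2 = 1 ∧ c ≤ key i)

/-- The even owners with key at least `c` and the odd owners with key at most `c`. -/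
def highPart (key : Item → ℕ) (c : ℕ) (i : Item) : Bool :=
  (i.o % 2 = 0 ∧ c ≤ key i) ∨ (i.o % 2 = 1 ∧ key i ≤ c)

/-- An even item and an odd item with different keys lie both below `c`, both above `c`, or are
weakly separated by `c` in exactly one direction; a tie at `c` is excluded by `hkey`. The updates do
not matter because `g` sees the owners only. -/
theorem pairSum_split (g : ℕ → ℕ → ℕ) (l : List Item) (key : Item → ℕ) (c : ℕ)
    (hkey : ∀ i ∈ l, ∀ j ∈ l, i.o % 2 = 0 → j.o % 2 = 1 → key i ≠ key j) {f f' : Item → Item}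
    (hf : ∀ i, (f i).o = i.o) (hf' : ∀ i, (f' i).o = i.o) :
    pairSum g l = pairSum g ((l.filter fun i => key i < c).map id) +
      pairSum g ((l.filter fun i => c < key i).map id) +
      pairSum g ((l.filter (lowPart key c)).map f) +
      pairSum g ((l.filter (highPart key c)).map f') := by
  rw [pairSum_filter_map _ _ _ _ hf, pairSum_filter_map _ _ _ _ hf',
    pairSum_filter_map _ _ _ id (fun _ => rfl), pairSum_filter_map _ _ _ id (fun _ => rfl)]
  unfold pairSum
  rw [← List.sum_map_add, ← List.sum_map_add, ← List.sum_map_add]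
  congr 1
  refine List.map_congr_left fun i hi => ?_
  rw [← List.sum_map_add, ← List.sum_map_add, ← List.sum_map_add]
  congr 1
  refine List.map_congr_left fun j hj => ?_
  by_cases h : i.o % 2 = 0 ∧ j.o % 2 = 1
  · have := hkey i hi j hj h.1 h.2
    simp only [h, lowPart, highPart, decide_eq_true_eq]
    simp only [true_and, and_true, zero_ne_one, one_ne_zero, false_and, or_false, false_or,
      if_true]
    rcases lt_trichotomy (key i) c with h1 | h1 | h1 <;>
      rcases lt_trichotomy (key j) c with h2 | h2 | h2 <;>
      first
      | (exfalso; omega)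
      | (simp [h1, h2, h1.le, h2.le, h1.not_ge, h2.not_ge, h1.not_gt, h2.not_gt])
      | (simp [h1, h2, h2.le, h2.not_ge, h2.not_gt])
      | (simp [h1, h2, h1.le, h1.not_ge, h1.not_gt])
  · rw [if_neg h, if_neg (fun h' => h h'.2.2), if_neg (fun h' => h h'.2.2),
      if_neg (fun h' => h h'.2.2), if_neg (fun h' => h h'.2.2)]

/-- The factorisation $X^{a+b}=X^aX^b$ replaces a sum over pairs by two sums over items; this is
what makes a fully merged task cheap. -/
theorem pairSum_eq_mul (X : ℕ) (T : ℕ → ℕ → ℕ) (l : List Item)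
    (h : ∀ i ∈ l, ∀ j ∈ l, i.o % 2 = 0 → j.o % 2 = 1 → i.a + j.a = T i.o j.o) :
    pairSum (fun o o' => X ^ T o o') l =
      (l.map fun i => if i.o % 2 = 0 then X ^ i.a else 0).sum *
      (l.map fun i => if i.o % 2 = 0 then 0 else X ^ i.a).sum := by
  unfold pairSum
  rw [← List.sum_map_mul_right]
  congr 1
  refine List.map_congr_left fun i hi => ?_
  rw [← List.sum_map_mul_left]
  congr 1
  refine List.map_congr_left fun j hj => ?_
  rcases Nat.mod_two_eq_zero_or_one i.o with h1 | h1 <;>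
    rcases Nat.mod_two_eq_zero_or_one j.o with h2 | h2 <;> simp [h1, h2]
  rw [← h i hi j hj h1 h2, pow_add]

theorem pairSum_eq_zero (g : ℕ → ℕ → ℕ) (l : List Item)
    (h : ¬ ((∃ i ∈ l, i.o % 2 = 0) ∧ ∃ i ∈ l, i.o % 2 = 1)) : pairSum g l = 0 := by
  unfold pairSum
  rw [List.sum_eq_zero]
  intro x hx
  obtain ⟨i, hi, rfl⟩ := List.mem_map.1 hx
  rw [List.sum_eq_zero]
  intro y hy
  obtain ⟨j, hj, rfl⟩ := List.mem_map.1 hy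
  rw [if_neg]
  exact fun h' => h ⟨⟨i, hi, h'.1⟩, ⟨j, hj, h'.2⟩⟩

/-! ### Simulated merging of two sorted labels, and tasks of pairs in the same phase. -/

namespace HubData

variable {n D : ℕ} (H : HubData n D)

/-- The least hub of owner `o` that is at least `c`, or `n` if there is none. -/
def nxt (o c : ℕ) : ℕ :=
  (insert n ((H.lab o).filter (c ≤ ·))).min' (Finset.insert_nonempty _ _)

theorem nxt_le (o c : ℕ) : H.nxt o c ≤ n :=
  Finset.min'_le _ _ (Finset.mem_insert_self _ _)

theorem nxt_le_of_mem {o c x : ℕ} (hx : x ∈ H.lab o) (hc : c ≤ x) : H.nxt o c ≤ x :=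
  Finset.min'_le _ _ (by simp [hx, hc])

theorem nxt_mem {o c : ℕ} (h : H.nxt o c < n) : H.nxt o c ∈ H.lab o ∧ c ≤ H.nxt o c := by
  have := Finset.min'_mem (insert n ((H.lab o).filter (c ≤ ·))) (Finset.insert_nonempty _ _)
  change H.nxt o c ∈ _ at this
  rw [Finset.mem_insert, Finset.mem_filter] at this
  rcases this with h' | h'
  · omega
  · exact h'

/-- The form in which a linear scan through an unsorted label delivers the next hub, with `n` as the
value for an exhausted label. -/
theorem eq_nxt {o c b : ℕ} (h1 : b ≤ n) (h2 : b < n → b ∈ H.lab o ∧ c ≤ b)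
    (h3 : ∀ x ∈ H.lab o, c ≤ x → b ≤ x) : b = H.nxt o c := by
  have hle := H.nxt_le o c
  apply le_antisymm
  · rcases hle.lt_or_eq with h | h
    · exact h3 _ (H.nxt_mem h).1 (H.nxt_mem h).2
    · omega
  · rcases h1.lt_or_eq with h | h
    · exact H.nxt_le_of_mem (h2 h).1 (h2 h).2
    · omega

/-- The number of hubs of an owner that have not been considered. -/
def rest (o c : ℕ) : ℕ := ((H.lab o).filter (c ≤ ·)).card

theorem rest_succ_nxt {o c : ℕ} (h : H.nxt o c < n) :
    H.rest o (H.nxt o c + 1) + 1 ≤ H.rest o c := by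
  obtain ⟨h1, h2⟩ := H.nxt_mem h
  apply Finset.card_lt_card
  refine Finset.ssubset_iff_of_subset (fun x hx => ?_) |>.2 ⟨H.nxt o c, ?_, ?_⟩
  · simp only [Finset.mem_filter] at hx ⊢
    exact ⟨hx.1, by omega⟩
  · simp [h1, h2]
  · simp

/-- The next hub of an item. -/
def hub (i : Item) : ℕ := H.nxt i.o i.c

/-- The distance to the next hub of an item. -/
def hubDist (i : Item) : ℕ := H.dd i.o (H.hub i)

theorem hub_le (i : Item) : H.hub i ≤ n := H.nxt_le _ _

theorem hub_le_of_mem {i : Item} {x : ℕ} (hx : x ∈ H.lab i.o) (hc : i.c ≤ x) : H.hub i ≤ x :=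
  H.nxt_le_of_mem hx hc

theorem hub_mem {i : Item} (h : H.hub i < n) : H.hub i ∈ H.lab i.o ∧ i.c ≤ H.hub i :=
  H.nxt_mem h

theorem rest_succ_hub {i : Item} (h : H.hub i < n) :
    H.rest i.o (H.hub i + 1) + 1 ≤ H.rest i.o i.c := H.rest_succ_nxt h

/-- Items that occur during the merging. -/
def Valid (i : Item) : Prop :=
  i.o < 2 * n ∧ i.a ≤ n ∧ (i.c = 0 ∨ ∃ x ∈ H.lab i.o, i.c = x + 1)

/-- The key by which two items are compared. In phase `0` an even item has a smaller key than an odd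
item iff its next hub is at most that of the odd one, in phase `1` iff it is smaller, and in phase
`2` iff the next hub, which is then common, is at least as good as the best one so far. -/
def key (ph : ℕ) (i : Item) : ℕ :=
  if ph = 2 then
    (if i.o % 2 = 0 then 2 * (n + H.hubDist i - i.a) else 2 * (n + i.a - H.hubDist i) + 1)
  else 2 * H.hub i + (i.o + ph) % 2

/-- The update of the items of a pair whose even key is smaller. -/
def lowStep (ph : ℕ) (i : Item) : Item :=
  if ph = 2 then ⟨i.o, H.hub i + 1, H.hubDist i⟩
  else if ph = 1 ∧ i.o % 2 = 0 then ⟨i.o, H.hub i + 1, i.a⟩ else i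

/-- The update of the items of a pair whose even key is larger. -/
def highStep (ph : ℕ) (i : Item) : Item :=
  if ph = 2 ∨ (ph = 0 ∧ i.o % 2 = 1) then ⟨i.o, H.hub i + 1, i.a⟩ else i

/-- What is known about a pair of items. -/
structure PairOK (ph : ℕ) (i j : Item) : Prop where
  le : H.T i.o j.o ≤ i.a + j.a
  ex : i.a + j.a = H.T i.o j.o ∨ ∃ x ∈ H.lab i.o, x ∈ H.lab j.o ∧ i.c ≤ x ∧ j.c ≤ x ∧
    H.dd i.o x + H.dd j.o x = H.T i.o j.o
  hub_le : ph = 1 → H.hub i ≤ H.hub j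
  hub_eq : ph = 2 → H.hub i = H.hub j

/-- A bound for the number of comparisons that a pair has still to undergo. -/
def rank (ph : ℕ) (i j : Item) : ℕ := 3 * (H.rest i.o i.c + H.rest j.o j.c) + (3 - ph)

theorem lowStep_o (ph : ℕ) (i : Item) : (H.lowStep ph i).o = i.o := by
  unfold lowStep; split_ifs <;> rfl

theorem highStep_o (ph : ℕ) (i : Item) : (H.highStep ph i).o = i.o := by
  unfold highStep; split_ifs <;> rfl

variable {H}

theorem hubDist_le {i : Item} (h : H.hub i < n) : H.hubDist i ≤ n :=
  (H.dd_le (H.hub_mem h).1).trans H.D_lt.le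

theorem Valid.succ_hub {i : Item} (hi : H.Valid i) (h : H.hub i < n) {a : ℕ} (ha : a ≤ n) :
    H.Valid ⟨i.o, H.hub i + 1, a⟩ :=
  ⟨hi.1, ha, Or.inr ⟨_, (H.hub_mem h).1, rfl⟩⟩

/-- Phase `0` learns that the even hub is at most the odd one and passes to phase `1`. Phase `1`
learns that it is strictly smaller, so it is no common hub and is skipped. Phase `2` has a common
hub that is at least as good as the current value, which is replaced. Skipping a hub lowers the rank
by at least `3`, which outweighs the return to phase `0`. -/
theorem pair_low {ph : ℕ} (hph : ph ≤ 2) {i j : Item} (hi : H.Valid i) (hj : H.Valid j)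
    (hi0 : i.o % 2 = 0) (hj1 : j.o % 2 = 1) (hp : H.PairOK ph i j) (hn : ph = 2 → H.hub i < n)
    (hk : H.key ph i < H.key ph j) :
    H.PairOK (if ph = 0 then 1 else 0) (H.lowStep ph i) (H.lowStep ph j) ∧
    H.Valid (H.lowStep ph i) ∧ H.Valid (H.lowStep ph j) ∧
    H.rank (if ph = 0 then 1 else 0) (H.lowStep ph i) (H.lowStep ph j) + 1 ≤ H.rank ph i j := by
  obtain ⟨h1, h2, h3, h4⟩ := hp
  have hjn := H.hub_le j
  have hin := H.hub_le i
  interval_cases ph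
  · simp only [key, OfNat.zero_ne_ofNat, if_false] at hk
    have hle : H.hub i ≤ H.hub j := by omega
    simp only [lowStep, OfNat.zero_ne_ofNat, if_false, zero_ne_one, false_and, if_true]
    exact ⟨⟨h1, h2, fun _ => hle, by simp⟩, hi, hj, by simp [rank]⟩
  · simp only [key, OfNat.one_ne_ofNat, if_false] at hk
    have hlt : H.hub i < H.hub j := by omega
    have hlt' : H.hub i < n := by omega
    simp only [lowStep, OfNat.one_ne_ofNat, if_false, hi0, hj1, true_and, if_true, one_ne_zero,
      and_false]
    refine ⟨⟨h1, ?_, by simp, by simp⟩, hi.succ_hub hlt' hi.2.1, hj, ?_⟩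
    -- A remaining optimal hub lies in the odd label too, hence is at least the next odd hub and so
    -- beyond the skipped even one.
    · refine h2.imp id fun ⟨x, hx, hx', hc, hc', he⟩ => ⟨x, hx, hx', ?_, hc', he⟩
      have := H.hub_le_of_mem hx' hc'
      simp only
      omega
    · have := H.rest_succ_hub hlt'
      simp only [rank] at *
      omega
  · have he := h4 rfl
    have hlt := hn rfl
    have hlt' : H.hub j < n := by omega
    have hdi := hubDist_le hlt
    have hdj := hubDist_le hlt'
    have hmi := H.hub_mem hlt
    have hmj := H.hub_mem hlt'
    simp only [key, if_true, hi0, hj1, one_ne_zero, if_false] at hk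
    have hia := hi.2.1
    have hja := hj.2.1
    -- The summand `n` in the keys keeps the truncated subtractions exact, and the odd key's extra
    -- `1` turns the strict comparison into a weak one.
    have hle : H.hubDist i + H.hubDist j ≤ i.a + j.a := by omega
    have hT : H.T i.o j.o ≤ H.hubDist i + H.hubDist j := by
      have := H.T_le_add hi.1 hj.1 hi0 hj1 hmi.1 (by rw [he]; exact hmj.1)
      rw [hubDist, hubDist, ← he]; exact this
    simp only [lowStep, if_true, OfNat.ofNat_ne_zero, if_false]
    refine ⟨⟨hT, ?_, by simp, by simp⟩, hi.succ_hub hlt hdi, hj.succ_hub hlt' hdj, ?_⟩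
    -- If the old value was already exact, the new one is squeezed between the target and it.
    -- Otherwise the optimal hub is either the current common hub, which makes the new value exact,
    -- or a later one, which survives.
    · rcases h2 with h2 | ⟨x, hx, hx', hc, hc', hxe⟩
      · left; simp only; omega
      · have g1 := H.hub_le_of_mem hx hc
        have g2 := H.hub_le_of_mem hx' hc'
        rcases g1.lt_or_eq with g | g
        · right
          refine ⟨x, hx, hx', ?_, ?_, hxe⟩ <;> simp only <;> omega
        · left
          simp only [hubDist, ← he, g]; exact hxe
    · have := H.rest_succ_hub hlt
      have := H.rest_succ_hub hlt'
      simp only [rank] at *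
      omega

/-- Phase `0` skips an odd hub that precedes every remaining even one. Phase `1` already knows one
inequality between the hubs and learns the other, so they coincide. Phase `2` discards a common hub
that is strictly worse than the current value. -/
theorem pair_high {ph : ℕ} (hph : ph ≤ 2) {i j : Item} (hi : H.Valid i) (hj : H.Valid j)
    (hi0 : i.o % 2 = 0) (hj1 : j.o % 2 = 1) (hp : H.PairOK ph i j) (hn : ph = 2 → H.hub i < n)
    (hk : H.key ph j < H.key ph i) :
    H.PairOK (if ph = 1 then 2 else 0) (H.highStep ph i) (H.highStep ph j) ∧
    H.Valid (H.highStep ph i) ∧ H.Valid (H.highStep ph j) ∧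
    H.rank (if ph = 1 then 2 else 0) (H.highStep ph i) (H.highStep ph j) + 1 ≤ H.rank ph i j := by
  obtain ⟨h1, h2, h3, h4⟩ := hp
  have hjn := H.hub_le j
  have hin := H.hub_le i
  interval_cases ph
  · simp only [key, OfNat.zero_ne_ofNat, if_false] at hk
    have hlt : H.hub j < H.hub i := by omega
    have hlt' : H.hub j < n := by omega
    simp only [highStep, OfNat.zero_ne_ofNat, if_false, hi0, hj1, true_and, if_true, zero_ne_one,
      and_false, false_or]
    refine ⟨⟨h1, ?_, by simp, by simp⟩, hi, hj.succ_hub hlt' hj.2.1, ?_⟩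
    · refine h2.imp id fun ⟨x, hx, hx', hc, hc', he⟩ => ⟨x, hx, hx', hc, ?_, he⟩
      have := H.hub_le_of_mem hx hc
      simp only
      omega
    · have := H.rest_succ_hub hlt'
      simp only [rank] at *
      omega
  · simp only [key, OfNat.one_ne_ofNat, if_false] at hk
    have hle : H.hub j ≤ H.hub i := by omega
    have := h3 rfl
    simp only [highStep, OfNat.one_ne_ofNat, if_false, one_ne_zero, false_and, if_true, or_false]
    exact ⟨⟨h1, h2, by simp, fun _ => le_antisymm this hle⟩, hi, hj, by simp [rank]⟩
  · have he := h4 rfl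
    have hlt := hn rfl
    have hlt' : H.hub j < n := by omega
    have hdi := hubDist_le hlt
    have hdj := hubDist_le hlt'
    have hmi := H.hub_mem hlt
    have hmj := H.hub_mem hlt'
    simp only [key, if_true, hi0, hj1, one_ne_zero, if_false] at hk
    have hia := hi.2.1
    have hja := hj.2.1
    have hle : i.a + j.a < H.hubDist i + H.hubDist j := by omega
    simp only [highStep, true_or, if_true, OfNat.ofNat_ne_one, if_false]
    refine ⟨⟨h1, ?_, by simp, by simp⟩, hi.succ_hub hlt hia, hj.succ_hub hlt' hja, ?_⟩
    · rcases h2 with h2 | ⟨x, hx, hx', hc, hc', hxe⟩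
      · left; exact h2
      · have g1 := H.hub_le_of_mem hx hc
        have g2 := H.hub_le_of_mem hx' hc'
        rcases g1.lt_or_eq with g | g
        · right
          refine ⟨x, hx, hx', ?_, ?_, hxe⟩ <;> simp only <;> omega
        -- The discarded hub cannot be the optimal one, for the current value is smaller than its
        -- sum but never below the target.
        · exfalso
          rw [hubDist, hubDist, ← he, g, hxe] at hle
          omega
    · have := H.rest_succ_hub hlt
      have := H.rest_succ_hub hlt'
      simp only [rank] at *
      omega

/-- All hubs are less than `n`, so no optimal hub can remain and the stored value must be exact. -/
theorem PairOK.final {i j : Item} (hp : H.PairOK 2 i j) (hn : H.hub i = n) :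
    i.a + j.a = H.T i.o j.o := by
  rcases hp.ex with h | ⟨x, hx, hx', hc, hc', hxe⟩
  · exact h
  · have := H.hub_le_of_mem hx hc
    have := H.lab_lt hx
    have : H.hub i = n := hn
    omega

variable (H)

/-- The keys of even and odd owners have opposite parity in every phase, so no pair is lost to a
tie. -/
theorem key_ne {ph : ℕ} (hph : ph ≤ 2) {i j : Item} (hi0 : i.o % 2 = 0) (hj1 : j.o % 2 = 1) :
    H.key ph i ≠ H.key ph j := by
  unfold key
  interval_cases ph
  · simp; omega
  · simp; omega
  · simp [hi0, hj1]; omega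

/-- A set of items all of whose pairs are in the same phase, with a bound `r` for their ranks. -/
structure Task where
  ph : ℕ
  r : ℕ
  items : List Item

/-- The invariant of a task. -/
structure TaskOK (t : Task) : Prop where
  ph_le : t.ph ≤ 2
  even : ∃ i ∈ t.items, i.o % 2 = 0
  odd : ∃ i ∈ t.items, i.o % 2 = 1
  valid : ∀ i ∈ t.items, H.Valid i
  pair : ∀ i ∈ t.items, ∀ j ∈ t.items, i.o % 2 = 0 → j.o % 2 = 1 →
    H.PairOK t.ph i j ∧ H.rank t.ph i j ≤ t.r

variable {H}

/-- The summand `3 - ph` keeps ranks positive, so the truncated `t.r - 1` of the decided parts is a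
genuine decrease. -/
theorem TaskOK.one_le_r {t : Task} (h : H.TaskOK t) : 1 ≤ t.r := by
  obtain ⟨i, hi, hi0⟩ := h.even
  obtain ⟨j, hj, hj1⟩ := h.odd
  have := (h.pair i hi j hj hi0 hj1).2
  have := h.ph_le
  unfold rank at *
  omega

theorem TaskOK.filter {t : Task} (h : H.TaskOK t) (p : Item → Bool)
    (he : ∃ i ∈ t.items.filter p, i.o % 2 = 0) (ho : ∃ i ∈ t.items.filter p, i.o % 2 = 1) :
    H.TaskOK ⟨t.ph, t.r, t.items.filter p⟩ :=
  ⟨h.ph_le, he, ho, fun i hi => h.valid i (List.mem_filter.1 hi).1,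
    fun i hi j hj => h.pair i (List.mem_filter.1 hi).1 j (List.mem_filter.1 hj).1⟩

theorem hub_lt_of_ne {t : Task} (hn : t.ph = 2 → ∀ i ∈ t.items, H.hub i ≠ n)
    {i : Item} (hi : i ∈ t.items) (hp : t.ph = 2) : H.hub i < n :=
  lt_of_le_of_ne (H.hub_le _) (hn hp i hi)

/-- Since both parities occur, every item has a partner, and the validity of single items can be
read off from facts about pairs. -/
theorem TaskOK.of_pairs {l : List Item} {f : Item → Item} (hf : ∀ i, (f i).o = i.o) {ph r : ℕ}
    (hph : ph ≤ 2) (he : ∃ i ∈ l, i.o % 2 = 0) (ho : ∃ i ∈ l, i.o % 2 = 1)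
    (h : ∀ i ∈ l, ∀ j ∈ l, i.o % 2 = 0 → j.o % 2 = 1 → H.PairOK ph (f i) (f j) ∧
      H.Valid (f i) ∧ H.Valid (f j) ∧ H.rank ph (f i) (f j) ≤ r) :
    H.TaskOK ⟨ph, r, l.map f⟩ := by
  obtain ⟨i₀, hi₀, hi₀'⟩ := he
  obtain ⟨j₀, hj₀, hj₀'⟩ := ho
  refine ⟨hph, ⟨f i₀, List.mem_map_of_mem hi₀, by rw [hf]; exact hi₀'⟩,
    ⟨f j₀, List.mem_map_of_mem hj₀, by rw [hf]; exact hj₀'⟩, ?_, ?_⟩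
  · intro x hx
    obtain ⟨i, hi, rfl⟩ := List.mem_map.1 hx
    rcases Nat.mod_two_eq_zero_or_one i.o with h' | h'
    · exact (h i hi j₀ hj₀ h' hj₀').2.1
    · exact (h i₀ hi₀ i hi hi₀' h').2.2.1
  · intro x hx y hy
    obtain ⟨i, hi, rfl⟩ := List.mem_map.1 hx
    obtain ⟨j, hj, rfl⟩ := List.mem_map.1 hy
    intro hi0 hj1
    rw [hf] at hi0 hj1
    exact ⟨(h i hi j hj hi0 hj1).1, (h i hi j hj hi0 hj1).2.2.2⟩

theorem TaskOK.low {t : Task} (h : H.TaskOK t) (hn : t.ph = 2 → ∀ i ∈ t.items, H.hub i ≠ n)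
    (c : ℕ) (he : ∃ i ∈ t.items.filter (lowPart (H.key t.ph) c), i.o % 2 = 0)
    (ho : ∃ i ∈ t.items.filter (lowPart (H.key t.ph) c), i.o % 2 = 1) :
    H.TaskOK ⟨if t.ph = 0 then 1 else 0, t.r - 1,
      (t.items.filter (lowPart (H.key t.ph) c)).map (H.lowStep t.ph)⟩ := by
  refine TaskOK.of_pairs (H.lowStep_o _) (by split_ifs <;> omega) he ho ?_
  intro i hi j hj hi0 hj1
  rw [List.mem_filter] at hi hj
  have hki : H.key t.ph i ≤ c := by simpa [lowPart, hi0] using hi.2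
  have hkj : c ≤ H.key t.ph j := by simpa [lowPart, hj1] using hj.2
  have hlt := lt_of_le_of_ne (hki.trans hkj) (H.key_ne h.ph_le hi0 hj1)
  have hp := h.pair i hi.1 j hj.1 hi0 hj1
  obtain ⟨g1, g2, g3, g4⟩ := pair_low h.ph_le (h.valid i hi.1) (h.valid j hj.1) hi0 hj1 hp.1
    (hub_lt_of_ne hn hi.1) hlt
  exact ⟨g1, g2, g3, by omega⟩

theorem TaskOK.high {t : Task} (h : H.TaskOK t) (hn : t.ph = 2 → ∀ i ∈ t.items, H.hub i ≠ n)
    (c : ℕ) (he : ∃ i ∈ t.items.filter (highPart (H.key t.ph) c), i.o % 2 = 0)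
    (ho : ∃ i ∈ t.items.filter (highPart (H.key t.ph) c), i.o % 2 = 1) :
    H.TaskOK ⟨if t.ph = 1 then 2 else 0, t.r - 1,
      (t.items.filter (highPart (H.key t.ph) c)).map (H.highStep t.ph)⟩ := by
  refine TaskOK.of_pairs (H.highStep_o _) (by split_ifs <;> omega) he ho ?_
  intro i hi j hj hi0 hj1
  rw [List.mem_filter] at hi hj
  have hki : c ≤ H.key t.ph i := by simpa [highPart, hi0] using hi.2
  have hkj : H.key t.ph j ≤ c := by simpa [highPart, hj1] using hj.2
  have hlt := lt_of_le_of_ne (hkj.trans hki) (H.key_ne h.ph_le hi0 hj1).symm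
  have hp := h.pair i hi.1 j hj.1 hi0 hj1
  obtain ⟨g1, g2, g3, g4⟩ := pair_high h.ph_le (h.valid i hi.1) (h.valid j hj.1) hi0 hj1 hp.1
    (hub_lt_of_ne hn hi.1) hlt
  exact ⟨g1, g2, g3, by omega⟩

/-- In phase `2` all the items of a task have the same next hub. -/
theorem TaskOK.hub_eq {t : Task} (h : H.TaskOK t) (hp : t.ph = 2) {i j : Item}
    (hi : i ∈ t.items) (hj : j ∈ t.items) : H.hub i = H.hub j := by
  obtain ⟨i₀, hi₀, hi₀'⟩ := h.even
  obtain ⟨j₀, hj₀, hj₀'⟩ := h.odd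
  have key : ∀ i ∈ t.items, H.hub i = H.hub i₀ := by
    intro i hi
    rcases Nat.mod_two_eq_zero_or_one i.o with h' | h'
    · rw [(h.pair i hi j₀ hj₀ h' hj₀').1.hub_eq hp, (h.pair i₀ hi₀ j₀ hj₀ hi₀' hj₀').1.hub_eq hp]
    · rw [(h.pair i₀ hi₀ i hi hi₀' h').1.hub_eq hp]
  rw [key i hi, key j hj]

/-- The bound is the initial interval of the bisection for the median. In phase `2` a next hub must
exist for its distance to be bounded. -/
theorem key_le {ph : ℕ} {i : Item} (hi : H.Valid i) (hn : ph = 2 → H.hub i < n) :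
    H.key ph i ≤ 4 * n + 1 := by
  have h1 := hi.2.1
  have h2 := H.hub_le i
  unfold key
  split_ifs with h h'
  · have := hubDist_le (hn h); omega
  · omega
  · omega

end HubData

/-- The potential of a split task pays for its parts and for its size. -/
theorem potential_split {A δ : ℝ} (hδ : 0 < δ) (hA0 : 0 < A) (hA : (2 : ℝ) ^ (-δ) + 3 / A ≤ 1)
    {r m m₁ m₂ m₃ m₄ : ℕ} (hr : 1 ≤ r) (hm : 1 ≤ m) (h₁ : 2 * m₁ ≤ m) (h₂ : 2 * m₂ ≤ m)
    (h₃ : m₃ ≤ m) (h₄ : m₄ ≤ m) :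
    A ^ r * (m₁ : ℝ) ^ (1 + δ) + A ^ r * (m₂ : ℝ) ^ (1 + δ) + A ^ (r - 1) * (m₃ : ℝ) ^ (1 + δ) +
      A ^ (r - 1) * (m₄ : ℝ) ^ (1 + δ) + m ≤ A ^ r * (m : ℝ) ^ (1 + δ) := by
  have hm0 : (0 : ℝ) < m := by exact_mod_cast hm
  have hA1 : 1 ≤ A := by
    have : 3 / A ≤ 1 := by
      have := Real.rpow_pos_of_pos (show (0 : ℝ) < 2 by norm_num) (-δ)
      linarith
    rw [div_le_one hA0] at this; linarith
  have half : ∀ k : ℕ, 2 * k ≤ m → (k : ℝ) ^ (1 + δ) ≤ (2 : ℝ) ^ (-δ) / 2 * (m : ℝ) ^ (1 + δ) := by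
    intro k hk
    have hk' : (k : ℝ) ≤ m / 2 := by
      rw [le_div_iff₀ (by norm_num)]; exact_mod_cast by omega
    calc (k : ℝ) ^ (1 + δ) ≤ ((m : ℝ) / 2) ^ (1 + δ) :=
          Real.rpow_le_rpow (by positivity) hk' (by linarith)
      _ = (2 : ℝ) ^ (-δ) / 2 * (m : ℝ) ^ (1 + δ) := by
          rw [Real.div_rpow hm0.le (by norm_num), Real.rpow_add (by norm_num : (0 : ℝ) < 2),
            Real.rpow_one, Real.rpow_neg (by norm_num)]
          field_simp
  have full : ∀ k : ℕ, k ≤ m → (k : ℝ) ^ (1 + δ) ≤ (m : ℝ) ^ (1 + δ) := fun k hk =>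
    Real.rpow_le_rpow (by positivity) (by exact_mod_cast hk) (by linarith)
  have hmm : (m : ℝ) ≤ (m : ℝ) ^ (1 + δ) := by
    conv_lhs => rw [← Real.rpow_one (m : ℝ)]
    exact Real.rpow_le_rpow_of_exponent_le (by exact_mod_cast hm) (by linarith)
  obtain ⟨r, rfl⟩ : ∃ r', r = r' + 1 := ⟨r - 1, by omega⟩
  rw [Nat.add_sub_cancel]
  set M := (m : ℝ) ^ (1 + δ)
  have hM : 0 < M := Real.rpow_pos_of_pos hm0 _
  have hAr : 1 ≤ A ^ r := one_le_pow₀ hA1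
  have e1 := mul_le_mul_of_nonneg_left (half m₁ h₁) (show 0 ≤ A ^ (r + 1) by positivity)
  have e2 := mul_le_mul_of_nonneg_left (half m₂ h₂) (show 0 ≤ A ^ (r + 1) by positivity)
  have e3 := mul_le_mul_of_nonneg_left (full m₃ h₃) (show 0 ≤ A ^ r by positivity)
  have e4 := mul_le_mul_of_nonneg_left (full m₄ h₄) (show 0 ≤ A ^ r by positivity)
  have e5 : M ≤ A ^ r * M := le_mul_of_one_le_left hM.le hAr
  -- The share $2^{-\delta}$ pays for the two half-size parts; of the three shares $1/A$, two pay
  -- for the decided parts of full size and one for the summand `m`.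
  have e6 : ((2 : ℝ) ^ (-δ) + 3 / A) * (A ^ (r + 1) * M) ≤ 1 * (A ^ (r + 1) * M) :=
    mul_le_mul_of_nonneg_right hA (by positivity)
  have e7 : ((2 : ℝ) ^ (-δ) + 3 / A) * (A ^ (r + 1) * M) =
      (2 : ℝ) ^ (-δ) * (A ^ (r + 1) * M) + 3 * (A ^ r * M) := by
    rw [pow_succ]; field_simp
  linarith

/-! ### The program

Registers: `0`–`3` output, `4` the number `n`, `5` the base `X`, `6` read position, `7` owner,
`8` label length, `9` label index, `10` cut, `11` and `12` best hub and its distance, `13` index,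
`14` hub, `15` number of tasks, `16` number of stored items, `17` accumulator, `18` phase,
`19` start of the task, `20` size of the task, `21` number of even owners, `22`–`24` bisection,
`25` counter, `26` start of the new task, `27` and `28` partial sums, `29` power, `30` exponent,
`31` number of digits.

Arrays: `0` input, `1` and `2` next hubs and their distances, `3`–`5` stored items, `6` and `7`
phases and starts of the stored tasks, `8`–`10` items of the current task, `11` their keys,
`12` digits. -/

namespace RAM

open RAM.Expr (get eq lt)

infixr:40 " ;; " => Prog.seq
infix:50 " ≔ " => Prog.assign
prefix:max "‡" => Expr.var

/-- Find the least hub of the current label that is at least the cut. -/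
def scanLabel : Prog :=
  11 ≔ ‡4 ;; 12 ≔ 0 ;; 13 ≔ 0 ;;
  .loop (lt ‡13 ‡8) (
    14 ≔ get 0 (‡6 + 1 + 2 * ‡13) ;;
    .ite (lt ‡14 ‡11 * lt ‡10 (‡14 + 1)) (11 ≔ ‡14 ;; 12 ≔ get 0 (‡6 + 2 + 2 * ‡13)) .skip ;;
    13 ≔ ‡13 + 1)

/-- Tabulate the next hubs of the current label after every cut that can occur. -/
def tabulateLabel : Prog :=
  .loop (lt ‡9 (‡8 + 1)) (
    scanLabel ;;
    .put 1 (‡7 * (‡4 + 1) + ‡10) ‡11 ;;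
    .put 2 (‡7 * (‡4 + 1) + ‡10) ‡12 ;;
    -- The next cut lies just behind the current hub. The last round reads past the end of the
    -- label; that cut is never used.
    10 ≔ get 0 (‡6 + 1 + 2 * ‡9) + 1 ;;
    9 ≔ ‡9 + 1)

/-- Tabulate all labels and store the initial items. -/
def readInput : Prog :=
  .loop (lt ‡7 (2 * ‡4)) (
    8 ≔ get 0 ‡6 ;;
    -- The starting value `n` plays the role of infinity, as it exceeds every distance.
    .put 3 ‡7 ‡7 ;; .put 4 ‡7 0 ;; .put 5 ‡7 ‡4 ;;
    10 ≔ 0 ;; 9 ≔ 0 ;;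
    tabulateLabel ;;
    6 ≔ ‡6 + 1 + 2 * ‡8 ;; 7 ≔ ‡7 + 1)

/-- The address of the current item in the table. -/
def slot (j : Expr) : Expr := get 8 j * (‡4 + 1) + get 9 j

/-- The key of the current item. -/
def keyExpr : Expr :=
  eq ‡18 2 * (eq (get 8 ‡13 % 2) 0 * (2 * (‡4 + get 2 (slot ‡13) - get 10 ‡13)) +
    (get 8 ‡13 % 2) * (2 * (‡4 + get 10 ‡13 - get 2 (slot ‡13)) + 1)) +
  (1 - eq ‡18 2) * (2 * get 1 (slot ‡13) + (get 8 ‡13 + ‡18) % 2)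

/-- Copy the items of the current task and compute their keys. -/
def copyTask : Prog :=
  .loop (lt ‡13 ‡20) (
    .put 8 ‡13 (get 3 (‡19 + ‡13)) ;; .put 9 ‡13 (get 4 (‡19 + ‡13)) ;;
    .put 10 ‡13 (get 5 (‡19 + ‡13)) ;; .put 11 ‡13 keyExpr ;; 13 ≔ ‡13 + 1)

/-- Account for the pairs of a completely merged task. -/
def finishTask : Prog :=
  27 ≔ 0 ;; 28 ≔ 0 ;; 13 ≔ 0 ;;
  .loop (lt ‡13 ‡20) (
    29 ≔ 1 ;; 30 ≔ 0 ;;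
    .loop (lt ‡30 (get 10 ‡13)) (29 ≔ ‡29 * ‡5 ;; 30 ≔ ‡30 + 1) ;;
    .ite (get 8 ‡13 % 2) (28 ≔ ‡28 + ‡29) (27 ≔ ‡27 + ‡29) ;;
    13 ≔ ‡13 + 1) ;;
  17 ≔ ‡17 + ‡27 * ‡28

/-- Count the keys that are at most the middle of the current interval. -/
def countKeys : Prog :=
  25 ≔ 0 ;; 13 ≔ 0 ;;
  .loop (lt ‡13 ‡20) (25 ≔ ‡25 + lt (get 11 ‡13) (‡24 + 1) ;; 13 ≔ ‡13 + 1)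

/-- Find the median of the keys by bisection. -/
def findMedian : Prog :=
  22 ≔ 0 ;; 23 ≔ 4 * ‡4 + 1 ;;
  .loop (lt ‡22 ‡23) (
    24 ≔ (‡22 + ‡23) / 2 ;; countKeys ;;
    .ite (lt (2 * ‡25) ‡20) (22 ≔ ‡24 + 1) (23 ≔ ‡24))

/-- Store the updated items that satisfy a condition as a new task, unless it has no pairs. -/
def pushTask (cond newc newa newph : Expr) : Prog :=
  26 ≔ ‡16 ;; 21 ≔ 0 ;; 13 ≔ 0 ;;
  .loop (lt ‡13 ‡20) (
    .ite cond (
      .put 3 ‡16 (get 8 ‡13) ;; .put 4 ‡16 newc ;; .put 5 ‡16 newa ;; 16 ≔ ‡16 + 1 ;;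
      21 ≔ ‡21 + eq (get 8 ‡13 % 2) 0) .skip ;;
    13 ≔ ‡13 + 1) ;;
  -- Both parities occur iff the number of even owners is positive and less than the number of new
  -- items.
  .ite (lt 0 ‡21 * lt ‡21 (‡16 - ‡26))
    (.put 6 ‡15 newph ;; .put 7 ‡15 ‡26 ;; 15 ≔ ‡15 + 1) (16 ≔ ‡26)

/-- The condition that an item of the current task belongs to the low part. -/
def lowCond : Expr :=
  eq (get 8 ‡13 % 2) 0 * lt (get 11 ‡13) (‡22 + 1) + get 8 ‡13 % 2 * lt ‡22 (get 11 ‡13 + 1)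

/-- The condition that an item of the current task belongs to the high part. -/
def highCond : Expr :=
  eq (get 8 ‡13 % 2) 0 * lt ‡22 (get 11 ‡13 + 1) + get 8 ‡13 % 2 * lt (get 11 ‡13) (‡22 + 1)

/-- The cut of the current item, moved behind its next hub if the condition has value `1`. -/
def moveCut (cond : Expr) : Expr :=
  cond * (get 1 (slot ‡13) + 1) + (1 - cond) * get 9 ‡13

/-- Whether the current item moves on when the even key is smaller. -/
def lowMove : Expr := eq ‡18 2 + eq ‡18 1 * eq (get 8 ‡13 % 2) 0

/-- Whether the current item moves on when the even key is larger. -/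
def highMove : Expr := eq ‡18 2 + eq ‡18 0 * (get 8 ‡13 % 2)

/-- Split the current task at the median of its keys. -/
def splitTask : Prog :=
  findMedian ;;
  pushTask (lt (get 11 ‡13) ‡22) (get 9 ‡13) (get 10 ‡13) ‡18 ;;
  pushTask (lt ‡22 (get 11 ‡13)) (get 9 ‡13) (get 10 ‡13) ‡18 ;;
  pushTask lowCond (moveCut lowMove)
    (eq ‡18 2 * get 2 (slot ‡13) + (1 - eq ‡18 2) * get 10 ‡13) (eq ‡18 0) ;;
  pushTask highCond (moveCut highMove) (get 10 ‡13) (2 * eq ‡18 1)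

/-- Take a task from the stack and process it. -/
def taskStep : Prog :=
  15 ≔ ‡15 - 1 ;; 18 ≔ get 6 ‡15 ;; 19 ≔ get 7 ‡15 ;; 20 ≔ ‡16 - ‡19 ;; 13 ≔ 0 ;;
  copyTask ;;
  -- The items are popped; the new tasks overwrite their place, which is why the task was copied
  -- before.
  16 ≔ ‡19 ;;
  -- In phase `2` all items share the next hub, so looking at the first item suffices.
  .ite (eq ‡18 2 * eq (get 1 (slot 0)) ‡4) finishTask splitTask

/-- Compute the two indices from the accumulator. -/
def writeOutput : Prog :=
  31 ≔ 0 ;;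
  .loop ‡17 (.put 12 ‡31 (‡17 % ‡5) ;; 17 ≔ ‡17 / ‡5 ;; 31 ≔ ‡31 + 1) ;;
  0 ≔ 0 ;; 1 ≔ 1 ;; 2 ≔ 0 ;; 3 ≔ 1 ;; 13 ≔ 1 ;;
  .loop (lt ‡13 ‡31) (
    0 ≔ ‡0 * ‡13 + get 12 ‡13 * ‡1 ;; 1 ≔ ‡1 * ‡13 ;;
    2 ≔ ‡2 * (‡31 - ‡13) + get 12 ‡13 * ‡3 ;; 3 ≔ ‡3 * (‡31 - ‡13) ;;
    13 ≔ ‡13 + 1)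

/-- The program that computes both indices from a hub labeling. -/
def indexProgram : Prog :=
  4 ≔ get 0 0 ;; 5 ≔ ‡4 * ‡4 + 1 ;; 6 ≔ 1 ;; 7 ≔ 0 ;;
  readInput ;;
  .put 6 0 0 ;; .put 7 0 0 ;; 15 ≔ 1 ;; 16 ≔ 2 * ‡4 ;; 17 ≔ 0 ;;
  .loop ‡15 taskStep ;;
  writeOutput

/-! ### The stack of tasks -/

/-- Three arrays hold the items of a list from index `b` on. -/
def Holds (s : State) (x y z b : ℕ) (l : List Item) : Prop :=
  ∀ (j : ℕ) (hj : j < l.length),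
    s.arr x (b + j) = l[j].o ∧ s.arr y (b + j) = l[j].c ∧ s.arr z (b + j) = l[j].a

open HubData (Task)

/-- The stack holds a list of tasks, with `h` entries and `sp` items. -/
def Stack (s : State) : List Task → ℕ → ℕ → Prop
  | [], h, sp => h = 0 ∧ sp = 0
  | t :: ts, h, sp => ∃ h' b, h = h' + 1 ∧ sp = b + t.items.length ∧ t.items ≠ [] ∧
      s.arr 6 h' = t.ph ∧ s.arr 7 h' = b ∧ Holds s 3 4 5 b t.items ∧ Stack s ts h' b

theorem Holds.congr {s s' : State} {x y z b : ℕ} {l : List Item} (h : Holds s x y z b l)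
    (h' : ∀ i < b + l.length, s'.arr x i = s.arr x i ∧ s'.arr y i = s.arr y i ∧
      s'.arr z i = s.arr z i) : Holds s' x y z b l := fun j hj => by
  obtain ⟨h1, h2, h3⟩ := h' (b + j) (by omega)
  rw [h1, h2, h3]; exact h j hj

theorem Stack.congr {s s' : State} {ts : List Task} {h sp : ℕ} (hs : Stack s ts h sp)
    (h1 : ∀ i < h, s'.arr 6 i = s.arr 6 i ∧ s'.arr 7 i = s.arr 7 i)
    (h2 : ∀ i < sp, s'.arr 3 i = s.arr 3 i ∧ s'.arr 4 i = s.arr 4 i ∧ s'.arr 5 i = s.arr 5 i) :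
    Stack s' ts h sp := by
  induction ts generalizing h sp with
  | nil => exact hs
  | cons t ts ih =>
    obtain ⟨h', b, e1, e2, e3, e4, e5, e6, e7⟩ := hs
    have := h1 h' (by omega)
    refine ⟨h', b, e1, e2, e3, by rw [this.1, e4], by rw [this.2, e5],
      e6.congr fun i hi => h2 i (by omega), ih e7 (fun i hi => h1 i (by omega))
      (fun i hi => h2 i (by omega))⟩

/-- Tasks on the stack are nonempty, so a bound for the number of items also bounds the number of
tasks. -/
theorem Stack.le {s : State} {ts : List Task} {h sp : ℕ} (hs : Stack s ts h sp) : h ≤ sp := by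
  induction ts generalizing h sp with
  | nil => have := hs.1; omega
  | cons t ts ih =>
    obtain ⟨h', b, e1, e2, e3, -, -, -, e7⟩ := hs
    have := ih e7
    have := List.length_pos_iff.2 e3
    omega

theorem Stack.sum {s : State} {ts : List Task} {h sp : ℕ} (hs : Stack s ts h sp) :
    sp = (ts.map fun t => t.items.length).sum := by
  induction ts generalizing h sp with
  | nil => exact hs.2
  | cons t ts ih =>
    obtain ⟨h', b, e1, e2, e3, -, -, -, e7⟩ := hs
    rw [List.map_cons, List.sum_cons, ← ih e7, e2, add_comm]

/-- There is a pair of an even and an odd owner. -/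
def HasPair (l : List Item) : Prop := (∃ i ∈ l, i.o % 2 = 0) ∧ ∃ i ∈ l, i.o % 2 = 1

instance (l : List Item) : Decidable (HasPair l) := inferInstanceAs (Decidable (_ ∧ _))

/-- Add a task unless it has no pairs. -/
def addTask (t : Task) (ts : List Task) : List Task := if HasPair t.items then t :: ts else ts

theorem hasPair_iff (l : List Item) :
    HasPair l ↔ 0 < l.countP (fun i => i.o % 2 = 0) ∧ l.countP (fun i => i.o % 2 = 0) < l.length := by
  unfold HasPair
  rw [List.countP_pos_iff, List.countP_lt_length_iff]
  simp

/-- The expressions are required to have the right values in all states that differ from `s` only in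
what the program writes, because `newc` and `newa` are evaluated after some of the writes and
`newph` after the loop. The rank bound `r` belongs to the analysis and is not stored. -/
theorem pushTask_runs {K : ℕ} {s : State} {l : List Item} {ts : List Task} {p : Item → Bool}
    {f : Item → Item} {ph r : ℕ} {cond newc newa newph : Expr}
    (hst : Stack s ts (s.var 15) (s.var 16)) (hl : Holds s 8 9 10 0 l)
    (h20 : s.var 20 = l.length) (hf : ∀ i, (f i).o = i.o)
    (hcond : ∀ s', Agree (pushTask cond newc newa newph) s s' →
      newph.eval s' = ph ∧ ∀ j (hj : j < l.length), s'.var 13 = j →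
        (cond.eval s' ≠ 0 ↔ p l[j]) ∧ newc.eval s' = (f l[j]).c ∧ newa.eval s' = (f l[j]).a)
    (hK : s.var 16 + l.length + 1 < K) (hph : ph < K)
    (hfK : ∀ i ∈ l, (f i).c < K ∧ (f i).a < K) :
    Runs K (pushTask cond newc newa newph) s (l.length * 9 + 8) fun s' =>
      Stack s' (addTask ⟨ph, r, (l.filter p).map f⟩ ts) (s'.var 15) (s'.var 16) ∧
      s'.var 16 ≤ s.var 16 + l.length := by
  set b := s.var 16 with hb
  set q : ℕ → List Item := fun j => ((l.take j).filter p).map f with hq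
  have hqs : ∀ j (hj : j < l.length), q (j + 1) = if p l[j] then q j ++ [f l[j]] else q j := by
    intro j hj
    simp only [hq, List.take_succ_eq_append_getElem hj, List.filter_append, List.map_append]
    split_ifs with h <;> simp [h]
  have hqle : ∀ j, (q j).length ≤ j := fun j => by
    simp only [hq, List.length_map]
    exact (List.length_filter_le _ _).trans (List.length_take_le _ _)
  have hcnt : ∀ j, (q j).countP (fun i => i.o % 2 = 0) ≤ (q j).length := fun j =>
    List.countP_le_length
  set P := pushTask cond newc newa newph with hP
  have h13 : 13 ∈ P.modVars := by simp [hP, pushTask, Prog.modVars]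
  have h16 : 16 ∈ P.modVars := by simp [hP, pushTask, Prog.modVars]
  have h21 : 21 ∈ P.modVars := by simp [hP, pushTask, Prog.modVars]
  have h26 : 26 ∈ P.modVars := by simp [hP, pushTask, Prog.modVars]
  have h3 : 3 ∈ P.modArrs := by simp [hP, pushTask, Prog.modArrs]
  have h4 : 4 ∈ P.modArrs := by simp [hP, pushTask, Prog.modArrs]
  have h6 : 6 ∈ P.modArrs := by simp [hP, pushTask, Prog.modArrs]
  have hA20 : ∀ s', Agree P s s' → s'.var 20 = l.length := fun s' h =>
    (h.1 20 (by simp [hP, pushTask, Prog.modVars])).trans h20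
  have hA8 : ∀ s', Agree P s s' → ∀ j (hj : j < l.length), s'.arr 8 j = l[j].o := fun s' h j hj => by
    rw [h.2 8 (by simp [hP, pushTask, Prog.modArrs])]
    simpa using (hl j hj).1
  have h1 : Agree P s (((s.setVar 26 b).setVar 21 0).setVar 13 0) :=
    (((Agree.refl P s).setVar _ h26).setVar _ h21).setVar _ h13
  refine Runs.of_le (T := (1 * 0 + ((l.length * (7 + 1) + 1) + (3 + 1))) + 1 + 1 + 1) ?_ (by omega)
  rw [hP]
  refine Runs.assign_seq (fun h => h.1 _) (Runs.assign_seq (fun _ => by simp; omega)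
    (Runs.assign_seq (fun _ => by simp; omega) ?_))
  simp only [eval_var, eval_zero, one_mul, zero_add]
  generalize hs1 : ((s.setVar 26 (s.var 16)).setVar 21 0).setVar 13 0 = s1 at h1 ⊢
  rw [← hb] at hs1
  refine Runs.seq (Runs.for (fun j s' => s'.var 13 = j ∧ s'.var 16 = b + (q j).length ∧
    s'.var 21 = (q j).countP (fun i => i.o % 2 = 0) ∧ Holds s' 3 4 5 b (q j) ∧
    (∀ i < b, s'.arr 3 i = s.arr 3 i ∧ s'.arr 4 i = s.arr 4 i ∧ s'.arr 5 i = s.arr 5 i))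
    (m := l.length) ?_ ?_ ?_) ?_
  · subst hs1
    simp [hq, Holds, ← hb]
  · rintro j s' hj ⟨e13, -⟩ hag
    have hag' : Agree P s s' := h1.trans (hag.of_subset (by simp [hP, pushTask, Prog.modVars])
      (by simp [hP, pushTask, Prog.modArrs]))
    simp [e13, hA20 s' hag']
  · rintro j s' hj ⟨e13, e16, e21, eH, eS⟩ hag hbd
    have hag' : Agree P s s' := h1.trans (hag.of_subset (by simp [hP, pushTask, Prog.modVars])
      (by simp [hP, pushTask, Prog.modArrs]))
    have hqj := hqle j
    have hcj := hcnt j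
    have hc := (hcond s' hag').2 j hj e13
    refine Runs.seq (T := 6) (T' := 1) (Q := fun t => t.var 13 = j ∧
      t.var 16 = b + (q (j + 1)).length ∧
      t.var 21 = (q (j + 1)).countP (fun i => i.o % 2 = 0) ∧ Holds t 3 4 5 b (q (j + 1)) ∧
      (∀ i < b, t.arr 3 i = s.arr 3 i ∧ t.arr 4 i = s.arr 4 i ∧ t.arr 5 i = s.arr 5 i)) ?_ ?_
    · refine Runs.ite (T := 5) (fun hne => ?_) (fun he => ?_)
      · have hp := hc.1.1 hne
        have g1 := hag'.setArr (a := 3) (s'.var 16) (s'.arr 8 (s'.var 13)) h3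
        have g2 := (hcond _ g1).2 j hj e13
        have g3 := g1.setArr (a := 4) (s'.var 16) (f l[j]).c h4
        have g4 := (hcond _ g3).2 j hj e13
        have hm := hfK l[j] (List.getElem_mem hj)
        refine Runs.put_seq (fun _ => hbd.2 _ _) (Runs.put_seq (fun _ => ?_)
          (Runs.put_seq (fun _ => ?_) (Runs.assign_seq (fun _ => ?_) (Runs.assign (fun _ => ?_) ?_))))
        · exact g2.2.1.trans_lt hm.1
        · simp only [eval_var, eval_get] at g2 g4 ⊢
          rw [g2.2.1]
          exact g4.2.2.trans_lt hm.2
        · simp only [eval_add, eval_var, setArr_var, e16, eval_one]; omega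
        · simp only [eval_add, eval_var, setArr_var, setVar_var, eval_eq]
          have : s'.var 21 < K - 1 := by omega
          split_ifs <;> simp_all <;> omega
        · simp only [eval_var, eval_get, setArr_var, e13, hA8 s' hag' j hj] at g2 g4 ⊢
          rw [g2.2.1, g4.2.2]
          rw [e16]
          simp only [hqs j hj, hp, if_true, List.length_append, List.length_singleton,
            List.countP_append, eval_add, eval_var, eval_one, setArr_var, setVar_var, setArr_arr,
            setVar_arr, eval_eq, eval_mod, eval_get, eval_two, eval_zero]
          refine ⟨by simp [e13], by simp [e16]; omega, ?_, ?_, ?_⟩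
          · simp [e21, e13, hA8 s' hag' j hj, hf, List.countP_cons]
          · intro i hi
            simp only [List.length_append, List.length_singleton] at hi
            simp only [setArr_arr, setVar_arr]
            by_cases hiq : i < (q j).length
            · have := eH i hiq
              simp [hiq.ne, List.getElem_append_left hiq, this]
            · obtain rfl : i = (q j).length := by omega
              simp [hf]
          · intro i hi
            have hib : i ≠ b + (q j).length := by omega
            simpa [hib] using eS i hi
      · have hp : ¬ p l[j] := fun h => hc.1.2 h he
        refine Runs.of_le (Runs.skip ?_) (by norm_num)
        rw [hqs j hj, if_neg hp]
        exact ⟨e13, e16, e21, eH, eS⟩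
    · rintro t hbt - ⟨t13, t16, t21, tH, tS⟩
      refine Runs.assign (fun _ => ?_) ⟨?_, ?_, ?_, ?_, ?_⟩
      · simp [t13]; omega
      · simp [t13]
      · simpa using t16
      · simpa using t21
      · exact tH
      · exact tS
  · rintro s' hbd - ⟨⟨e13, e16, e21, eH, eS⟩, hag⟩
    have hag' : Agree P s s' := h1.trans (hag.of_subset (by simp [hP, pushTask, Prog.modVars])
      (by simp [hP, pushTask, Prog.modArrs]))
    have e26 : s'.var 26 = b := by
      rw [hag.1 26 (by simp [Prog.modVars])]
      simp [← hs1]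
    have e15 : s'.var 15 = s.var 15 := by
      rw [hag.1 15 (by simp [Prog.modVars])]
      simp [← hs1]
    have e6 : s'.arr 6 = s.arr 6 := by
      rw [hag.2 6 (by simp [Prog.modArrs])]
      simp [← hs1]
    have e7 : s'.arr 7 = s.arr 7 := by
      rw [hag.2 7 (by simp [Prog.modArrs])]
      simp [← hs1]
    have hql : q l.length = (l.filter p).map f := by simp [hq]
    have hst' : Stack s' ts (s.var 15) b := hst.congr (fun i _ => by rw [e6, e7]; simp) eS
    have hle := hst.le
    have hqj := hqle l.length
    rw [hql] at e16 e21 eH hqj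
    have hlen : s'.var 16 - s'.var 26 = ((l.filter p).map f).length := by omega
    refine Runs.ite (T := 3) (fun hne => ?_) (fun he => ?_)
    · have hpair : HasPair ((l.filter p).map f) := by
        rw [hasPair_iff, ← e21]
        by_contra hcon
        apply hne
        simp only [eval_mul, eval_lt, eval_sub, eval_var, eval_zero, hlen]
        rcases not_and_or.1 hcon with h | h <;> simp only [if_neg h, zero_mul, mul_zero]
      have g1 := (hcond s' hag').1
      refine Runs.put_seq (fun _ => g1.trans_lt hph) (Runs.put_seq (fun h => h.1 _)
        (Runs.assign (fun _ => ?_) ⟨?_, ?_⟩))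
      · simp [e15]; omega
      · rw [addTask, if_pos hpair]
        refine ⟨s.var 15, b, by simp [e15], by simp [e16], ?_, ?_, ?_, ?_, ?_⟩
        · rintro h
          simp only at h
          rw [h] at hpair
          simp [HasPair] at hpair
        · simp [e15, g1]
        · simp [e15, e26]
        · exact eH.congr fun i hi => by simp
        · refine hst'.congr (fun i hi => ?_) fun i hi => ?_
          · simp [e15, hi.ne]
          · simp
      · simp [e16]; simpa using hqj
    · have hpair : ¬ HasPair ((l.filter p).map f) := by
        rw [hasPair_iff, ← e21]
        rintro ⟨g1, g2⟩
        simp only [eval_mul, eval_lt, eval_sub, eval_var, eval_zero, hlen, if_pos g1, if_pos g2] at he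
        omega
      refine Runs.of_le (Runs.assign (fun h => h.1 _) ⟨?_, ?_⟩) (by norm_num)
      · rw [addTask, if_neg hpair]
        simpa [e15, e26] using hst'.congr (s' := s'.setVar 16 b) (fun _ _ => by simp) (by simp)
      · simp [e26]

end RAM

namespace RAM

open RAM.Expr (get eq lt)
open HubData (Task)

/-! ### Processing a task -/

/-- Array `11` holds the keys of the items of a list. -/
def Keys (s : State) (key : Item → ℕ) (l : List Item) : Prop :=
  ∀ (j : ℕ) (hj : j < l.length), s.arr 11 j = key l[j]

theorem countKeys_runs {K : ℕ} {s : State} {l : List Item} {key : Item → ℕ}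
    (h20 : s.var 20 = l.length) (hk : Keys s key l) (hK : l.length + 1 < K) :
    Runs K countKeys s (3 * l.length + 3) fun s' =>
      s'.var 25 = l.countP (fun i => key i ≤ s.var 24) := by
  have hle : ∀ j, (l.take j).countP (fun i => key i ≤ s.var 24) ≤ l.length := fun j =>
    List.countP_le_length.trans (List.length_take_le' _ _)
  refine Runs.of_le (T := (l.length * (2 + 1) + 1) + 1 + 1) ?_ (by omega)
  refine Runs.assign_seq (fun _ => by simp; omega) (Runs.assign_seq (fun _ => by simp; omega) ?_)
  refine (Runs.for (fun j s' => s'.var 13 = j ∧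
    s'.var 25 = (l.take j).countP (fun i => key i ≤ s.var 24)) (m := l.length) ?_ ?_ ?_).mono le_rfl
    ?_
  · simp
  · rintro j s' hj ⟨e13, -⟩ hag
    have : s'.var 20 = l.length := by
      rw [hag.1 20 (by simp [Prog.modVars])]; simpa using h20
    simp [e13, this]
  · rintro j s' hj ⟨e13, e25⟩ hag hbd
    have e24 : s'.var 24 = s.var 24 := by
      rw [hag.1 24 (by simp [Prog.modVars])]; simp
    have e11 : s'.arr 11 j = key l[j] := by
      rw [hag.2 11 (by simp [Prog.modArrs])]; simpa using hk j hj
    have h1 : (l.take (j + 1)).countP (fun i => key i ≤ s.var 24) =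
        s'.var 25 + if key l[j] < s.var 24 + 1 then 1 else 0 := by
      rw [List.take_succ_eq_append_getElem hj, List.countP_append, e25]
      simp
    have h2 := hle (j + 1)
    refine Runs.assign_seq (T := 1) (fun _ => ?_) (Runs.assign (fun _ => ?_) ?_)
    · simp only [eval_add, eval_lt, eval_get, eval_var, eval_one, e13, e11, e24, ← h1]; omega
    · simp [e13]; omega
    · simp [e13, e11, e24, h1]
  · rintro s' - - ⟨⟨-, e25⟩, -⟩
    simpa using e25

theorem length_filter_lt_of_countP {l : List Item} {key : Item → ℕ} {c : ℕ}
    (h : l.length ≤ 2 * l.countP (fun i => key i ≤ c)) :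
    2 * (l.filter fun i => c < key i).length ≤ l.length := by
  have := List.length_eq_countP_add_countP (fun i => decide (key i ≤ c)) (l := l)
  rw [← List.countP_eq_length_filter]
  simp only [decide_eq_true_eq, not_le] at this
  omega

/-- Bisection on key values: at most half of the keys lie below the lower end, and at least half are
at most the upper end. When the ends meet, both halves of the median property hold. The logarithmic
number of rounds is affordable and spares a selection algorithm. -/
theorem findMedian_runs {K n d : ℕ} {s : State} {l : List Item} {key : Item → ℕ}
    (h20 : s.var 20 = l.length) (hk : Keys s key l) (h4 : s.var 4 = n)
    (hkn : ∀ i ∈ l, key i ≤ 4 * n + 1) (hd : 4 * n + 1 < 2 ^ d)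
    (hK : l.length + 1 < K) (hnK : 8 * n + 10 < K) :
    Runs K findMedian s (d * (3 * l.length + 7) + 3) fun s' =>
      2 * (l.filter fun i => key i < s'.var 22).length ≤ l.length ∧
      2 * (l.filter fun i => s'.var 22 < key i).length ≤ l.length := by
  refine Runs.of_le (T := (d * ((2 + (3 * l.length + 3) + 1) + 1) + 1) + 1 + 1) ?_
    (by ring_nf; omega)
  refine Runs.assign_seq (fun _ => by simp; omega) (Runs.assign_seq (fun _ => by simp; omega) ?_)
  refine (Runs.loop (fun d s' => s'.var 22 ≤ s'.var 23 ∧ s'.var 23 ≤ 4 * n + 1 ∧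
    s'.var 23 - s'.var 22 < 2 ^ d ∧ 2 * (l.filter fun i => key i < s'.var 22).length ≤ l.length ∧
    l.length ≤ 2 * l.countP (fun i => key i ≤ s'.var 23)) (d := d) ?_ ?_).mono le_rfl ?_
  · simp only [eval_zero, eval_add, eval_mul, eval_four, eval_var, eval_one, setVar_var]
    have : l.countP (fun i => key i ≤ 4 * n + 1) = l.length :=
      List.countP_eq_length.2 fun i hi => by simpa using hkn i hi
    simp [h4, hd, this]
    omega
  · rintro d s' ⟨h1, h2, h3, h5, h6⟩ hag hbd hne
    have hlt : s'.var 22 < s'.var 23 := by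
      by_contra h
      simp [h] at hne
    obtain ⟨d, rfl⟩ : ∃ d', d = d' + 1 := by
      rcases d with _ | d
      · simp at h3; omega
      · exact ⟨d, rfl⟩
    have e20 : s'.var 20 = l.length := by
      rw [hag.1 20 (by simp [Prog.modVars, countKeys])]; simpa using h20
    have eK : Keys s' key l := fun j hj => by
      rw [hag.2 11 (by simp [Prog.modArrs, countKeys])]; simpa using hk j hj
    refine Runs.of_le (T := ((3 * l.length + 3) + 2) + 1) ?_ (by omega)
    refine Runs.assign_seq (fun _ => by simp; omega) (Runs.seq (T := 3 * l.length + 3) (T' := 2)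
      (countKeys_runs (l := l) (key := key) ?_ (fun j hj => ?_) hK) ?_)
    · simpa using e20
    · simpa using eK j hj
    intro t hbt hat e25
    have t20 : t.var 20 = l.length := by
      rw [hat.1 20 (by simp [Prog.modVars, countKeys])]; simpa using e20
    have t22 : t.var 22 = s'.var 22 := by
      rw [hat.1 22 (by simp [Prog.modVars, countKeys])]; simp
    have t23 : t.var 23 = s'.var 23 := by
      rw [hat.1 23 (by simp [Prog.modVars, countKeys])]; simp
    have t24 : t.var 24 = (s'.var 22 + s'.var 23) / 2 := by
      rw [hat.1 24 (by simp [Prog.modVars, countKeys])]; simp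
    simp only [eval_div, eval_add, eval_var, eval_two, setVar_var, if_true] at e25
    rw [pow_succ] at h3
    refine Runs.ite (T := 1) (fun hc => ?_) (fun hc => ?_)
    · have hlt' : 2 * t.var 25 < l.length := by
        by_contra h
        simp [t20, h] at hc
      refine Runs.assign (fun _ => by simp; omega) ⟨d, by omega, ?_, ?_, ?_, ?_, ?_⟩
      · simp [t23, t24]; omega
      · simp [t23]; omega
      · simp [t23, t24]; omega
      · simp only [eval_add, eval_var, eval_one, setVar_var, if_true, t24]
        rw [← List.countP_eq_length_filter]
        simp only [Nat.lt_succ_iff]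
        omega
      · simpa [t23] using h6
    · have hlt' : l.length ≤ 2 * t.var 25 := by
        by_contra h
        simp [t20, not_le.1 h] at hc
      refine Runs.assign (fun h => h.1 _) ⟨d, by omega, ?_, ?_, ?_, ?_, ?_⟩
      · simp [t22, t24]; omega
      · simp [t24]; omega
      · simp [t22, t24]; omega
      · simpa [t22] using h5
      · simpa [t24, ← e25] using hlt'
  · rintro s' - - ⟨hc, ⟨d, h1, -, -, h5, h6⟩, -⟩
    have : s'.var 22 = s'.var 23 := by
      by_contra h
      have : s'.var 22 < s'.var 23 := by omega
      simp [this] at hc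
    rw [← this] at h6
    exact ⟨h5, length_filter_lt_of_countP h6⟩

/-- Each power is computed by at most `D` multiplications, hence the factor `D` in the step bound.
The partial sums stay below `l.length * X ^ D`, and `hZ` bounds the final value of the accumulator.
-/
theorem finishTask_runs {K D : ℕ} {s : State} {l : List Item} {X : ℕ}
    (h20 : s.var 20 = l.length) (hl : Holds s 8 9 10 0 l) (h5 : s.var 5 = X) (hX : 1 ≤ X)
    (hD : ∀ i ∈ l, i.a ≤ D) (hDK : D + 1 < K) (hK : (l.length + 1) * X ^ D + l.length < K)
    (hZ : s.var 17 + (l.map fun i => if i.o % 2 = 0 then X ^ i.a else 0).sum *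
      (l.map fun i => if i.o % 2 = 0 then 0 else X ^ i.a).sum < K) :
    Runs K finishTask s (l.length * (3 * D + 7) + 5) fun s' =>
      s'.var 17 = s.var 17 + (l.map fun i => if i.o % 2 = 0 then X ^ i.a else 0).sum *
      (l.map fun i => if i.o % 2 = 0 then 0 else X ^ i.a).sum := by
  have hXD : 1 ≤ X ^ D := Nat.one_le_pow _ _ hX
  have hpow : ∀ e ≤ D, X ^ e ≤ X ^ D := fun e he => Nat.pow_le_pow_right hX he
  rw [add_mul, one_mul] at hK
  have hlK : l.length + 1 < K := by omega
  have bound : ∀ (f : Item → ℕ) (_ : ∀ i ∈ l, f i ≤ X ^ D) (j : ℕ), j ≤ l.length →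
      ((l.take j).map f).sum ≤ l.length * X ^ D := by
    intro f hf j hj
    refine (List.sum_le_card_nsmul _ (X ^ D) ?_).trans ?_
    · intro x hx
      obtain ⟨i, hi, rfl⟩ := List.mem_map.1 hx
      exact hf i (List.mem_of_mem_take hi)
    · rw [smul_eq_mul, List.length_map]
      exact Nat.mul_le_mul_right _ (List.length_take_le' _ _)
  have bound0 := bound (fun i => if i.o % 2 = 0 then X ^ i.a else 0) (fun i hi => by
    split_ifs
    exacts [hpow _ (hD i hi), by omega])
  have bound1 := bound (fun i => if i.o % 2 = 0 then 0 else X ^ i.a) (fun i hi => by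
    split_ifs
    exacts [by omega, hpow _ (hD i hi)])
  refine Runs.of_le (T := ((l.length * (((D * (2 + 1) + 1) + (2 + 1)) + 1 + 1 + 1) + 1) + 1) +
    1 + 1 + 1) ?_ (by ring_nf; omega)
  refine Runs.assign_seq (fun _ => by simp; omega) (Runs.assign_seq (fun _ => by simp; omega)
    (Runs.assign_seq (fun _ => by simp; omega) ?_))
  refine Runs.seq (T := l.length * (((D * (2 + 1) + 1) + (2 + 1)) + 1 + 1 + 1) + 1) (T' := 1)
    (Runs.for (b := ((D * (2 + 1) + 1) + (2 + 1)) + 1 + 1) (fun j s' => s'.var 13 = j ∧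
    s'.var 27 = ((l.take j).map fun i => if i.o % 2 = 0 then X ^ i.a else 0).sum ∧
    s'.var 28 = ((l.take j).map fun i => if i.o % 2 = 0 then 0 else X ^ i.a).sum)
    (m := l.length) ?_ ?_ ?_) ?_
  · simp
  · rintro j s' hj ⟨e13, -⟩ hag
    have : s'.var 20 = l.length := by
      rw [hag.1 20 (by simp [Prog.modVars])]; simpa using h20
    simp [e13, this]
  · rintro j s' hj ⟨e13, e27, e28⟩ hag hbd
    have e5 : s'.var 5 = X := by
      rw [hag.1 5 (by simp [Prog.modVars])]; simpa using h5
    have e8 : s'.arr 8 j = l[j].o := by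
      rw [hag.2 8 (by simp [Prog.modArrs])]; simpa using (hl j hj).1
    have e10 : s'.arr 10 j = l[j].a := by
      rw [hag.2 10 (by simp [Prog.modArrs])]; simpa using (hl j hj).2.2
    have haD := hD l[j] (List.getElem_mem hj)
    refine Runs.assign_seq (fun _ => by simp; omega) (Runs.assign_seq (fun _ => by simp; omega) ?_)
    refine Runs.seq (T := D * (2 + 1) + 1) (T' := 2 + 1) (Q := fun t => t.var 29 = X ^ l[j].a ∧ t.var 13 = j ∧
      t.var 27 = s'.var 27 ∧ t.var 28 = s'.var 28 ∧ t.arr 8 j = l[j].o) ?_ ?_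
    · refine (Runs.for (fun e t => t.var 30 = e ∧ t.var 29 = X ^ e) (m := l[j].a) (b := 2)
        ?_ ?_ ?_).mono ?_ ?_
      · simp
      · rintro e t he ⟨f30, f29⟩ hat
        have f13 : t.var 13 = j := by
          rw [hat.1 13 (by simp [Prog.modVars])]; simpa using e13
        have f10 : t.arr 10 j = l[j].a := by
          rw [hat.2 10 (by simp [Prog.modArrs])]; simpa using e10
        simp [f30, f13, f10]
      · rintro e t he ⟨f30, f29⟩ hat hbt
        have f5 : t.var 5 = X := by
          rw [hat.1 5 (by simp [Prog.modVars])]; simpa using e5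
        have := hpow (e + 1) (by omega)
        refine Runs.assign_seq (T := 1) (fun _ => ?_) (Runs.assign (fun _ => ?_) ?_)
        · simp only [eval_mul, eval_var, f29, f5, ← pow_succ]; omega
        · simp [f30]; omega
        · simp [f30, f29, f5, pow_succ]
      · nlinarith
      · rintro t - - ⟨⟨f30, f29⟩, hat⟩
        refine ⟨f29, ?_, ?_, ?_, ?_⟩
        · rw [hat.1 13 (by simp [Prog.modVars])]; simpa using e13
        · rw [hat.1 27 (by simp [Prog.modVars])]; simp
        · rw [hat.1 28 (by simp [Prog.modVars])]; simp
        · rw [hat.2 8 (by simp [Prog.modArrs])]; simpa using e8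
    · rintro t hbt - ⟨t29, t13, t27, t28, t8⟩
      have b0 := bound0 (j + 1) hj
      have b1 := bound1 (j + 1) hj
      have s0 : ∀ f : Item → ℕ, ((l.take (j + 1)).map f).sum = ((l.take j).map f).sum + f l[j] :=
        fun f => by rw [List.take_succ_eq_append_getElem hj, List.map_append, List.sum_append]; rfl
      rw [s0] at b0 b1
      rw [← e27] at b0
      rw [← e28] at b1
      refine Runs.seq (T := 1 + 1) (T' := 1) (Q := fun u => u.var 13 = j ∧
        u.var 27 = ((l.take (j + 1)).map fun i => if i.o % 2 = 0 then X ^ i.a else 0).sum ∧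
        u.var 28 = ((l.take (j + 1)).map fun i => if i.o % 2 = 0 then 0 else X ^ i.a).sum) ?_ ?_
      · rw [s0, s0, ← e27, ← e28]
        refine Runs.ite (fun hc => ?_) (fun hc => ?_)
        · have ho : ¬ l[j].o % 2 = 0 := by simpa [t13, t8] using hc
          rw [if_neg ho] at b1
          refine Runs.assign (fun _ => ?_) ?_
          · simp only [eval_add, eval_var, t28, t29]; omega
          · simp [t13, t27, t28, t29, ho]
        · have ho : l[j].o % 2 = 0 := by simpa [t13, t8] using hc
          rw [if_pos ho] at b0
          refine Runs.assign (fun _ => ?_) ?_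
          · simp only [eval_add, eval_var, t27, t29]; omega
          · simp [t13, t27, t28, t29, ho]
      · rintro u - - ⟨u13, u27, u28⟩
        exact Runs.assign (fun _ => by simp [u13]; omega) (by simp [u13, u27, u28])
  · rintro s' hbd - ⟨⟨e13, e27, e28⟩, hag⟩
    have e17 : s'.var 17 = s.var 17 := by
      rw [hag.1 17 (by simp [Prog.modVars])]; simp
    rw [List.take_length] at e27 e28
    refine Runs.assign (fun _ => ?_) ?_
    · simp only [eval_add, eval_mul, eval_var, e17, e27, e28]; exact hZ
    · simp [e17, e27, e28]

end RAM

/-! ### Table look-ups, splitting, and one step of the task stack. -/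

namespace RAM

open RAM.Expr (get eq lt)
open HubData (Task)

variable {n D : ℕ} {H : HubData n D}

/-- The table of next hubs is complete. -/
structure TabOK (H : HubData n D) (s : State) : Prop where
  n_eq : s.var 4 = n
  hub_eq : ∀ o < 2 * n, ∀ c, (c = 0 ∨ ∃ x ∈ H.lab o, c = x + 1) →
    s.arr 1 (o * (n + 1) + c) = H.nxt o c
  dist_eq : ∀ o < 2 * n, ∀ c, (c = 0 ∨ ∃ x ∈ H.lab o, c = x + 1) → H.nxt o c < n →
    s.arr 2 (o * (n + 1) + c) = H.dd o (H.nxt o c)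
  dist_le : ∀ i, s.arr 2 i ≤ n

theorem TabOK.congr {s s' : State} (h : TabOK H s) (h4 : s'.var 4 = s.var 4)
    (h1 : s'.arr 1 = s.arr 1) (h2 : s'.arr 2 = s.arr 2) : TabOK H s' :=
  ⟨h4.trans h.n_eq, by rw [h1]; exact h.hub_eq, by rw [h2]; exact h.dist_eq,
    by rw [h2]; exact h.dist_le⟩

theorem TabOK.hub {s : State} (h : TabOK H s) {i : Item} (hi : H.Valid i) :
    s.arr 1 (i.o * (n + 1) + i.c) = H.hub i := h.hub_eq _ hi.1 _ hi.2.2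

theorem TabOK.hubDist {s : State} (h : TabOK H s) {i : Item} (hi : H.Valid i)
    (hn : H.hub i < n) : s.arr 2 (i.o * (n + 1) + i.c) = H.hubDist i :=
  h.dist_eq _ hi.1 _ hi.2.2 hn

/-- Item `j` of the current task is `i`. -/
def AtItem (s : State) (i : Item) : Prop :=
  s.arr 8 (s.var 13) = i.o ∧ s.arr 9 (s.var 13) = i.c ∧ s.arr 10 (s.var 13) = i.a

/-- Keys are computed before exhaustion is tested, so in phase `2` the tabulated distance may be
meaningless. The bound holds nevertheless, since all entries of that array are at most `n`. -/
theorem keyExpr_eval {s : State} {i : Item} (ht : TabOK H s) (hs : AtItem s i) (hi : H.Valid i) :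
    keyExpr.eval s ≤ 4 * n + 1 ∧
      ((s.var 18 = 2 → H.hub i < n) → keyExpr.eval s = H.key (s.var 18) i) := by
  obtain ⟨h1, h2, h3⟩ := hs
  have hle := ht.dist_le (i.o * (n + 1) + i.c)
  have hn := H.hub_le i
  have ha := hi.2.1
  simp only [keyExpr, slot, eval_add, eval_mul, eval_sub, eval_eq, eval_mod, eval_get, eval_var,
    eval_zero, eval_one, eval_two, h1, h2, h3, ht.n_eq, ht.hub hi]
  constructor
  · rcases Nat.mod_two_eq_zero_or_one i.o with h | h <;> by_cases h' : s.var 18 = 2 <;>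
      simp [h, h'] <;> omega
  · intro hlt
    unfold HubData.key
    by_cases h' : s.var 18 = 2
    · have := ht.hubDist hi (hlt h')
      rcases Nat.mod_two_eq_zero_or_one i.o with h | h <;> simp [h, h', this]
    · simp [h']

theorem copyTask_runs {K : ℕ} {s : State} {l : List Item} (ht : TabOK H s)
    (hl : Holds s 3 4 5 (s.var 19) l) (h20 : s.var 20 = l.length) (h13 : s.var 13 = 0)
    (hv : ∀ i ∈ l, H.Valid i) (hK : 8 * n + 10 < K) (hlK : l.length + 1 < K) :
    Runs K copyTask s (l.length * 6 + 1) fun s' => Holds s' 8 9 10 0 l ∧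
      ((s.var 18 = 2 → ∀ i ∈ l, H.hub i < n) → Keys s' (H.key (s.var 18)) l) := by
  refine (Runs.for (b := 5) (fun j s' => s'.var 13 = j ∧ ∀ j' (hj : j' < l.length), j' < j →
    (s'.arr 8 j' = l[j'].o ∧ s'.arr 9 j' = l[j'].c ∧ s'.arr 10 j' = l[j'].a) ∧
    ((s.var 18 = 2 → H.hub l[j'] < n) → s'.arr 11 j' = H.key (s.var 18) l[j'])) (m := l.length)
    ?_ ?_ ?_).mono le_rfl ?_
  · simp [h13]
  · rintro j s' hj ⟨e13, -⟩ hag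
    have : s'.var 20 = l.length := by
      rw [hag.1 20 (by simp [Prog.modVars])]; simpa using h20
    simp [e13, this]
  · rintro j s' hj ⟨e13, eI⟩ hag hbd
    have e19 : s'.var 19 = s.var 19 := hag.1 19 (by simp [Prog.modVars])
    have e18 : s'.var 18 = s.var 18 := hag.1 18 (by simp [Prog.modVars])
    have e3 : s'.arr 3 (s.var 19 + j) = l[j].o := by
      rw [hag.2 3 (by simp [Prog.modArrs])]; exact (hl j hj).1
    have e4 : s'.arr 4 (s.var 19 + j) = l[j].c := by
      rw [hag.2 4 (by simp [Prog.modArrs])]; exact (hl j hj).2.1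
    have e5 : s'.arr 5 (s.var 19 + j) = l[j].a := by
      rw [hag.2 5 (by simp [Prog.modArrs])]; exact (hl j hj).2.2
    have ht' : TabOK H s' := ht.congr (hag.1 4 (by simp [Prog.modVars]))
      (hag.2 1 (by simp [Prog.modArrs])) (hag.2 2 (by simp [Prog.modArrs]))
    set u := ((s'.setArr 8 j l[j].o).setArr 9 j l[j].c).setArr 10 j l[j].a with hu
    have hue : AtItem u l[j] := by simp [AtItem, hu, e13]
    have htu : TabOK H u := ht'.congr (by simp [hu]) (by ext; simp [hu]) (by ext; simp [hu])
    have hk := keyExpr_eval htu hue (hv _ (List.getElem_mem hj))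
    have u18 : u.var 18 = s.var 18 := by simpa [hu] using e18
    rw [u18] at hk
    refine Runs.put_seq (T := 4) (fun _ => hbd.2 _ _) (Runs.put_seq (fun h => h.2 _ _)
      (Runs.put_seq (fun h => h.2 _ _) ?_))
    simp only [eval_var, eval_get, eval_add, setArr_var, setArr_arr, e13, e19, e3, e4, e5,
      Nat.reduceEqDiff, false_and, if_false]
    rw [← hu]
    refine Runs.put_seq (fun _ => by omega) (Runs.assign (fun _ => ?_) ⟨?_, ?_⟩)
    · simp [hu, e13]; omega
    · simp [hu, e13]
    · intro j' hj' hlt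
      rcases Nat.lt_succ_iff_lt_or_eq.1 hlt with h | rfl
      · simpa [hu, h.ne, e13] using eI j' hj' h
      · simpa [hu, e13] using hk.2
  · rintro s' - - ⟨⟨-, eI⟩, -⟩
    refine ⟨fun j hj => ?_, fun h j hj => (eI j hj hj).2 fun h' => h h' _ (List.getElem_mem hj)⟩
    simpa using (eI j hj hj).1

theorem Holds.atItem {s : State} {l : List Item} (hl : Holds s 8 9 10 0 l) {j : ℕ}
    (hj : j < l.length) (h13 : s.var 13 = j) : AtItem s l[j] := by
  simpa [AtItem, h13] using hl j hj

theorem lowCond_eval {s : State} {i : Item} {key : Item → ℕ} {c : ℕ} (hs : AtItem s i)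
    (hk : s.arr 11 (s.var 13) = key i) (hc : s.var 22 = c) :
    lowCond.eval s ≠ 0 ↔ lowPart key c i := by
  simp only [lowCond, eval_add, eval_mul, eval_eq, eval_mod, eval_get, eval_var, eval_zero,
    eval_one, eval_two, eval_lt, hs.1, hk, hc, lowPart, decide_eq_true_eq, Nat.lt_succ_iff]
  rcases Nat.mod_two_eq_zero_or_one i.o with h | h <;> simp [h]

theorem highCond_eval {s : State} {i : Item} {key : Item → ℕ} {c : ℕ} (hs : AtItem s i)
    (hk : s.arr 11 (s.var 13) = key i) (hc : s.var 22 = c) :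
    highCond.eval s ≠ 0 ↔ highPart key c i := by
  simp only [highCond, eval_add, eval_mul, eval_eq, eval_mod, eval_get, eval_var, eval_zero,
    eval_one, eval_two, eval_lt, hs.1, hk, hc, highPart, decide_eq_true_eq, Nat.lt_succ_iff]
  rcases Nat.mod_two_eq_zero_or_one i.o with h | h <;> simp [h]

theorem moveCut_lowMove_eval {s : State} {i : Item} (ht : TabOK H s) (hs : AtItem s i)
    (hi : H.Valid i) (hph : s.var 18 ≤ 2) :
    (moveCut lowMove).eval s = (H.lowStep (s.var 18) i).c := by
  simp only [moveCut, lowMove, slot, eval_add, eval_sub, eval_mul, eval_eq, eval_mod, eval_get,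
    eval_var, eval_zero, eval_one, eval_two, hs.1, hs.2.1, ht.n_eq, ht.hub hi, HubData.lowStep]
  interval_cases s.var 18 <;> rcases Nat.mod_two_eq_zero_or_one i.o with h | h <;> simp [h]

theorem moveCut_highMove_eval {s : State} {i : Item} (ht : TabOK H s) (hs : AtItem s i)
    (hi : H.Valid i) (hph : s.var 18 ≤ 2) :
    (moveCut highMove).eval s = (H.highStep (s.var 18) i).c := by
  simp only [moveCut, highMove, slot, eval_add, eval_sub, eval_mul, eval_eq, eval_mod, eval_get,
    eval_var, eval_zero, eval_one, eval_two, hs.1, hs.2.1, ht.n_eq, ht.hub hi, HubData.highStep]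
  interval_cases s.var 18 <;> rcases Nat.mod_two_eq_zero_or_one i.o with h | h <;> simp [h]

/-- The tasks into which a task is split at the key `c`, added to a list of tasks. -/
def splitTasks (H : HubData n D) (t : Task) (c : ℕ) (ts : List Task) : List Task :=
  addTask ⟨if t.ph = 1 then 2 else 0, t.r - 1,
      (t.items.filter (highPart (H.key t.ph) c)).map (H.highStep t.ph)⟩ <|
  addTask ⟨if t.ph = 0 then 1 else 0, t.r - 1,
      (t.items.filter (lowPart (H.key t.ph) c)).map (H.lowStep t.ph)⟩ <|
  addTask ⟨t.ph, t.r, (t.items.filter fun i => c < H.key t.ph i).map id⟩ <|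
  addTask ⟨t.ph, t.r, (t.items.filter fun i => H.key t.ph i < c).map id⟩ ts

/-- The part of the memory that describes the current task. -/
structure CurOK (H : HubData n D) (t : Task) (s : State) : Prop where
  tab : TabOK H s
  holds : Holds s 8 9 10 0 t.items
  keys : Keys s (H.key t.ph) t.items
  ph_eq : s.var 18 = t.ph
  size_eq : s.var 20 = t.items.length

theorem CurOK.congr {t : Task} {s s' : State} (h : CurOK H t s)
    (hv : ∀ x ∈ [4, 18, 20], s'.var x = s.var x)
    (ha : ∀ x ∈ [1, 2, 8, 9, 10, 11], s'.arr x = s.arr x) : CurOK H t s' := by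
  simp only [List.forall_mem_cons, List.not_mem_nil, false_imp_iff, implies_true, and_true] at hv ha
  obtain ⟨v1, v2, v3⟩ := hv
  obtain ⟨a1, a2, a3, a4, a5, a6⟩ := ha
  exact ⟨h.tab.congr v1 a1 a2, h.holds.congr (by simp [a3, a4, a5]),
    fun j hj => by rw [a6]; exact h.keys j hj, v2.trans h.ph_eq, v3.trans h.size_eq⟩

theorem CurOK.push {t : Task} {s s' : State} (h : CurOK H t s) {e₁ e₂ e₃ e₄ : Expr}
    (hag : Agree (pushTask e₁ e₂ e₃ e₄) s s') : CurOK H t s' ∧ s'.var 22 = s.var 22 :=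
  ⟨h.congr (fun x hx => hag.1 x (by fin_cases hx <;> simp [pushTask, Prog.modVars]))
    (fun x hx => hag.2 x (by fin_cases hx <;> simp [pushTask, Prog.modArrs])),
    hag.1 22 (by simp [pushTask, Prog.modVars])⟩

theorem CurOK.at {t : Task} {s : State} (h : CurOK H t s) {j : ℕ} (hj : j < t.items.length)
    (h13 : s.var 13 = j) :
    AtItem s t.items[j] ∧ s.arr 11 (s.var 13) = H.key t.ph t.items[j] :=
  ⟨h.holds.atItem hj h13, by rw [h13]; exact h.keys j hj⟩

theorem splitTask_runs {K d : ℕ} {s : State} {t : Task} {ts : List Task} (hc : CurOK H t s)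
    (ht : H.TaskOK t) (hn : t.ph = 2 → ∀ i ∈ t.items, H.hub i < n)
    (hst : Stack s ts (s.var 15) (s.var 16)) (hd : 4 * n + 1 < 2 ^ d)
    (hK : s.var 16 + 4 * t.items.length + 1 < K) (hnK : 8 * n + 10 < K) :
    Runs K splitTask s (d * (3 * t.items.length + 7) + 3 + 4 * (t.items.length * 9 + 8)) fun s' =>
      ∃ c, 2 * (t.items.filter fun i => H.key t.ph i < c).length ≤ t.items.length ∧
        2 * (t.items.filter fun i => c < H.key t.ph i).length ≤ t.items.length ∧
        Stack s' (splitTasks H t c ts) (s'.var 15) (s'.var 16) := by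
  set m := t.items.length with hm
  have hphK : t.ph < K := by have := ht.ph_le; omega
  have hsame : ∀ i ∈ t.items, (id i : Item).c < K ∧ (id i : Item).a < K := by
    intro i hi
    obtain ⟨j, hj, rfl⟩ := List.getElem_of_mem hi
    obtain ⟨-, h2, h3⟩ := ht.valid _ hi
    refine ⟨?_, by simp; omega⟩
    rcases h2' : t.items[j].c with _ | x
    · simp [h2']; omega
    · rcases h3 with h3 | ⟨y, hy, h3⟩
      · omega
      · have := H.lab_lt hy
        simp; omega
  have hhub : ∀ i, H.hub i + 1 < K := fun i => by have := H.hub_le i; omega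
  have hlow : ∀ i ∈ t.items, (H.lowStep t.ph i).c < K ∧ (H.lowStep t.ph i).a < K := by
    intro i hi
    have := hsame i hi
    unfold HubData.lowStep
    split_ifs with h1 h2
    · have := HubData.hubDist_le (hn h1 i hi)
      exact ⟨hhub i, by simp; omega⟩
    · exact ⟨hhub i, this.2⟩
    · exact this
  have hhigh : ∀ i ∈ t.items, (H.highStep t.ph i).c < K ∧ (H.highStep t.ph i).a < K := by
    intro i hi
    have := hsame i hi
    unfold HubData.highStep
    split_ifs with h1
    · exact ⟨hhub i, this.2⟩
    · exact this
  refine Runs.of_le (T := (d * (3 * m + 7) + 3) + ((m * 9 + 8) + ((m * 9 + 8) + ((m * 9 + 8) +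
    (m * 9 + 8))))) ?_ (by omega)
  refine Runs.seq (findMedian_runs hc.size_eq hc.keys hc.tab.n_eq
    (fun i hi => HubData.key_le (ht.valid i hi) fun h => hn h i hi) hd (by omega) hnK) ?_
  rintro s₁ - ha₁ ⟨hc₁, hc₂⟩
  have hcur₁ : CurOK H t s₁ := hc.congr
    (fun x hx => ha₁.1 x (by fin_cases hx <;> simp [findMedian, countKeys, Prog.modVars]))
    (fun x hx => ha₁.2 x (by fin_cases hx <;> simp [findMedian, countKeys, Prog.modArrs]))
  have e15 : s₁.var 15 = s.var 15 := ha₁.1 15 (by simp [findMedian, countKeys, Prog.modVars])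
  have e16 : s₁.var 16 = s.var 16 := ha₁.1 16 (by simp [findMedian, countKeys, Prog.modVars])
  have hst₁ : Stack s₁ ts (s₁.var 15) (s₁.var 16) := by
    rw [e15, e16]
    refine hst.congr (fun i _ => ?_) (fun i _ => ?_)
    · rw [ha₁.2 6 (by simp [findMedian, countKeys, Prog.modArrs]),
        ha₁.2 7 (by simp [findMedian, countKeys, Prog.modArrs])]
      simp
    · rw [ha₁.2 3 (by simp [findMedian, countKeys, Prog.modArrs]),
        ha₁.2 4 (by simp [findMedian, countKeys, Prog.modArrs]),
        ha₁.2 5 (by simp [findMedian, countKeys, Prog.modArrs])]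
      simp
  set c := s₁.var 22 with hcdef
  refine Runs.seq (pushTask_runs (r := t.r) (ph := t.ph) (f := id)
    (p := fun i => H.key t.ph i < c) hst₁ hcur₁.holds hcur₁.size_eq (fun _ => rfl) ?_ (by omega)
    hphK hsame) ?_
  · intro s' hag
    obtain ⟨hcur, h22⟩ := hcur₁.push hag
    refine ⟨hcur.ph_eq, fun j hj h13 => ?_⟩
    obtain ⟨h1, h2⟩ := hcur.at hj h13
    simp [h2, h22, h1.2.1, h1.2.2, ← hcdef]
  rintro s₂ - ha₂ ⟨hst₂, hle₂⟩
  obtain ⟨hcur₂, h22₂⟩ := hcur₁.push ha₂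
  refine Runs.seq (pushTask_runs (r := t.r) (ph := t.ph) (f := id)
    (p := fun i => c < H.key t.ph i) hst₂ hcur₂.holds hcur₂.size_eq (fun _ => rfl) ?_ (by omega)
    hphK hsame) ?_
  · intro s' hag
    obtain ⟨hcur, h22⟩ := hcur₂.push hag
    refine ⟨hcur.ph_eq, fun j hj h13 => ?_⟩
    obtain ⟨h1, h2⟩ := hcur.at hj h13
    simp [h2, h22, h22₂, h1.2.1, h1.2.2, ← hcdef]
  rintro s₃ - ha₃ ⟨hst₃, hle₃⟩
  obtain ⟨hcur₃, h22₃⟩ := hcur₂.push ha₃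
  refine Runs.seq (pushTask_runs (r := t.r - 1) (ph := if t.ph = 0 then 1 else 0)
    (f := H.lowStep t.ph) (p := lowPart (H.key t.ph) c) hst₃ hcur₃.holds hcur₃.size_eq
    (H.lowStep_o _) ?_ (by omega) (by split_ifs <;> omega) hlow) ?_
  · intro s' hag
    obtain ⟨hcur, h22⟩ := hcur₃.push hag
    refine ⟨by simp [hcur.ph_eq], fun j hj h13 => ?_⟩
    obtain ⟨h1, h2⟩ := hcur.at hj h13
    have hv := ht.valid _ (List.getElem_mem hj)
    refine ⟨lowCond_eval h1 h2 (by rw [h22, h22₃, h22₂]), ?_, ?_⟩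
    · rw [moveCut_lowMove_eval hcur.tab h1 hv (by rw [hcur.ph_eq]; exact ht.ph_le), hcur.ph_eq]
    · simp only [eval_add, eval_sub, eval_mul, eval_eq, eval_get, eval_var, slot, eval_one,
        eval_two, h1.1, h1.2.1, h1.2.2, hcur.tab.n_eq, hcur.ph_eq, HubData.lowStep]
      by_cases h : t.ph = 2
      · have := hcur.tab.hubDist hv (hn h _ (List.getElem_mem hj))
        simp [h, this]
      · simp only [h, if_false]
        split_ifs <;> simp
  rintro s₄ - ha₄ ⟨hst₄, hle₄⟩
  obtain ⟨hcur₄, h22₄⟩ := hcur₃.push ha₄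
  refine (pushTask_runs (r := t.r - 1) (ph := if t.ph = 1 then 2 else 0)
    (f := H.highStep t.ph) (p := highPart (H.key t.ph) c) hst₄ hcur₄.holds hcur₄.size_eq
    (H.highStep_o _) ?_ (by omega) (by split_ifs <;> omega) hhigh).mono le_rfl ?_
  · intro s' hag
    obtain ⟨hcur, h22⟩ := hcur₄.push hag
    refine ⟨by simp [hcur.ph_eq], fun j hj h13 => ?_⟩
    obtain ⟨h1, h2⟩ := hcur.at hj h13
    have hv := ht.valid _ (List.getElem_mem hj)
    refine ⟨highCond_eval h1 h2 (by rw [h22, h22₄, h22₃, h22₂]), ?_, ?_⟩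
    · rw [moveCut_highMove_eval hcur.tab h1 hv (by rw [hcur.ph_eq]; exact ht.ph_le), hcur.ph_eq]
    · simp only [eval_get, eval_var, h1.2.2, HubData.highStep]
      split_ifs <;> rfl
  · rintro s' - - ⟨hst', -⟩
    exact ⟨c, hc₁, hc₂, hst'⟩

theorem taskStep_runs {K d X : ℕ} {s : State} {t : Task} {ts : List Task} (htab : TabOK H s)
    (h5 : s.var 5 = X) (hX : 1 ≤ X)
    (ht : H.TaskOK t) (hst : Stack s (t :: ts) (s.var 15) (s.var 16)) (hd : 4 * n + 1 < 2 ^ d)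
    (hK : 4 * s.var 16 + 1 < K) (hnK : 8 * n + 10 < K)
    (hXK : (s.var 16 + 1) * X ^ D + s.var 16 < K)
    (hZ : s.var 17 + pairSum (fun o o' => X ^ H.T o o') t.items < K) :
    Runs K taskStep s (t.items.length * (3 * D + 10 * d + 100)) fun s' =>
      (s'.var 17 = s.var 17 + pairSum (fun o o' => X ^ H.T o o') t.items ∧
        Stack s' ts (s'.var 15) (s'.var 16)) ∨
      (s'.var 17 = s.var 17 ∧ (t.ph = 2 → ∀ i ∈ t.items, H.hub i ≠ n) ∧
        ∃ c, 2 * (t.items.filter fun i => H.key t.ph i < c).length ≤ t.items.length ∧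
        2 * (t.items.filter fun i => c < H.key t.ph i).length ≤ t.items.length ∧
        Stack s' (splitTasks H t c ts) (s'.var 15) (s'.var 16)) := by
  obtain ⟨h', b, e15, e16, hne, e6, e7, hl, hst'⟩ := hst
  set m := t.items.length with hm
  have hm1 : 1 ≤ m := List.length_pos_iff.2 hne
  have hph := ht.ph_le
  set R := max (m * (3 * D + 7) + 5) (d * (3 * m + 7) + 3 + 4 * (m * 9 + 8)) with hR
  refine Runs.of_le (T := ((m * 6 + 1) + (R + 2)) + 1 + 1 + 1 + 1 + 1) ?_ ?_
  swap
  · have h1 : R ≤ m * (3 * D + 10 * d + 85) := by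
      apply max_le
      · nlinarith
      · nlinarith [Nat.zero_le d, Nat.zero_le D, Nat.mul_le_mul_right d hm1]
    nlinarith
  refine Runs.assign_seq (fun h => ?_) (Runs.assign_seq (fun h => h.2 _ _)
    (Runs.assign_seq (fun h => h.2 _ _) (Runs.assign_seq (fun h => ?_) (Runs.assign_seq (fun h => ?_)
    ?_))))
  · have := h.1 15
    simp; omega
  · have := h.1 16
    simp at this ⊢
    omega
  · simp; omega
  simp only [eval_sub, eval_var, eval_one, eval_zero, eval_get, setVar_var, setVar_arr,
    Nat.reduceEqDiff, if_true, if_false, e15, Nat.add_sub_cancel, e6, e7]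
  generalize hs₁ : ((((s.setVar 15 h').setVar 18 t.ph).setVar 19 b).setVar 20 (s.var 16 - b)).setVar
    13 0 = s₁
  have htab₁ : TabOK H s₁ := htab.congr (by simp [← hs₁]) (by simp [← hs₁]) (by simp [← hs₁])
  have f18 : s₁.var 18 = t.ph := by simp [← hs₁]
  have f19 : s₁.var 19 = b := by simp [← hs₁]
  have f20 : s₁.var 20 = m := by simp [← hs₁]; omega
  have hcopy := copyTask_runs (K := K) (l := t.items) htab₁
    (by rw [f19]; exact hl.congr fun i _ => by simp [← hs₁]) f20 (by simp [← hs₁]) ht.valid hnK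
    (by omega)
  rw [f18] at hcopy
  refine Runs.seq (T := m * 6 + 1) (T' := R + 2) hcopy ?_
  rintro s₂ - ha₂ ⟨hl₂, hk₂⟩
  have htab₂ : TabOK H s₂ := htab₁.congr (ha₂.1 4 (by simp [copyTask, Prog.modVars]))
    (ha₂.2 1 (by simp [copyTask, Prog.modArrs])) (ha₂.2 2 (by simp [copyTask, Prog.modArrs]))
  have g5 : s₂.var 5 = X := by
    rw [ha₂.1 5 (by simp [copyTask, Prog.modVars])]; simpa [← hs₁] using h5
  have g15 : s₂.var 15 = h' := by
    rw [ha₂.1 15 (by simp [copyTask, Prog.modVars])]; simp [← hs₁]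
  have g17 : s₂.var 17 = s.var 17 := by
    rw [ha₂.1 17 (by simp [copyTask, Prog.modVars])]; simp [← hs₁]
  have g18 : s₂.var 18 = t.ph := by
    rw [ha₂.1 18 (by simp [copyTask, Prog.modVars])]; exact f18
  have g19 : s₂.var 19 = b := by
    rw [ha₂.1 19 (by simp [copyTask, Prog.modVars])]; exact f19
  have g20 : s₂.var 20 = m := by
    rw [ha₂.1 20 (by simp [copyTask, Prog.modVars])]; exact f20
  have hst₂ : Stack s₂ ts h' b := by
    refine hst'.congr (fun i _ => ?_) (fun i _ => ?_)
    · rw [ha₂.2 6 (by simp [copyTask, Prog.modArrs]), ha₂.2 7 (by simp [copyTask, Prog.modArrs])]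
      simp [← hs₁]
    · rw [ha₂.2 3 (by simp [copyTask, Prog.modArrs]), ha₂.2 4 (by simp [copyTask, Prog.modArrs]),
        ha₂.2 5 (by simp [copyTask, Prog.modArrs])]
      simp [← hs₁]
  refine Runs.assign_seq (T := R + 1) (fun h => h.1 _) ?_
  simp only [eval_var, g19]
  have hst₃ : Stack (s₂.setVar 16 b) ts ((s₂.setVar 16 b).var 15) ((s₂.setVar 16 b).var 16) := by
    simpa [g15] using hst₂.congr (s' := s₂.setVar 16 b) (by simp) (by simp)
  have h0 := hl₂ 0 hm1
  have hmem0 : t.items[0] ∈ t.items := List.getElem_mem hm1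
  have hhub0 := htab₂.hub (ht.valid _ hmem0)
  have hcond : (eq ‡18 2 * eq (get 1 (slot 0)) ‡4).eval (s₂.setVar 16 b) ≠ 0 ↔
      t.ph = 2 ∧ H.hub t.items[0] = n := by
    simp only [Nat.zero_add] at h0
    simp [slot, g18, htab₂.n_eq, h0.1, h0.2.1, hhub0, and_comm]
  refine Runs.ite (fun hc => ?_) (fun hc => ?_)
  · obtain ⟨hp2, hn⟩ := hcond.1 hc
    have hfin : ∀ i ∈ t.items, ∀ j ∈ t.items, i.o % 2 = 0 → j.o % 2 = 1 →
        i.a + j.a = H.T i.o j.o := by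
      intro i hi j hj hi0 hj1
      have hp := (ht.pair i hi j hj hi0 hj1).1
      rw [hp2] at hp
      exact hp.final (by rw [ht.hub_eq hp2 hi hmem0, hn])
    -- Each item has a partner of the other parity, and the two values add up to a distance; so each
    -- is at most `D`, although only `n` is known before the merging ends.
    have hD : ∀ i ∈ t.items, i.a ≤ D := by
      intro i hi
      rcases Nat.mod_two_eq_zero_or_one i.o with h | h
      · obtain ⟨j, hj, hj1⟩ := ht.odd
        have := hfin i hi j hj h hj1
        have := H.T_le (ht.valid i hi).1 (ht.valid j hj).1 h hj1
        omega
      · obtain ⟨j, hj, hj1⟩ := ht.even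
        have := hfin j hj i hi hj1 h
        have := H.T_le (ht.valid j hj).1 (ht.valid i hi).1 hj1 h
        omega
    have hDn := H.D_lt
    have hXD : m * X ^ D ≤ s.var 16 * X ^ D := Nat.mul_le_mul_right _ (by omega)
    have heq := pairSum_eq_mul X H.T t.items hfin
    refine (finishTask_runs (l := t.items) (X := X) (D := D) (by simpa using g20)
      (hl₂.congr fun i _ => by simp) (by simpa using g5) hX hD (by omega)
      (by rw [← hm]; rw [add_mul] at hXK ⊢; omega)
      (by simpa [g17, ← heq] using hZ)).mono (le_max_left _ _) ?_
    rintro s' - ha h17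
    left
    have k15 : s'.var 15 = h' := by
      rw [ha.1 15 (by simp [finishTask, Prog.modVars])]; simpa using g15
    have k16 : s'.var 16 = b := by
      rw [ha.1 16 (by simp [finishTask, Prog.modVars])]; simp
    refine ⟨by simpa [g17, ← heq] using h17, ?_⟩
    rw [k15, k16]
    refine hst₂.congr (fun i _ => ?_) (fun i _ => ?_)
    · rw [ha.2 6 (by simp [finishTask, Prog.modArrs]), ha.2 7 (by simp [finishTask, Prog.modArrs])]
      simp
    · rw [ha.2 3 (by simp [finishTask, Prog.modArrs]), ha.2 4 (by simp [finishTask, Prog.modArrs]),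
        ha.2 5 (by simp [finishTask, Prog.modArrs])]
      simp
  · have hn : t.ph = 2 → ∀ i ∈ t.items, H.hub i < n := by
      intro hp i hi
      refine lt_of_le_of_ne (H.hub_le i) fun h => ?_
      exact hcond.2 ⟨hp, by rw [← ht.hub_eq hp hi hmem0, h]⟩ hc
    have hcur : CurOK H t (s₂.setVar 16 b) :=
      ⟨htab₂.congr (by simp) rfl rfl, hl₂.congr fun i _ => by simp,
        fun j hj => hk₂ hn j hj, by simpa using g18, by simpa using g20⟩
    refine (splitTask_runs (d := d) hcur ht hn hst₃ hd (by simp; omega) hnK).mono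
      (le_max_right _ _) ?_
    rintro s' - ha hs'
    right
    refine ⟨?_, fun h i hi => (hn h i hi).ne, hs'⟩
    rw [ha.1 17 (by simp [splitTask, findMedian, countKeys, pushTask, Prog.modVars])]
    simpa using g17

end RAM

namespace RAM

open RAM.Expr (get eq lt)
open HubData (Task)

variable {n D : ℕ} {H : HubData n D}

/-! ### The loop over the tasks -/

/-- The potential of a list of tasks. -/
noncomputable def potential (A δ : ℝ) (ts : List Task) : ℝ :=
  (ts.map fun t => A ^ t.r * (t.items.length : ℝ) ^ (1 + δ)).sum

/-- The sum of `g` over the pairs of all tasks. -/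
def totalSum (g : ℕ → ℕ → ℕ) (ts : List Task) : ℕ := (ts.map fun t => pairSum g t.items).sum

theorem potential_addTask_le {A δ : ℝ} (hA : 0 ≤ A) (t : Task) (ts : List Task) :
    potential A δ (addTask t ts) ≤
      A ^ t.r * (t.items.length : ℝ) ^ (1 + δ) + potential A δ ts := by
  unfold addTask potential
  split_ifs
  · simp
  · have : 0 ≤ A ^ t.r * (t.items.length : ℝ) ^ (1 + δ) := by positivity
    linarith

theorem totalSum_addTask (g : ℕ → ℕ → ℕ) (t : Task) (ts : List Task) :
    totalSum g (addTask t ts) = pairSum g t.items + totalSum g ts := by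
  unfold addTask totalSum
  split_ifs with h
  · simp
  · rw [pairSum_eq_zero g t.items h, zero_add]

theorem forall_addTask {p : Task → Prop} {t : Task} {ts : List Task}
    (h : HasPair t.items → p t) (h' : ∀ t ∈ ts, p t) : ∀ t' ∈ addTask t ts, p t' := by
  unfold addTask
  split_ifs with hp
  · exact List.forall_mem_cons.2 ⟨h hp, h'⟩
  · exact h'

theorem totalSum_splitTasks {t : Task} (ht : H.TaskOK t) (g : ℕ → ℕ → ℕ) (c : ℕ)
    (ts : List Task) : totalSum g (splitTasks H t c ts) = pairSum g t.items + totalSum g ts := by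
  simp only [splitTasks, totalSum_addTask]
  rw [pairSum_split g t.items (H.key t.ph) c
    (fun i _ j _ hi hj => H.key_ne ht.ph_le hi hj) (H.lowStep_o t.ph) (H.highStep_o t.ph)]
  ring

theorem splitTasks_ok {t : Task} (ht : H.TaskOK t)
    (hn : t.ph = 2 → ∀ i ∈ t.items, H.hub i ≠ n) (c : ℕ) {ts : List Task}
    (hts : ∀ t ∈ ts, H.TaskOK t) : ∀ t' ∈ splitTasks H t c ts, H.TaskOK t' := by
  have step : ∀ {l : List Item} {f : Item → Item}, (∀ i, (f i).o = i.o) → HasPair (l.map f) →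
      (∃ i ∈ l, i.o % 2 = 0) ∧ ∃ i ∈ l, i.o % 2 = 1 := by
    rintro l f hf ⟨⟨i, hi, hi0⟩, ⟨j, hj, hj1⟩⟩
    obtain ⟨i, hi', rfl⟩ := List.mem_map.1 hi
    obtain ⟨j, hj', rfl⟩ := List.mem_map.1 hj
    rw [hf] at hi0 hj1
    exact ⟨⟨i, hi', hi0⟩, ⟨j, hj', hj1⟩⟩
  refine forall_addTask (fun h => ?_) (forall_addTask (fun h => ?_) (forall_addTask (fun h => ?_)
    (forall_addTask (fun h => ?_) hts)))
  · obtain ⟨he, ho⟩ := step (H.highStep_o _) h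
    exact ht.high hn c he ho
  · obtain ⟨he, ho⟩ := step (H.lowStep_o _) h
    exact ht.low hn c he ho
  · rw [List.map_id] at h ⊢
    exact ht.filter _ h.1 h.2
  · rw [List.map_id] at h ⊢
    exact ht.filter _ h.1 h.2

theorem potential_splitTasks {A δ : ℝ} (hδ : 0 < δ) (hA0 : 0 < A)
    (hA : (2 : ℝ) ^ (-δ) + 3 / A ≤ 1) {t : Task} (ht : H.TaskOK t) {c : ℕ}
    (h₁ : 2 * (t.items.filter fun i => H.key t.ph i < c).length ≤ t.items.length)
    (h₂ : 2 * (t.items.filter fun i => c < H.key t.ph i).length ≤ t.items.length)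
    (ts : List Task) :
    potential A δ (splitTasks H t c ts) + t.items.length ≤ potential A δ (t :: ts) := by
  have hm : 1 ≤ t.items.length := by
    obtain ⟨i, hi, -⟩ := ht.even
    exact List.length_pos_of_mem hi
  have key := potential_split hδ hA0 hA ht.one_le_r hm h₁ h₂
    (List.length_filter_le (lowPart (H.key t.ph) c) t.items)
    (List.length_filter_le (highPart (H.key t.ph) c) t.items)
  unfold splitTasks
  refine le_trans (add_le_add_left (potential_addTask_le hA0.le _ _) _) ?_
  have e1 := potential_addTask_le (δ := δ) hA0.le ⟨if t.ph = 0 then 1 else 0, t.r - 1,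
      (t.items.filter (lowPart (H.key t.ph) c)).map (H.lowStep t.ph)⟩ <|
    addTask ⟨t.ph, t.r, (t.items.filter fun i => c < H.key t.ph i).map id⟩ <|
    addTask ⟨t.ph, t.r, (t.items.filter fun i => H.key t.ph i < c).map id⟩ ts
  have e2 := potential_addTask_le (δ := δ) hA0.le
      ⟨t.ph, t.r, (t.items.filter fun i => c < H.key t.ph i).map id⟩ <|
    addTask ⟨t.ph, t.r, (t.items.filter fun i => H.key t.ph i < c).map id⟩ ts
  have e3 := potential_addTask_le (δ := δ) hA0.le
    ⟨t.ph, t.r, (t.items.filter fun i => H.key t.ph i < c).map id⟩ ts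
  have e4 : potential A δ (t :: ts) =
      A ^ t.r * (t.items.length : ℝ) ^ (1 + δ) + potential A δ ts := by simp [potential]
  simp only [List.length_map] at e1 e2 e3 ⊢
  rw [e4]
  linarith

theorem one_le_of_split {A δ : ℝ} (hA0 : 0 < A) (hA : (2 : ℝ) ^ (-δ) + 3 / A ≤ 1) : 1 ≤ A := by
  have : 3 / A ≤ 1 := by
    have := Real.rpow_pos_of_pos (show (0 : ℝ) < 2 by norm_num) (-δ)
    linarith
  rw [div_le_one hA0] at this
  linarith

theorem length_le_potential {A δ : ℝ} (hδ : 0 < δ) (hA : 1 ≤ A) (r m : ℕ) :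
    (m : ℝ) ≤ A ^ r * (m : ℝ) ^ (1 + δ) := by
  rcases Nat.eq_zero_or_pos m with rfl | hm
  · simp; positivity
  · have h1 : (m : ℝ) ≤ (m : ℝ) ^ (1 + δ) := by
      conv_lhs => rw [← Real.rpow_one (m : ℝ)]
      exact Real.rpow_le_rpow_of_exponent_le (by exact_mod_cast hm) (by linarith)
    exact h1.trans (le_mul_of_one_le_left (by positivity) (one_le_pow₀ hA))

theorem sum_length_le_potential {A δ : ℝ} (hδ : 0 < δ) (hA : 1 ≤ A) (ts : List Task) :
    (((ts.map fun t => t.items.length).sum : ℕ) : ℝ) ≤ potential A δ ts := by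
  induction ts with
  | nil => simp [potential]
  | cons t ts ih =>
    simp only [potential, List.map_cons, List.sum_cons, Nat.cast_add] at ih ⊢
    exact add_le_add (length_le_potential hδ hA _ _) ih

/-- Processing a task with `m` items takes at most `m * (3 * D + 10 * d + 100)` steps and lowers the
potential by at least `m`. The potential also dominates the number of items on the stack, so `M`
bounds time and memory at once. -/
theorem taskLoop_runs {K d X M : ℕ} {A δ : ℝ} (hδ : 0 < δ) (hA0 : 0 < A)
    (hA : (2 : ℝ) ^ (-δ) + 3 / A ≤ 1) {s : State} {t : Task} (htab : TabOK H s)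
    (h5 : s.var 5 = X) (hX : 1 ≤ X) (h17 : s.var 17 = 0)
    (ht : H.TaskOK t) (hst : Stack s [t] (s.var 15) (s.var 16)) (hd : 4 * n + 1 < 2 ^ d)
    (hM : potential A δ [t] ≤ M) (hK : 4 * M + 1 < K) (hnK : 8 * n + 10 < K)
    (hXK : (M + 1) * X ^ D + M < K) (hZ : pairSum (fun o o' => X ^ H.T o o') t.items < K) :
    Runs K (.loop ‡15 taskStep) s ((3 * D + 10 * d + 101) * M + 1) fun s' =>
      s'.var 17 = pairSum (fun o o' => X ^ H.T o o') t.items := by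
  set g : ℕ → ℕ → ℕ := fun o o' => X ^ H.T o o' with hg
  -- One more than the cost per item: since a task is nonempty, the excess pays for the test of the
  -- loop.
  set Y : ℕ := 3 * D + 10 * d + 101 with hY
  have hA1 := one_le_of_split hA0 hA
  refine (Runs.loop_potential (fun x s' => TabOK H s' ∧ s'.var 5 = X ∧ ∃ ts,
    Stack s' ts (s'.var 15) (s'.var 16) ∧ (∀ t ∈ ts, H.TaskOK t) ∧
    s'.var 17 + totalSum g ts = pairSum g t.items ∧ potential A δ ts ≤ M ∧
    Y * potential A δ ts = x) (φ := Y * potential A δ [t]) ?_ ?_ ?_).mono ?_ ?_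
  · exact ⟨htab, h5, [t], hst, by simpa using ht, by simp [h17, totalSum], hM, rfl⟩
  · rintro x s' ⟨-, -, ts, -, -, -, -, rfl⟩
    have : 0 ≤ potential A δ ts := by
      have := sum_length_le_potential hδ hA1 ts
      exact (Nat.cast_nonneg _).trans this
    positivity
  · rintro x s' ⟨htab', h5', ts, hst', hok, hsum, hpM, rfl⟩ - hbd hne
    rcases ts with _ | ⟨t', ts⟩
    · exact absurd hst'.1 (by simpa using hne)
    have hok' := List.forall_mem_cons.1 hok
    have hlen : 1 ≤ t'.items.length := by
      obtain ⟨i, hi, -⟩ := hok'.1.even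
      exact List.length_pos_of_mem hi
    have hsp : s'.var 16 ≤ M := by
      have h1 := sum_length_le_potential hδ hA1 (t' :: ts)
      rw [← hst'.sum] at h1
      exact_mod_cast h1.trans hpM
    have hts : totalSum g (t' :: ts) = pairSum g t'.items + totalSum g ts := by simp [totalSum]
    have hXD : (s'.var 16 + 1) * X ^ D ≤ (M + 1) * X ^ D := Nat.mul_le_mul_right _ (by omega)
    have hpot : potential A δ (t' :: ts) =
      A ^ t'.r * (t'.items.length : ℝ) ^ (1 + δ) + potential A δ ts := by simp [potential]
    have hpay : ∀ p : ℝ, p + t'.items.length ≤ potential A δ (t' :: ts) →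
        Y * p + (t'.items.length * (3 * D + 10 * d + 100) : ℕ) + 1 ≤
          Y * potential A δ (t' :: ts) := by
      intro p hp
      have h1 : (Y : ℝ) * (p + t'.items.length) ≤ Y * potential A δ (t' :: ts) :=
        mul_le_mul_of_nonneg_left hp (by positivity)
      have h2 : t'.items.length * (3 * D + 10 * d + 100) + 1 ≤ Y * t'.items.length := by
        rw [hY]; nlinarith
      have h3 : ((t'.items.length * (3 * D + 10 * d + 100) : ℕ) : ℝ) + 1 ≤
          Y * t'.items.length := by exact_mod_cast h2
      linarith
    refine ⟨_, (taskStep_runs htab' h5' hX hok'.1 hst' hd (by omega) hnK (by omega)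
      (by rw [← hg]; omega)).mono le_rfl ?_⟩
    rintro s'' - ha h
    have htab'' : TabOK H s'' := htab'.congr
      (ha.1 4 (by simp [taskStep, copyTask, finishTask, splitTask, findMedian, countKeys, pushTask,
        Prog.modVars]))
      (ha.2 1 (by simp [taskStep, copyTask, finishTask, splitTask, findMedian, countKeys, pushTask,
        Prog.modArrs]))
      (ha.2 2 (by simp [taskStep, copyTask, finishTask, splitTask, findMedian, countKeys, pushTask,
        Prog.modArrs]))
    have h5'' : s''.var 5 = X := by
      rw [ha.1 5 (by simp [taskStep, copyTask, finishTask, splitTask, findMedian, countKeys,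
        pushTask, Prog.modVars]), h5']
    rw [← hg] at h
    rcases h with ⟨h17'', hst''⟩ | ⟨h17'', hn, c, hc1, hc2, hst''⟩
    · have hle := length_le_potential hδ hA1 t'.r t'.items.length
      exact ⟨_, hpay (potential A δ ts) (by linarith), htab'', h5'', ts, hst'', hok'.2,
        by rw [h17'']; omega, by linarith [Nat.cast_nonneg (α := ℝ) t'.items.length], rfl⟩
    · have hle := potential_splitTasks hδ hA0 hA hok'.1 hc1 hc2 ts
      refine ⟨_, hpay _ hle, htab'', h5'', _, hst'', splitTasks_ok hok'.1 hn c hok'.2, ?_, ?_, rfl⟩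
      · rw [h17'', totalSum_splitTasks hok'.1]; omega
      · linarith [Nat.cast_nonneg (α := ℝ) t'.items.length]
  · refine Nat.add_le_add_right (Nat.floor_le_of_le ?_) 1
    push_cast
    exact mul_le_mul_of_nonneg_left hM (by positivity)
  · rintro s' - - ⟨hc, ⟨-, -, -, ts, hst', -, hsum, -⟩, -⟩
    rcases ts with _ | ⟨t', ts⟩
    · simpa [totalSum] using hsum
    · obtain ⟨h', b, h15, -⟩ := hst'
      simp [h15] at hc

end RAM

namespace RAM

open RAM.Expr (get eq lt)
open HubData (Task)

variable {n D : ℕ} {H : HubData n D}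

/-! ### Reading the input -/

/-- `W` is an input word: the label of owner `o` has length `len o` and starts at `pos o`. -/
structure InputOK (H : HubData n D) (W pos len : ℕ → ℕ) (k : ℕ) : Prop where
  zero : W 0 = n
  le : ∀ i, W i ≤ n
  pos_zero : pos 0 = 1
  pos_succ : ∀ o, pos (o + 1) = pos o + 1 + 2 * len o
  len_eq : ∀ o < 2 * n, W (pos o) = len o
  len_le : ∀ o < 2 * n, len o ≤ k
  mem : ∀ o < 2 * n, ∀ j < len o, W (pos o + 1 + 2 * j) ∈ H.lab o
  dist : ∀ o < 2 * n, ∀ j < len o, W (pos o + 2 + 2 * j) = H.dd o (W (pos o + 1 + 2 * j))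
  surj : ∀ o < 2 * n, ∀ x ∈ H.lab o, ∃ j < len o, W (pos o + 1 + 2 * j) = x

theorem scanLabel_runs {K k : ℕ} {W pos len : ℕ → ℕ} (hW : InputOK H W pos len k) {s : State}
    {o : ℕ} (ho : o < 2 * n) (h0 : s.arr 0 = W) (h4 : s.var 4 = n) (h6 : s.var 6 = pos o)
    (h8 : s.var 8 = len o) (hK : n + k + 2 < K) :
    Runs K scanLabel s (6 * k + 4) fun s' => s'.var 11 = H.nxt o (s.var 10) ∧
      (H.nxt o (s.var 10) < n → s'.var 12 = H.dd o (H.nxt o (s.var 10))) ∧ s'.var 12 ≤ n := by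
  have hk := hW.len_le o ho
  set c := s.var 10 with hc
  refine Runs.of_le (T := (len o * (5 + 1) + 1) + 1 + 1 + 1) ?_ (by omega)
  refine Runs.assign_seq (fun h => h.1 _) (Runs.assign_seq (fun _ => by simp; omega)
    (Runs.assign_seq (fun _ => by simp; omega) ?_))
  refine (Runs.for (fun j s' => s'.var 13 = j ∧ s'.var 11 ≤ n ∧ s'.var 12 ≤ n ∧
    (s'.var 11 < n → s'.var 11 ∈ H.lab o ∧ c ≤ s'.var 11 ∧ s'.var 12 = H.dd o (s'.var 11)) ∧
    ∀ i < j, c ≤ W (pos o + 1 + 2 * i) → s'.var 11 ≤ W (pos o + 1 + 2 * i)) (m := len o)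
    ?_ ?_ ?_).mono le_rfl ?_
  · simp [h4]
  · rintro j s' hj ⟨e13, -⟩ hag
    have : s'.var 8 = len o := by
      rw [hag.1 8 (by simp [Prog.modVars])]; simpa using h8
    simp [e13, this]
  · rintro j s' hj ⟨e13, e11, e12, e3, e5⟩ hag hbd
    have f0 : s'.arr 0 = W := by
      rw [hag.2 0 (by simp [Prog.modArrs])]; simpa using h0
    have f6 : s'.var 6 = pos o := by
      rw [hag.1 6 (by simp [Prog.modVars])]; simpa using h6
    have f10 : s'.var 10 = c := by
      rw [hag.1 10 (by simp [Prog.modVars])]; simp [hc]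
    have hx := hW.mem o ho j hj
    have hd := hW.dist o ho j hj
    have hdn := hW.le (pos o + 2 + 2 * j)
    have hxn := H.lab_lt hx
    refine Runs.assign_seq (T := 4) (fun h => h.2 _ _) ?_
    simp only [eval_get, eval_add, eval_mul, eval_var, eval_one, eval_two, f0, f6, e13]
    set x := W (pos o + 1 + 2 * j) with hxdef
    refine Runs.seq (T := 3) (T' := 1) (Q := fun t => t.var 13 = j ∧ t.var 11 ≤ n ∧ t.var 12 ≤ n ∧
      (t.var 11 < n → t.var 11 ∈ H.lab o ∧ c ≤ t.var 11 ∧ t.var 12 = H.dd o (t.var 11)) ∧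
      ∀ i < j + 1, c ≤ W (pos o + 1 + 2 * i) → t.var 11 ≤ W (pos o + 1 + 2 * i)) ?_ ?_
    · refine Runs.ite (T := 2) (fun hc => ?_) (fun hc => ?_)
      · have hxc : x < s'.var 11 ∧ c ≤ x := by
          simpa [f10, Nat.lt_succ_iff, and_comm] using hc
        refine Runs.assign_seq (T := 1) (fun h => h.1 _) (Runs.assign (fun h => h.2 _ _) ?_)
        simp only [eval_get, eval_add, eval_mul, eval_var, eval_two, setVar_var,
          setVar_arr, f0, f6, e13, Nat.reduceEqDiff, if_true, if_false]
        refine ⟨trivial, hxn.le, hdn, fun _ => ⟨hx, hxc.2, hd⟩, fun i hi hci => ?_⟩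
        rcases Nat.lt_succ_iff_lt_or_eq.1 hi with h | rfl
        · exact hxc.1.le.trans (e5 i h hci)
        · exact le_rfl
      · have hxc : ¬ (x < s'.var 11 ∧ c ≤ x) := by
          rw [and_comm]
          simpa [f10, Nat.lt_succ_iff] using hc
        refine Runs.of_le (Runs.skip ?_) (by norm_num)
        simp only [setVar_var, Nat.reduceEqDiff, if_false]
        refine ⟨e13, e11, e12, e3, fun i hi hci => ?_⟩
        rcases Nat.lt_succ_iff_lt_or_eq.1 hi with h | rfl
        · exact e5 i h hci
        · rw [← hxdef] at hci ⊢
          by_contra h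
          exact hxc ⟨by omega, hci⟩
    · rintro t - - ⟨t13, t11, t12, t3, t5⟩
      refine Runs.assign (fun _ => by simp [t13]; omega) ?_
      simp only [eval_add, eval_var, eval_one, setVar_var, Nat.reduceEqDiff, if_true, if_false]
      exact ⟨by rw [t13], t11, t12, t3, t5⟩
  · rintro s' - - ⟨⟨-, e11, e12, e3, e5⟩, -⟩
    have heq : s'.var 11 = H.nxt o c := H.eq_nxt e11 (fun h => ⟨(e3 h).1, (e3 h).2.1⟩) (by
      intro x hx hcx
      obtain ⟨j, hj, rfl⟩ := hW.surj o ho x hx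
      exact e5 j hj hcx)
    exact ⟨heq, fun h => by rw [← heq] at h ⊢; exact (e3 h).2.2, e12⟩

/-- The entry of the table for owner `o` and cut `c` is correct. -/
def EntryOK (H : HubData n D) (s : State) (o c : ℕ) : Prop :=
  s.arr 1 (o * (n + 1) + c) = H.nxt o c ∧
    (H.nxt o c < n → s.arr 2 (o * (n + 1) + c) = H.dd o (H.nxt o c))

theorem slot_inj {o o' c c' : ℕ} (hc : c ≤ n) (hc' : c' ≤ n)
    (h : o * (n + 1) + c = o' * (n + 1) + c') : o = o' ∧ c = c' := by
  have h1 : (o * (n + 1) + c) / (n + 1) = o := by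
    rw [mul_comm, Nat.mul_add_div (by omega), Nat.div_eq_of_lt (by omega), add_zero]
  have h2 : (o' * (n + 1) + c') / (n + 1) = o' := by
    rw [mul_comm, Nat.mul_add_div (by omega), Nat.div_eq_of_lt (by omega), add_zero]
  have : o = o' := by rw [← h1, ← h2, h]
  subst this
  exact ⟨rfl, by omega⟩

theorem tabulateLabel_runs {K k : ℕ} {W pos len : ℕ → ℕ} (hW : InputOK H W pos len k) {s : State}
    {o : ℕ} (ho : o < 2 * n) (h0 : s.arr 0 = W) (h4 : s.var 4 = n) (h6 : s.var 6 = pos o)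
    (h7 : s.var 7 = o) (h8 : s.var 8 = len o) (h9 : s.var 9 = 0) (h10 : s.var 10 = 0)
    (h2 : ∀ i, s.arr 2 i ≤ n) (hK : n + k + 2 < K) :
    Runs K tabulateLabel s ((k + 1) * (6 * k + 9) + 1) fun s' =>
      (∀ i, s'.arr 2 i ≤ n) ∧ (∀ o' c, c ≤ n → EntryOK H s o' c → EntryOK H s' o' c) ∧
      ∀ c, (c = 0 ∨ ∃ x ∈ H.lab o, c = x + 1) → EntryOK H s' o c := by
  have hk := hW.len_le o ho
  -- In round `i` the cut is `0` or lies just behind the hub with index `i - 1`. The guard `i ≤ len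
  -- o` excludes the final state, whose cut was read from beyond the label.
  refine (Runs.for (b := (6 * k + 4) + 4) (fun i s' => s'.var 9 = i ∧
    (i ≤ len o → s'.var 10 = 0 ∧ i = 0 ∨ ∃ j < len o, i = j + 1 ∧
      s'.var 10 = W (pos o + 1 + 2 * j) + 1) ∧ (∀ i, s'.arr 2 i ≤ n) ∧
    (∀ o' c, c ≤ n → EntryOK H s o' c → EntryOK H s' o' c) ∧
    (0 < i → EntryOK H s' o 0) ∧
    ∀ j < len o, j + 1 < i → EntryOK H s' o (W (pos o + 1 + 2 * j) + 1)) (m := len o + 1)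
    ?_ ?_ ?_).mono (Nat.add_le_add_right (Nat.mul_le_mul (by omega) (by omega)) 1) ?_
  · exact ⟨h9, fun _ => Or.inl ⟨h10, rfl⟩, h2, fun _ _ _ h => h, by omega, by omega⟩
  · rintro i s' hi ⟨e9, -⟩ hag
    have : s'.var 8 = len o := by
      rw [hag.1 8 (by simp [scanLabel, Prog.modVars])]; simpa using h8
    simp [e9, this]
  · rintro i s' hi ⟨e9, e10, e2, eold, enew, enew'⟩ hag hbd
    have f0 : s'.arr 0 = W := by
      rw [hag.2 0 (by simp [scanLabel, Prog.modArrs])]; exact h0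
    have f4 : s'.var 4 = n := by
      rw [hag.1 4 (by simp [scanLabel, Prog.modVars])]; exact h4
    have f6 : s'.var 6 = pos o := by
      rw [hag.1 6 (by simp [scanLabel, Prog.modVars])]; exact h6
    have f7 : s'.var 7 = o := by
      rw [hag.1 7 (by simp [scanLabel, Prog.modVars])]; exact h7
    have f8 : s'.var 8 = len o := by
      rw [hag.1 8 (by simp [scanLabel, Prog.modVars])]; exact h8
    replace e10 := e10 (by omega)
    set c := s'.var 10 with hc
    have hcn : c ≤ n := by
      rcases e10 with h | ⟨j, hj, -, h⟩
      · omega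
      · have := H.lab_lt (hW.mem o ho j hj); omega
    refine Runs.seq (T := 6 * k + 4) (T' := 4) (scanLabel_runs hW ho f0 f4 f6 f8 hK) ?_
    rintro t hbt hat ⟨t11, t12, t12'⟩
    have g0 : t.arr 0 = W := by
      rw [hat.2 0 (by simp [scanLabel, Prog.modArrs])]; exact f0
    have g1 : t.arr 1 = s'.arr 1 := hat.2 1 (by simp [scanLabel, Prog.modArrs])
    have g2 : t.arr 2 = s'.arr 2 := hat.2 2 (by simp [scanLabel, Prog.modArrs])
    have g4 : t.var 4 = n := by
      rw [hat.1 4 (by simp [scanLabel, Prog.modVars])]; exact f4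
    have g6 : t.var 6 = pos o := by
      rw [hat.1 6 (by simp [scanLabel, Prog.modVars])]; exact f6
    have g7 : t.var 7 = o := by
      rw [hat.1 7 (by simp [scanLabel, Prog.modVars])]; exact f7
    have g9 : t.var 9 = i := by
      rw [hat.1 9 (by simp [scanLabel, Prog.modVars])]; exact e9
    have g10 : t.var 10 = c := hat.1 10 (by simp [scanLabel, Prog.modVars])
    rw [← hc] at t11 t12
    have hWn := hW.le (pos o + 1 + 2 * i)
    refine Runs.put_seq (fun h => h.1 _) (Runs.put_seq (fun h => h.1 _)
      (Runs.assign_seq (fun _ => ?_) (Runs.assign (fun _ => ?_) ?_)))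
    · simp [g0, g6, g9]; omega
    · simp [g9]; omega
    simp only [eval_get, eval_add, eval_mul, eval_var, eval_one, eval_two, setVar_var, setArr_var,
      setVar_arr, setArr_arr, g0, g4, g6, g7, g9, g10, Nat.reduceEqDiff, if_true,
      if_false, zero_ne_one, OfNat.zero_ne_ofNat, false_and]
    generalize hu : ((((t.setArr 1 (o * (n + 1) + c) (t.var 11)).setArr 2 (o * (n + 1) + c)
      (t.var 12)).setVar 10 (W (pos o + 1 + 2 * i) + 1)).setVar 9 (i + 1)) = u
    have hcur : EntryOK H u o c := by
      simp only [EntryOK, ← hu, setVar_arr, setArr_arr]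
      simpa using ⟨t11, t12⟩
    have hpres : ∀ o' c', c' ≤ n → EntryOK H s' o' c' → EntryOK H u o' c' := by
      intro o' c' hc' he
      by_cases h : o' * (n + 1) + c' = o * (n + 1) + c
      · obtain ⟨rfl, rfl⟩ := slot_inj hc' hcn h
        exact hcur
      · simp only [EntryOK, ← hu, setVar_arr, setArr_arr, h, and_false, if_false, g1, g2]
        exact he
    have hcut : ∀ j < len o, W (pos o + 1 + 2 * j) + 1 ≤ n := fun j hj =>
      H.lab_lt (hW.mem o ho j hj)
    refine ⟨trivial, fun hle => Or.inr ⟨i, by omega, rfl, rfl⟩, fun a => ?_,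
      fun o' c' hc' he => hpres o' c' hc' (eold o' c' hc' he), fun _ => ?_, fun j hj hji => ?_⟩
    · rw [g2]
      split_ifs
      · exact t12'
      · simpa using e2 a
    · rcases e10 with ⟨h, -⟩ | ⟨j, hj, hji, h⟩
      · rw [← h]; exact hcur
      · exact hpres o 0 (by omega) (enew (by omega))
    · by_cases h : j + 1 < i
      · exact hpres o _ (hcut j hj) (enew' j hj h)
      · rcases e10 with ⟨-, h'⟩ | ⟨j', hj', hji', h'⟩
        · omega
        · obtain rfl : j' = j := by omega
          rw [← h']; exact hcur
  · rintro s' - - ⟨⟨-, -, e2, eold, enew, enew'⟩, -⟩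
    refine ⟨e2, eold, ?_⟩
    rintro c (rfl | ⟨x, hx, rfl⟩)
    · exact enew (by omega)
    · obtain ⟨j, hj, rfl⟩ := hW.surj o ho x hx
      exact enew' j hj (by omega)

theorem readInput_runs {K k : ℕ} {W pos len : ℕ → ℕ} (hW : InputOK H W pos len k) {s : State}
    (h0 : s.arr 0 = W) (h4 : s.var 4 = n) (h6 : s.var 6 = 1) (h7 : s.var 7 = 0)
    (h2 : ∀ i, s.arr 2 i ≤ n) (hK : 2 * n + k + 2 < K) (hp : pos (2 * n) < K) :
    Runs K readInput s (2 * n * ((k + 1) * (6 * k + 9) + 10) + 1) fun s' => TabOK H s' ∧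
      Holds s' 3 4 5 0 ((List.range (2 * n)).map fun o => ⟨o, 0, n⟩) := by
  have hmono : ∀ o ≤ 2 * n, pos o ≤ pos (2 * n) := by
    intro o ho
    refine monotone_nat_of_le_succ (fun m => ?_) ho
    rw [hW.pos_succ]; omega
  refine (Runs.for (b := 6 + (((k + 1) * (6 * k + 9) + 1) + 2)) (fun o s' => s'.var 7 = o ∧
    s'.var 6 = pos o ∧ (∀ i, s'.arr 2 i ≤ n) ∧
    (∀ o' < o, ∀ c, (c = 0 ∨ ∃ x ∈ H.lab o', c = x + 1) → EntryOK H s' o' c) ∧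
    ∀ i < o, s'.arr 3 i = i ∧ s'.arr 4 i = 0 ∧ s'.arr 5 i = n) (m := 2 * n) ?_ ?_ ?_).mono
    (by ring_nf; omega) ?_
  · exact ⟨h7, h6.trans hW.pos_zero.symm, h2, by omega, by omega⟩
  · rintro o s' ho ⟨e7, -⟩ hag
    have : s'.var 4 = n := by
      rw [hag.1 4 (by simp [tabulateLabel, scanLabel, Prog.modVars])]; exact h4
    simp [e7, this]
  · rintro o s' ho ⟨e7, e6, e2, etab, eit⟩ hag hbd
    have f0 : s'.arr 0 = W := by
      rw [hag.2 0 (by simp [tabulateLabel, scanLabel, Prog.modArrs])]; exact h0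
    have f4 : s'.var 4 = n := by
      rw [hag.1 4 (by simp [tabulateLabel, scanLabel, Prog.modVars])]; exact h4
    have hlen := hW.len_eq o ho
    have hpos := hmono (o + 1) (by omega)
    rw [hW.pos_succ] at hpos
    refine Runs.of_le (T := (((k + 1) * (6 * k + 9) + 1) + 2) + 6) ?_ (by omega)
    refine Runs.assign_seq (fun h => h.2 _ _) (Runs.put_seq (fun h => h.1 _)
      (Runs.put_seq (fun _ => by simp; omega) (Runs.put_seq (fun h => h.1 _)
      (Runs.assign_seq (fun _ => by simp; omega) (Runs.assign_seq (fun _ => by simp; omega) ?_)))))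
    simp only [eval_get, eval_var, eval_zero, setVar_var, setArr_var, f0, f4,
      e6, e7, hlen, Nat.reduceEqDiff, if_false]
    generalize hu : (((((s'.setVar 8 (len o)).setArr 3 o o).setArr 4 o 0).setArr 5 o n).setVar
      10 0).setVar 9 0 = u
    have hent : ∀ o' c, EntryOK H u o' c ↔ EntryOK H s' o' c := by
      intro o' c; simp [EntryOK, ← hu]
    refine Runs.seq (T := (k + 1) * (6 * k + 9) + 1) (T' := 2) (tabulateLabel_runs hW ho
      (by ext; simp [← hu, f0]) (by simp [← hu, f4]) (by simp [← hu, e6]) (by simp [← hu, e7])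
      (by simp [← hu]) (by simp [← hu]) (by simp [← hu]) (by simpa [← hu] using e2)
      (by omega)) ?_
    rintro t hbt hat ⟨t2, told, tnew⟩
    have t6 : t.var 6 = pos o := by
      rw [hat.1 6 (by simp [tabulateLabel, scanLabel, Prog.modVars])]; simpa [← hu] using e6
    have t7 : t.var 7 = o := by
      rw [hat.1 7 (by simp [tabulateLabel, scanLabel, Prog.modVars])]; simpa [← hu] using e7
    have t8 : t.var 8 = len o := by
      rw [hat.1 8 (by simp [tabulateLabel, scanLabel, Prog.modVars])]; simp [← hu]
    refine Runs.assign_seq (T := 1) (fun _ => ?_) (Runs.assign (fun _ => ?_) ?_)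
    · simp [t6, t8]; omega
    · simp [t7]; omega
    simp only [eval_add, eval_mul, eval_var, eval_one, eval_two, setVar_var, setVar_arr, t6, t7, t8,
      Nat.reduceEqDiff, if_true, if_false, EntryOK]
    refine ⟨trivial, (hW.pos_succ o).symm, t2, fun o' ho' c hc => ?_, fun i hi => ?_⟩
    · rcases Nat.lt_succ_iff_lt_or_eq.1 ho' with h | rfl
      · refine told o' c ?_ ((hent o' c).2 (etab o' h c hc))
        rcases hc with rfl | ⟨x, hx, rfl⟩
        · omega
        · exact H.lab_lt hx
      · exact tnew c hc
    · rw [hat.2 3 (by simp [tabulateLabel, scanLabel, Prog.modArrs]),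
        hat.2 4 (by simp [tabulateLabel, scanLabel, Prog.modArrs]),
        hat.2 5 (by simp [tabulateLabel, scanLabel, Prog.modArrs])]
      rcases Nat.lt_succ_iff_lt_or_eq.1 hi with h | rfl
      · simpa [← hu, h.ne] using eit i h
      · simp [← hu]
  · rintro s' - ha ⟨⟨-, -, e2, etab, eit⟩, -⟩
    have f4 : s'.var 4 = n := by
      rw [ha.1 4 (by simp [tabulateLabel, scanLabel, Prog.modVars])]; exact h4
    refine ⟨⟨f4, fun o ho c hc => (etab o ho c hc).1, fun o ho c hc => (etab o ho c hc).2, e2⟩,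
      fun j hj => ?_⟩
    simp only [List.length_map, List.length_range] at hj
    simpa using eit j hj

end RAM

namespace RAM

open RAM.Expr (get eq lt)
open HubData (Task)

variable {n D : ℕ} {H : HubData n D}

/-! ### Writing the output -/

/-- Repeated division by `X` uncovers the digits `N e`; as `N D` is not zero there are exactly `D +
1` of them, which gives `D` to the program. The sums are kept as unreduced fractions: the
denominators are at most `(D + 1) ^ D` and the numerators at most `S` times the denominators. -/
theorem writeOutput_runs {K X S : ℕ} {N : ℕ → ℕ} {s : State} (h5 : s.var 5 = X)
    (h17 : s.var 17 = ∑ e ∈ Finset.range (D + 1), N e * X ^ e) (hN : ∀ e, N e < X) (hND : N D ≠ 0)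
    (hS : ∑ e ∈ Finset.range D, N (e + 1) ≤ S) (hK : (S + 1) * (D + 1) ^ D + D + 2 < K) :
    Runs K writeOutput s (10 * D + 12) fun s' =>
      s'.var 1 ≠ 0 ∧
      (s'.var 0 : ℚ) = s'.var 1 * ∑ e ∈ Finset.range D, (N (e + 1) : ℚ) / ((e + 1 : ℕ) : ℚ) ∧
      s'.var 3 ≠ 0 ∧
      (s'.var 2 : ℚ) = s'.var 3 * ∑ e ∈ Finset.range D, (N (e + 1) : ℚ) / ((D - e : ℕ) : ℚ) := by
  have hX : 0 < X := (Nat.zero_le _).trans_lt (hN 0)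
  -- The contents of the accumulator after `i` digits have been removed.
  set Z : ℕ → ℕ := fun i => ∑ e ∈ Finset.range (D + 1 - i), N (i + e) * X ^ e with hZ
  have hZs : ∀ i < D + 1, Z i = N i + X * Z (i + 1) := by
    intro i hi
    simp only [hZ]
    rw [show D + 1 - i = (D + 1 - (i + 1)) + 1 by omega, Finset.sum_range_succ', Finset.mul_sum,
      add_comm]
    simp only [add_zero, pow_zero, mul_one]
    congr 1
    refine Finset.sum_congr rfl fun e _ => ?_
    rw [show i + (e + 1) = i + 1 + e by ring, pow_succ]; ring
  have hZ0 : ∀ i ≤ D + 1, (Z i ≠ 0 ↔ i < D + 1) := by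
    intro i hi
    refine ⟨fun h => ?_, fun h => ?_⟩
    · by_contra hcon
      exact h (by simp [hZ, show D + 1 - i = 0 by omega])
    · have : N (i + (D - i)) * X ^ (D - i) ≤ Z i :=
        Finset.single_le_sum (f := fun e => N (i + e) * X ^ e) (fun _ _ => Nat.zero_le _)
          (Finset.mem_range.2 (by omega))
      rw [show i + (D - i) = D by omega] at this
      have : 0 < N D * X ^ (D - i) := Nat.mul_pos (Nat.pos_of_ne_zero hND) (pow_pos hX _)
      omega
  have hpow : ∀ j ≤ D, (D + 1) ^ j ≤ (D + 1) ^ D := fun j hj => Nat.pow_le_pow_right (by omega) hj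
  have hpow1 : 1 ≤ (D + 1) ^ D := Nat.one_le_pow _ _ (by omega)
  have hmulK : ∀ a v j, j ≤ D → a ≤ S + 1 → v ≤ (D + 1) ^ j → a * v < K := by
    intro a v j hj ha hv
    have := Nat.mul_le_mul ha (hv.trans (hpow j hj))
    omega
  refine Runs.of_le (T := (((D + 1) * (3 + 1) + 1) + (6 * D + 6)) + 1) ?_ (by omega)
  refine Runs.assign_seq (fun _ => by simp; omega) (Runs.seq (T := (D + 1) * (3 + 1) + 1)
    (T' := 6 * D + 6) (Runs.for (fun i s' => s'.var 31 = i ∧ s'.var 17 = Z i ∧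
      ∀ e < i, s'.arr 12 e = N e) (m := D + 1) ?_ ?_ ?_) ?_)
  · simp [hZ, h17]
  · rintro i s' hi ⟨-, e17, -⟩ -
    simpa [e17] using hZ0 i hi
  · rintro i s' hi ⟨e31, e17, e12⟩ hag hbd
    have e5 : s'.var 5 = X := by
      rw [hag.1 5 (by simp [Prog.modVars])]; simpa using h5
    have hmod : Z i % X = N i := by
      rw [hZs i hi, Nat.add_mul_mod_self_left, Nat.mod_eq_of_lt (hN i)]
    have hdiv : Z i / X = Z (i + 1) := by
      rw [hZs i hi, Nat.add_mul_div_left _ _ hX, Nat.div_eq_of_lt (hN i), zero_add]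
    refine Runs.put_seq (T := 2) (fun h => (Nat.mod_le _ _).trans_lt (h.1 17))
      (Runs.assign_seq (fun h => (Nat.div_le_self _ _).trans_lt (h.1 17))
      (Runs.assign (fun _ => ?_) ?_))
    · simp [e31]; omega
    · simp only [eval_add, eval_div, eval_mod, eval_var, eval_one, setVar_var, setArr_var,
        setVar_arr, setArr_arr, e31, e17, e5, hmod, hdiv, Nat.reduceEqDiff, if_true, if_false,
        true_and]
      intro e he
      split_ifs with h
      · rw [h]
      · exact e12 e (by omega)
  · rintro s' hbd - ⟨⟨e31, -, e12⟩, -⟩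
    refine Runs.of_le (T := (D * (5 + 1) + 1) + 5) ?_ (by omega)
    refine Runs.assign_seq (fun _ => by simp; omega) (Runs.assign_seq (fun _ => by simp; omega)
      (Runs.assign_seq (fun _ => by simp; omega) (Runs.assign_seq (fun _ => by simp; omega)
      (Runs.assign_seq (fun _ => by simp; omega) ?_))))
    refine (Runs.for (fun j t => t.var 13 = j + 1 ∧
      (t.var 1 ≠ 0 ∧ t.var 1 ≤ (D + 1) ^ j ∧
        t.var 0 ≤ (∑ e ∈ Finset.range j, N (e + 1)) * t.var 1 ∧
        (t.var 0 : ℚ) = t.var 1 * ∑ e ∈ Finset.range j, (N (e + 1) : ℚ) / ((e + 1 : ℕ) : ℚ)) ∧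
      (t.var 3 ≠ 0 ∧ t.var 3 ≤ (D + 1) ^ j ∧
        t.var 2 ≤ (∑ e ∈ Finset.range j, N (e + 1)) * t.var 3 ∧
        (t.var 2 : ℚ) = t.var 3 * ∑ e ∈ Finset.range j, (N (e + 1) : ℚ) / ((D - e : ℕ) : ℚ)))
      (m := D) ?_ ?_ ?_).mono le_rfl ?_
    · simp
    · rintro j t hj ⟨t13, -⟩ hat
      have t31 : t.var 31 = D + 1 := by
        rw [hat.1 31 (by simp [Prog.modVars])]; simpa using e31
      simp [t13, t31]
    · rintro j t hj ⟨t13, ⟨a1, a2, a3, a4⟩, ⟨b1, b2, b3, b4⟩⟩ hat hbt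
      have t31 : t.var 31 = D + 1 := by
        rw [hat.1 31 (by simp [Prog.modVars])]; simpa using e31
      have t12 : t.arr 12 (j + 1) = N (j + 1) := by
        rw [hat.2 12 (by simp [Prog.modArrs])]; simpa using e12 (j + 1) (by omega)
      have hSj : ∑ e ∈ Finset.range j, N (e + 1) + N (j + 1) ≤ S := by
        rw [← Finset.sum_range_succ (fun e => N (e + 1))]
        exact (Finset.sum_le_sum_of_subset (Finset.range_subset_range.2 hj)).trans hS
      have step : ∀ p q x : ℕ, 1 ≤ x → x ≤ D + 1 → q ≤ (D + 1) ^ j →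
          p ≤ (∑ e ∈ Finset.range j, N (e + 1)) * q →
          q * x ≤ (D + 1) ^ (j + 1) ∧
          p * x + N (j + 1) * q ≤ (∑ e ∈ Finset.range (j + 1), N (e + 1)) * (q * x) ∧
          p * x + N (j + 1) * q < K ∧ q * x < K := by
        intro p q x hx hxD hq hp
        have h1 : q * x ≤ (D + 1) ^ (j + 1) := by
          rw [pow_succ]; exact Nat.mul_le_mul hq hxD
        have h2 : p * x + N (j + 1) * q ≤ (∑ e ∈ Finset.range (j + 1), N (e + 1)) * (q * x) := by
          rw [Finset.sum_range_succ]
          calc p * x + N (j + 1) * q ≤ (∑ e ∈ Finset.range j, N (e + 1)) * q * x +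
                N (j + 1) * (q * x) := add_le_add (Nat.mul_le_mul_right _ hp)
                  (Nat.mul_le_mul_left _ (Nat.le_mul_of_pos_right _ hx))
            _ = _ := by ring
        refine ⟨h1, h2, h2.trans_lt (hmulK _ _ (j + 1) hj ?_ h1), ?_⟩
        · rw [Finset.sum_range_succ]; omega
        · simpa using hmulK 1 _ (j + 1) hj (by omega) h1
      obtain ⟨u1, u2, u3, u4⟩ := step (t.var 0) (t.var 1) (j + 1) (by omega) (by omega) a2 a3
      obtain ⟨v1, v2, v3, v4⟩ := step (t.var 2) (t.var 3) (D - j) (by omega) (by omega) b2 b3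
      -- With `D + 1` digits, the number of digits minus the distance is the denominator of the
      -- complementary index.
      have hDj : D + 1 - (j + 1) = D - j := by omega
      refine Runs.assign_seq (T := 4) (fun _ => ?_) (Runs.assign_seq (fun _ => ?_)
        (Runs.assign_seq (fun _ => ?_) (Runs.assign_seq (fun _ => ?_)
        (Runs.assign (fun _ => ?_) ?_))))
      · simpa [t13, t12] using u3
      · simpa [t13] using u4
      · simpa [t13, t31, t12, hDj] using v3
      · simpa [t13, t31, hDj] using v4
      · simp [t13]; omega
      · simp only [eval_add, eval_mul, eval_sub, eval_get, eval_var, eval_one, setVar_var,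
          setVar_arr, t13, t31, t12, hDj, Nat.reduceEqDiff, if_true, if_false, zero_ne_one,
          one_ne_zero, OfNat.zero_ne_ofNat, OfNat.ofNat_ne_zero, OfNat.ofNat_ne_one,
          OfNat.one_ne_ofNat]
        refine ⟨trivial, ⟨Nat.mul_ne_zero a1 (by omega), u1, u2, ?_⟩,
          ⟨Nat.mul_ne_zero b1 (by omega), v1, v2, ?_⟩⟩
        · have : ((j + 1 : ℕ) : ℚ) ≠ 0 := by positivity
          rw [Finset.sum_range_succ, Nat.cast_add, Nat.cast_mul, a4, Nat.cast_mul, Nat.cast_mul]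
          field_simp
        · have : ((D - j : ℕ) : ℚ) ≠ 0 := by
            exact_mod_cast (by omega : D - j ≠ 0)
          rw [Finset.sum_range_succ, Nat.cast_add, Nat.cast_mul, b4, Nat.cast_mul, Nat.cast_mul]
          field_simp
    · rintro t - - ⟨⟨-, ⟨a1, -, -, a4⟩, ⟨b1, -, -, b4⟩⟩, -⟩
      exact ⟨a1, a4, b1, b4⟩

/-! ### The whole program -/

/-- The initial task. -/
def initTask (n k : ℕ) : Task := ⟨0, 6 * k + 3, (List.range (2 * n)).map fun o => ⟨o, 0, n⟩⟩

/-- The two labels of a pair have at most `2 * k` hubs, so the rank in phase `0` is at most `3 * (2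
* k) + 3`. The values `n + n` exceed every target, and the hub given by `exists_hub` is still ahead
of both cuts. -/
theorem initTask_ok {k : ℕ} (hk : ∀ o < 2 * n, (H.lab o).card ≤ k) : H.TaskOK (initTask n k) := by
  have hn : 0 < n := (Nat.zero_le _).trans_lt H.D_lt
  have hmem : ∀ i ∈ (initTask n k).items, i.o < 2 * n ∧ i.c = 0 ∧ i.a = n := by
    intro i hi
    simp only [initTask, List.mem_map, List.mem_range] at hi
    obtain ⟨o, ho, rfl⟩ := hi
    exact ⟨ho, rfl, rfl⟩
  refine ⟨by simp [initTask], ⟨⟨0, 0, n⟩, ?_, rfl⟩, ⟨⟨1, 0, n⟩, ?_, rfl⟩, fun i hi => ?_,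
    fun i hi j hj hi0 hj1 => ?_⟩
  · simp [initTask, hn]
  · simp only [initTask, List.mem_map, List.mem_range]
    exact ⟨1, by omega, rfl⟩
  · obtain ⟨h1, h2, h3⟩ := hmem i hi
    exact ⟨h1, h3.le, Or.inl h2⟩
  · obtain ⟨h1, h2, h3⟩ := hmem i hi
    obtain ⟨g1, g2, g3⟩ := hmem j hj
    have hTD := H.T_le h1 g1 hi0 hj1
    have hDn := H.D_lt
    refine ⟨⟨by omega, Or.inr ?_, by simp [initTask], by simp [initTask]⟩, ?_⟩
    · obtain ⟨x, hx, hx', he⟩ := H.exists_hub h1 g1 hi0 hj1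
      exact ⟨x, hx, hx', by omega, by omega, he⟩
    · have r1 : H.rest i.o i.c ≤ k := (Finset.card_filter_le _ _).trans (hk _ h1)
      have r2 : H.rest j.o j.c ≤ k := (Finset.card_filter_le _ _).trans (hk _ g1)
      simp only [HubData.rank, initTask]
      omega

theorem indexProgram_runs {K k d M S : ℕ} {A δ : ℝ} (hδ : 0 < δ) (hA0 : 0 < A)
    (hA : (2 : ℝ) ^ (-δ) + 3 / A ≤ 1) {W pos len N : ℕ → ℕ} (hW : InputOK H W pos len k)
    (hk : ∀ o < 2 * n, (H.lab o).card ≤ k) {s : State} (h0 : s.arr 0 = W)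
    (h2 : ∀ i, s.arr 2 i = 0) (hd : 4 * n + 1 < 2 ^ d)
    (hM : A ^ (6 * k + 3) * ((2 * n : ℕ) : ℝ) ^ (1 + δ) ≤ M)
    (hZ : pairSum (fun o o' => (n * n + 1) ^ H.T o o') (initTask n k).items =
      ∑ e ∈ Finset.range (D + 1), N e * (n * n + 1) ^ e)
    (hN : ∀ e, N e < n * n + 1) (hND : N D ≠ 0) (hS : ∑ e ∈ Finset.range D, N (e + 1) ≤ S)
    (hK1 : 4 * M + 1 < K) (hK2 : 8 * n + k + 10 + n * n < K) (hK3 : pos (2 * n) < K)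
    (hK4 : (M + 1) * (n * n + 1) ^ D + M < K)
    (hK5 : pairSum (fun o o' => (n * n + 1) ^ H.T o o') (initTask n k).items < K)
    (hK6 : (S + 1) * (D + 1) ^ D + D + 2 < K) :
    Runs K indexProgram s
      (2 * n * ((k + 1) * (6 * k + 9) + 10) + (3 * D + 10 * d + 101) * M + 10 * D + 24) fun s' =>
      s'.var 1 ≠ 0 ∧
      (s'.var 0 : ℚ) = s'.var 1 * ∑ e ∈ Finset.range D, (N (e + 1) : ℚ) / ((e + 1 : ℕ) : ℚ) ∧
      s'.var 3 ≠ 0 ∧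
      (s'.var 2 : ℚ) = s'.var 3 * ∑ e ∈ Finset.range D, (N (e + 1) : ℚ) / ((D - e : ℕ) : ℚ) := by
  have hn : 0 < n := (Nat.zero_le _).trans_lt H.D_lt
  refine Runs.of_le (T := ((2 * n * ((k + 1) * (6 * k + 9) + 10) + 1) +
    ((((3 * D + 10 * d + 101) * M + 1) + (10 * D + 12)) + 5)) + 4) ?_ (by omega)
  refine Runs.assign_seq (fun h => h.2 _ _) (Runs.assign_seq (fun _ => ?_)
    (Runs.assign_seq (fun _ => by simp; omega) (Runs.assign_seq (fun _ => by simp; omega) ?_)))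
  · simp [h0, hW.zero]; omega
  simp only [eval_get, eval_add, eval_mul, eval_var, eval_zero, eval_one, setVar_var, if_true, h0,
    hW.zero]
  generalize hs₁ : (((s.setVar 4 n).setVar 5 (n * n + 1)).setVar 6 1).setVar 7 0 = s₁
  refine Runs.seq (T := 2 * n * ((k + 1) * (6 * k + 9) + 10) + 1)
    (T' := (((3 * D + 10 * d + 101) * M + 1) + (10 * D + 12)) + 5) (readInput_runs hW
    (by simpa [← hs₁] using h0) (by simp [← hs₁]) (by simp [← hs₁]) (by simp [← hs₁])
    (by simp [← hs₁, h2]) (by omega) hK3) ?_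
  rintro s₂ - ha₂ ⟨htab, hl⟩
  have g5 : s₂.var 5 = n * n + 1 := by
    rw [ha₂.1 5 (by simp [readInput, tabulateLabel, scanLabel, Prog.modVars])]; simp [← hs₁]
  refine Runs.put_seq (fun _ => by simp; omega) (Runs.put_seq (fun _ => by simp; omega)
    (Runs.assign_seq (fun _ => by simp; omega) (Runs.assign_seq (fun _ => ?_)
    (Runs.assign_seq (fun _ => by simp; omega) ?_))))
  · simp [htab.n_eq]; omega
  simp only [eval_zero, eval_one, eval_mul, eval_two, eval_var, setVar_var, setArr_var,
    Nat.reduceEqDiff, if_false, htab.n_eq]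
  generalize hs₃ : (((((s₂.setArr 6 0 0).setArr 7 0 0).setVar 15 1).setVar 16 (2 * n)).setVar
    17 0) = s₃
  have g5' : s₃.var 5 = n * n + 1 := by simpa [← hs₃] using g5
  have hloop := taskLoop_runs (H := H) (K := K) (d := d) (X := n * n + 1) (M := M) (s := s₃)
    (t := initTask n k) hδ hA0 hA
    (htab.congr (by simp [← hs₃]) (by ext; simp [← hs₃]) (by ext; simp [← hs₃])) g5'
    (by omega) (by simp [← hs₃]) (initTask_ok hk) ?_ hd (by simpa [potential, initTask] using hM)
    hK1 (by omega) hK4 hK5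
  · refine Runs.seq (T := (3 * D + 10 * d + 101) * M + 1) (T' := 10 * D + 12) hloop ?_
    rintro s₄ - ha₄ h17
    refine writeOutput_runs (X := n * n + 1) ?_ (h17.trans hZ) hN hND hS hK6
    rw [ha₄.1 5 (by simp [taskStep, copyTask, finishTask, splitTask, findMedian, countKeys,
      pushTask, Prog.modVars]), g5']
  · refine ⟨0, 0, by simp [← hs₃], by simp [← hs₃, initTask], ?_, by simp [← hs₃, initTask],
      by simp [← hs₃], hl.congr fun i _ => by simp [← hs₃], rfl, rfl⟩
    simp [initTask]; omega

end RAM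

/-! ### Hub labelings of bounded size exist only for graphs of bounded diameter -/

/-- Halve a window of length `2 * m`. For `i` in the left and `j` in the right half, the common
point `c` lies in one half, hence opposite to `i` or to `j`. These crossing incidences number at
least `m` and are not counted inside the halves, so the count satisfies $S(2m)\ge2S(m)+m$. -/
theorem hub_separation_card_le (R F : ℕ → Finset ℕ) (D : ℕ)
    (hRF : ∀ i j, i ≤ j → j ≤ D → ∃ c, c ∈ R i ∧ c ∈ F j ∧ i ≤ c ∧ c ≤ j) (h : ℕ) :
    ∀ a, a + 2 ^ h ≤ D + 1 → h * 2 ^ h ≤ 2 * ∑ i ∈ Finset.Ico a (a + 2 ^ h),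
      ((R i ∩ Finset.Ico a (a + 2 ^ h)).card + (F i ∩ Finset.Ico a (a + 2 ^ h)).card) := by
  induction h with
  | zero => simp
  | succ h ih =>
    intro a ha
    set m := 2 ^ h with hm
    have h2 : 2 ^ (h + 1) = 2 * m := by rw [pow_succ, mul_comm]
    rw [h2] at ha ⊢
    have e1 : a + 2 * m = a + m + m := by ring
    rw [e1]
    have hsplit : Finset.Ico a (a + m + m) = Finset.Ico a (a + m) ∪ Finset.Ico (a + m) (a + m + m) :=
      (Finset.Ico_union_Ico_eq_Ico (by omega) (by omega)).symm
    have hdisj : Disjoint (Finset.Ico a (a + m)) (Finset.Ico (a + m) (a + m + m)) :=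
      Finset.Ico_disjoint_Ico_consecutive _ _ _
    have hcard : ∀ S : Finset ℕ, (S ∩ Finset.Ico a (a + m + m)).card =
        (S ∩ Finset.Ico a (a + m)).card + (S ∩ Finset.Ico (a + m) (a + m + m)).card := fun S => by
      rw [hsplit, Finset.inter_union_distrib_left, Finset.card_union_of_disjoint]
      exact hdisj.mono Finset.inter_subset_right Finset.inter_subset_right
    have hl := ih a (by omega)
    have hr := ih (a + m) (by omega)
    have hextra : m ≤ ∑ i ∈ Finset.Ico a (a + m), (R i ∩ Finset.Ico (a + m) (a + m + m)).card +
        ∑ j ∈ Finset.Ico (a + m) (a + m + m), (F j ∩ Finset.Ico a (a + m)).card := by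
      -- Either every `i` on the left has a crossing point, or some `i` has none, and then its
      -- common point with any `j` on the right is a crossing point of `j`.
      by_cases hc : ∀ i ∈ Finset.Ico a (a + m), 1 ≤ (R i ∩ Finset.Ico (a + m) (a + m + m)).card
      · have := Finset.sum_le_sum hc
        simp at this
        omega
      · push Not at hc
        obtain ⟨i, hi, hc⟩ := hc
        have : ∀ j ∈ Finset.Ico (a + m) (a + m + m), 1 ≤ (F j ∩ Finset.Ico a (a + m)).card := by
          intro j hj
          rw [Finset.mem_Ico] at hi hj
          obtain ⟨c, hcR, hcF, hic, hcj⟩ := hRF i j (by omega) (by omega)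
          refine Finset.card_pos.2 ⟨c, ?_⟩
          have hn : c ∉ R i ∩ Finset.Ico (a + m) (a + m + m) := fun hmem => by
            have := Finset.card_pos.2 ⟨c, hmem⟩
            omega
          simp only [Finset.mem_inter, Finset.mem_Ico, not_and] at hn ⊢
          have := hn hcR
          exact ⟨hcF, by omega, by omega⟩
        have := Finset.sum_le_sum this
        simp at this
        omega
    rw [hsplit, Finset.sum_union hdisj, ← hsplit]
    simp only [hcard, Finset.sum_add_distrib] at hl hr ⊢
    have : (h + 1) * (2 * m) = h * m + h * m + 2 * m := by ring
    omega

/-- Segments of a shortest walk are shortest: each is at most as long as its number of edges, and a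
shortcut would shorten the whole walk by the triangle inequality. -/
theorem SimpleGraph.exists_isometric_path {V : Type*} {G : SimpleGraph V} (hG : G.Connected)
    (u v : V) : ∃ q : ℕ → V, ∀ i j, i ≤ j → j ≤ G.dist u v → G.dist (q i) (q j) = j - i := by
  obtain ⟨p, hp⟩ := hG.exists_walk_length_eq_dist u v
  refine ⟨p.getVert, ?_⟩
  have hle : ∀ i m, i + m ≤ p.length → G.dist (p.getVert i) (p.getVert (i + m)) ≤ m := by
    intro i m
    induction m with
    | zero => simp
    | succ m ih =>
      intro h
      have h1 := ih (by omega)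
      have h2 := SimpleGraph.dist_eq_one_iff_adj.2 (p.adj_getVert_succ (i := i + m) (by omega))
      have h3 := hG.dist_triangle (u := p.getVert i) (v := p.getVert (i + m))
        (w := p.getVert (i + m + 1))
      rw [← add_assoc]
      omega
  intro i j hij hj
  rw [← hp] at hj
  have h1 := hle 0 i (by omega)
  have h2 := hle i (j - i) (by omega)
  have h3 := hle j (p.length - j) (by omega)
  rw [zero_add] at h1
  rw [show i + (j - i) = j by omega] at h2
  rw [show j + (p.length - j) = p.length by omega] at h3
  rw [SimpleGraph.Walk.getVert_zero] at h1
  rw [SimpleGraph.Walk.getVert_length] at h3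
  have h4 := hG.dist_triangle (u := u) (v := p.getVert i) (w := v)
  have h5 := hG.dist_triangle (u := p.getVert i) (v := p.getVert j) (w := v)
  omega

namespace HubLabeling

variable {V : Type*} [Fintype V] {G : SimpleGraph V} (L : HubLabeling G)

theorem card_out_le (v : V) : (L.out v).card ≤ L.maxLabelSize :=
  (le_max_left _ _).trans
    (Finset.le_sup (f := fun v => max (L.out v).card (L.inn v).card) (Finset.mem_univ v))

theorem card_inn_le (v : V) : (L.inn v).card ≤ L.maxLabelSize :=
  (le_max_right _ _).trans
    (Finset.le_sup (f := fun v => max (L.out v).card (L.inn v).card) (Finset.mem_univ v))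

/-- A hub `x` of the path vertices with positions `i` and `j` projects to
$i+dist(q_i,x)=j-dist(x,q_j)$, a position between them. A path with $2^{4k+1}$ vertices would carry
at least $(4k+1)2^{4k}$ incidences, while the labels supply at most $2k\cdot2^{4k+1}$. -/
theorem diam_lt_two_pow {k : ℕ} (hG : G.Connected) (hk : L.maxLabelSize ≤ k) :
    G.diam < 2 ^ (4 * k + 1) := by
  have := hG.nonempty
  obtain ⟨u, v, huv⟩ := G.exists_dist_eq_diam
  obtain ⟨q, hq⟩ := SimpleGraph.exists_isometric_path hG u v
  rw [huv] at hq
  by_contra! hD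
  have key := hub_separation_card_le (fun i => (L.out (q i)).image fun x => i + G.dist (q i) x)
    (fun j => (L.inn (q j)).image fun x => j - G.dist x (q j)) G.diam ?_ (4 * k + 1) 0 (by omega)
  · have hle : ∀ i ∈ Finset.Ico 0 (0 + 2 ^ (4 * k + 1)),
        (((L.out (q i)).image fun x => i + G.dist (q i) x) ∩
          Finset.Ico 0 (0 + 2 ^ (4 * k + 1))).card +
        (((L.inn (q i)).image fun x => i - G.dist x (q i)) ∩
          Finset.Ico 0 (0 + 2 ^ (4 * k + 1))).card ≤ 2 * k := by
      intro i _
      have h1 := (Finset.card_le_card (Finset.inter_subset_left (s₂ :=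
        Finset.Ico 0 (0 + 2 ^ (4 * k + 1))))).trans (Finset.card_image_le (s := L.out (q i))
        (f := fun x => i + G.dist (q i) x))
      have h2 := (Finset.card_le_card (Finset.inter_subset_left (s₂ :=
        Finset.Ico 0 (0 + 2 ^ (4 * k + 1))))).trans (Finset.card_image_le (s := L.inn (q i))
        (f := fun x => i - G.dist x (q i)))
      have h3 := L.card_out_le (q i)
      have h4 := L.card_inn_le (q i)
      omega
    have := Finset.sum_le_sum hle
    simp only [Finset.sum_const, Nat.card_Ico, smul_eq_mul] at this
    have h0 := Nat.two_pow_pos (4 * k + 1)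
    simp only [Nat.zero_add, Nat.sub_zero] at this key
    nlinarith
  · intro i j hij hj
    obtain ⟨x, hx, hx', hd⟩ := (L.isLeast_dist (q i) (q j)).1
    rw [hq i j hij hj] at hd
    exact ⟨i + G.dist (q i) x, Finset.mem_image_of_mem _ hx,
      Finset.mem_image.2 ⟨x, hx', by omega⟩, by omega, by omega⟩

end HubLabeling

/-! ### The instance given by a hub labeling of a graph -/

theorem SimpleGraph.diam_lt_card {V : Type*} [Fintype V] {G : SimpleGraph V} (hG : G.Connected) :
    G.diam < Fintype.card V := by
  have := hG.nonempty
  obtain ⟨u, v, huv⟩ := G.exists_dist_eq_diam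
  obtain ⟨p, hp, hl⟩ := hG.exists_path_of_dist u v
  rw [← huv, ← hl]
  exact hp.length_lt

theorem SimpleGraph.Connected.dist_le_diam {V : Type*} [Finite V] {G : SimpleGraph V}
    (hG : G.Connected) (u v : V) : G.dist u v ≤ G.diam := by
  have := hG.nonempty
  exact SimpleGraph.dist_le_diam (SimpleGraph.connected_iff_ediam_ne_top.1 hG)

/-! ### Distance counts of a graph and the two indices. -/

namespace SimpleGraph

variable {V : Type*} [Fintype V] (G : SimpleGraph V)

/-- The number of ordered pairs of vertices at distance `e`. -/
noncomputable def distCount (e : ℕ) : ℕ :=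
  (Finset.univ.filter fun p : V × V => G.dist p.1 p.2 = e).card

theorem distCount_le (e : ℕ) : G.distCount e ≤ Fintype.card V * Fintype.card V := by
  rw [← Fintype.card_prod]
  exact Finset.card_le_univ _

theorem distCount_diam_ne_zero [Nonempty V] : G.distCount G.diam ≠ 0 := by
  obtain ⟨u, v, huv⟩ := G.exists_dist_eq_diam
  exact (Finset.card_pos.2 ⟨(u, v), by simpa using huv⟩).ne'

variable {G}

theorem sum_dist_eq_sum_distCount (hG : G.Connected) {R : Type*} [Semiring R] (f : ℕ → R) :
    ∑ p : V × V, f (G.dist p.1 p.2) =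
      ∑ e ∈ Finset.range (G.diam + 1), (G.distCount e : R) * f e := by
  rw [← Finset.sum_fiberwise_of_maps_to (s := Finset.univ) (t := Finset.range (G.diam + 1))
    (g := fun p : V × V => G.dist p.1 p.2)
    (fun p _ => Finset.mem_range.2 (Nat.lt_succ_of_le (hG.dist_le_diam _ _)))]
  refine Finset.sum_congr rfl fun e _ => ?_
  rw [Finset.sum_congr rfl fun p hp => by rw [(Finset.mem_filter.1 hp).2], Finset.sum_const,
    nsmul_eq_mul, distCount]

theorem sum_distCount_succ_le (hG : G.Connected) :
    ∑ e ∈ Finset.range G.diam, G.distCount (e + 1) ≤ Fintype.card V * Fintype.card V := by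
  have h := sum_dist_eq_sum_distCount hG (fun _ => 1)
  simp only [mul_one, Finset.sum_const, Finset.card_univ, smul_eq_mul, Fintype.card_prod,
    Nat.cast_id] at h
  rw [h, Finset.sum_range_succ']
  exact Nat.le_add_right _ _

theorem sum_offDiag_dist [DecidableEq V] (hG : G.Connected) (f : ℕ → ℚ) :
    ∑ p ∈ (Finset.univ : Finset V).offDiag, f (G.dist p.1 p.2) =
      ∑ e ∈ Finset.range G.diam, (G.distCount (e + 1) : ℚ) * f (e + 1) := by
  -- The value `0` at distance `0` removes the diagonal pairs.
  have h := sum_dist_eq_sum_distCount hG (fun e => if e = 0 then 0 else f e)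
  rw [Finset.sum_range_succ'] at h
  simp only [Nat.add_eq_zero_iff, one_ne_zero, and_false, if_false, if_true, mul_zero,
    add_zero] at h
  rw [← h, ← Finset.sum_subset (Finset.subset_univ (Finset.univ : Finset V).offDiag)]
  · refine Finset.sum_congr rfl fun p hp => ?_
    rw [if_neg fun h0 => (Finset.mem_offDiag.1 hp).2.2 (hG.dist_eq_zero_iff.1 h0)]
  · intro p _ hp
    have : p.1 = p.2 := by simpa using hp
    simp [this]

end SimpleGraph

theorem hararyIndex_eq_sum_distCount {V : Type*} [Fintype V] [DecidableEq V] {G : SimpleGraph V}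
    (hG : G.Connected) : hararyIndex G =
      ∑ e ∈ Finset.range G.diam, (G.distCount (e + 1) : ℚ) / ((e + 1 : ℕ) : ℚ) := by
  rw [hararyIndex, SimpleGraph.sum_offDiag_dist hG fun e => 1 / (e : ℚ)]
  exact Finset.sum_congr rfl fun e _ => mul_one_div _ _

theorem rcwIndex_eq_sum_distCount {V : Type*} [Fintype V] [DecidableEq V] {G : SimpleGraph V}
    (hG : G.Connected) : rcwIndex G =
      ∑ e ∈ Finset.range G.diam, (G.distCount (e + 1) : ℚ) / ((G.diam - e : ℕ) : ℚ) := by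
  rw [rcwIndex, SimpleGraph.sum_offDiag_dist hG fun e => 1 / ((G.diam : ℚ) + 1 - (e : ℚ))]
  refine Finset.sum_congr rfl fun e he => ?_
  rw [mul_one_div, Nat.cast_sub (Finset.mem_range.1 he).le]
  push_cast
  congr 1
  ring

theorem sum_range_two_mul (f : ℕ → ℕ) (n : ℕ) :
    ∑ o ∈ Finset.range (2 * n), f o = ∑ u ∈ Finset.range n, (f (2 * u) + f (2 * u + 1)) := by
  induction n with
  | zero => rfl
  | succ n ih =>
    rw [Nat.mul_succ, Finset.sum_range_succ, Finset.sum_range_succ, ih, Finset.sum_range_succ]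
    ring

/-- The owners `2 * u` and `2 * v + 1` represent the ordered pair of `u` and `v`, so each ordered
pair, the diagonal included, is counted once. -/
theorem pairSum_initTask (g : ℕ → ℕ → ℕ) (n k : ℕ) :
    pairSum g (RAM.initTask n k).items =
      ∑ p : Fin n × Fin n, g (2 * p.1) (2 * p.2 + 1) := by
  have hsum : ∀ (f : ℕ → ℕ) m, ((List.range m).map f).sum = ∑ i ∈ Finset.range m, f i :=
    fun _ _ => rfl
  simp only [pairSum, RAM.initTask, List.map_map, Function.comp_def, hsum]
  simp only [sum_range_two_mul]
  rw [Fintype.sum_prod_type, Finset.sum_range]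
  refine Finset.sum_congr rfl fun u _ => ?_
  rw [← Finset.sum_range fun v => g (2 * u) (2 * v + 1)]
  simp [Nat.add_mod, Nat.mul_mod_right]

/-! ### Labels of a graph as numerical data. -/

namespace HubLabeling

variable {n : ℕ} {G : SimpleGraph (Fin n)}

theorem connected_pos (hG : G.Connected) : 0 < n := hG.nonempty.elim Fin.pos

/-- The vertex that owns the label with number `o`: the labels `2 v` and `2 v + 1` belong
to `v`. -/
def vertex (hn : 0 < n) (o : ℕ) : Fin n := ⟨o / 2 % n, Nat.mod_lt _ hn⟩

/-- The hubs of a graph as natural numbers, with the out-labels at the even places and the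
in-labels at the odd places. -/
noncomputable def toHubData (L : HubLabeling G) (hG : G.Connected) : HubData n G.diam where
  lab o := (if o % 2 = 0 then L.out (vertex (connected_pos hG) o)
    else L.inn (vertex (connected_pos hG) o)).map Fin.valEmbedding
  -- The remainder only makes the function total; hubs are less than `n`. By symmetry one formula
  -- serves for out-labels and in-labels.
  dd o x := G.dist (vertex (connected_pos hG) o) ⟨x % n, Nat.mod_lt _ (connected_pos hG)⟩
  T o o' := G.dist (vertex (connected_pos hG) o) (vertex (connected_pos hG) o')
  D_lt := by simpa using SimpleGraph.diam_lt_card hG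
  lab_lt := by
    intro o x hx
    obtain ⟨y, -, rfl⟩ := Finset.mem_map.1 hx
    exact y.2
  dd_le _ := hG.dist_le_diam _ _
  T_le _ _ _ _ := hG.dist_le_diam _ _
  T_le_add _ _ _ _ _ _ := by
    exact hG.dist_triangle.trans_eq (congrArg _ G.dist_comm)
  exists_hub := by
    intro o o' _ _ he ho
    obtain ⟨x, hx, hx', hd⟩ := (L.isLeast_dist (vertex (connected_pos hG) o)
      (vertex (connected_pos hG) o')).1
    refine ⟨x, Finset.mem_map.2 ⟨x, by simpa [he] using hx, rfl⟩,
      Finset.mem_map.2 ⟨x, by simpa [ho] using hx', rfl⟩, ?_⟩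
    have : (⟨(x : ℕ) % n, Nat.mod_lt _ (connected_pos hG)⟩ : Fin n) = x :=
      Fin.ext (Nat.mod_eq_of_lt x.2)
    rw [this, hd, G.dist_comm (u := x)]

/-- The sequence of the labels in an input word. -/
def labelList (hn : 0 < n) (lo li : Fin n → List (Fin n)) (o : ℕ) : List (Fin n) :=
  if o % 2 = 0 then lo (vertex hn o) else li (vertex hn o)

theorem vertex_two_mul (hn : 0 < n) (v : Fin n) : vertex hn (2 * v) = v :=
  Fin.ext (by simp [vertex, Nat.mod_eq_of_lt v.2])

theorem vertex_two_mul_add_one (hn : 0 < n) (v : Fin n) : vertex hn (2 * v + 1) = v :=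
  Fin.ext (by
    have : (2 * (v : ℕ) + 1) / 2 = v := by omega
    simp [vertex, this, Nat.mod_eq_of_lt v.2])

end HubLabeling

/-! ### Positions in an input word. -/

section Words

variable {α : Type*}

theorem flatMap_range_two_mul (b : ℕ → List α) (m : ℕ) :
    ((List.range m).flatMap fun v => b (2 * v) ++ b (2 * v + 1)) =
      (List.range (2 * m)).flatMap b := by
  induction m with
  | zero => rfl
  | succ m ih => simp [Nat.mul_succ, List.range_succ, ih]

theorem flatMap_range_eq_append (b : ℕ → List α) {o m : ℕ} (h : o < m) :
    ∃ r, (List.range m).flatMap b = (List.range o).flatMap b ++ (b o ++ r) := by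
  induction m with
  | zero => omega
  | succ m ih =>
    rcases Nat.lt_succ_iff_lt_or_eq.1 h with h | rfl
    · obtain ⟨r, hr⟩ := ih h
      exact ⟨r ++ b m, by simp [List.range_succ, hr]⟩
    · exact ⟨[], by simp [List.range_succ]⟩

theorem getD_flatMap_pair (f g : α → ℕ) (l : List α) {j : ℕ} (hj : j < l.length) :
    (l.flatMap fun x => [f x, g x]).getD (2 * j) 0 = f l[j] ∧
      (l.flatMap fun x => [f x, g x]).getD (2 * j + 1) 0 = g l[j] := by
  induction l generalizing j with
  | nil => simp at hj
  | cons x l ih =>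
    cases j with
    | zero => simp
    | succ j =>
      have := ih (j := j) (by simpa using hj)
      simpa [Nat.mul_succ] using this

end Words

namespace HubLabeling

variable {n : ℕ} {G : SimpleGraph (Fin n)}

/-- Distances in an undirected graph are symmetric, so the blocks of the word have one format and
can be numbered uniformly, two for each vertex; the lengths of the earlier blocks give the position
of a block. -/
theorem exists_inputOK {k : ℕ} (L : HubLabeling G) (hG : G.Connected) (hk : L.maxLabelSize ≤ k)
    {w : List ℕ} (hw : L.Encodes w) :
    ∃ pos len, RAM.InputOK (L.toHubData hG) (fun i => w.getD i 0) pos len k := by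
  obtain ⟨lo, li, hlo, hli, rfl⟩ := hw
  have hn := connected_pos hG
  set ls := labelList hn lo li with hls
  set b : ℕ → List ℕ := fun o => encodeLabel (fun x => G.dist (vertex hn o) x) (ls o) with hb
  have hflat : ((List.finRange n).flatMap fun v =>
      encodeLabel (fun x => G.dist v x) (lo v) ++ encodeLabel (fun x => G.dist x v) (li v)) =
      (List.range (2 * n)).flatMap b := by
    rw [← flatMap_range_two_mul, ← List.map_coe_finRange_eq_range, List.flatMap_map]
    congr 1
    funext v
    simp only [hb, hls, labelList, vertex_two_mul, vertex_two_mul_add_one,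
      G.dist_comm (v := v)]
    simp [Nat.add_mod, Nat.mul_mod_right]
  have hnodup : ∀ o, (ls o).Nodup := fun o => by
    rw [hls, labelList]
    split_ifs
    exacts [(hlo _).1, (hli _).1]
  have hfin : ∀ o, ((ls o).toFinset).map Fin.valEmbedding = (L.toHubData hG).lab o := fun o => by
    simp only [hls, labelList, toHubData]
    split_ifs
    exacts [by rw [(hlo _).2], by rw [(hli _).2]]
  have hlen : ∀ o, (ls o).length ≤ L.maxLabelSize := fun o => by
    rw [← List.toFinset_card_of_nodup (hnodup o), hls, labelList]
    split_ifs
    exacts [by rw [(hlo _).2]; exact L.card_out_le _, by rw [(hli _).2]; exact L.card_inn_le _]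
  have hlenn : ∀ o, (ls o).length ≤ n := fun o => by
    simpa using (hnodup o).length_le_card
  rw [hflat]
  have hblen : ∀ o, (b o).length = 1 + 2 * (ls o).length := fun o => by
    simp [hb, encodeLabel]; omega
  have hget : ∀ o < 2 * n, ∀ j, j < (b o).length →
      (n :: (List.range (2 * n)).flatMap b).getD
        (1 + ((List.range o).flatMap b).length + j) 0 = (b o).getD j 0 := by
    intro o ho j hj
    obtain ⟨r, hr⟩ := flatMap_range_eq_append b ho
    rw [hr, show 1 + ((List.range o).flatMap b).length + j =
      ((List.range o).flatMap b).length + j + 1 by ring, List.getD_cons_succ,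
      List.getD_append_right _ _ _ _ (by omega), Nat.add_sub_cancel_left,
      List.getD_append _ _ _ _ hj]
  have hmem : ∀ o j (hj : j < (ls o).length), (b o).getD (1 + 2 * j) 0 = (ls o)[j].val := by
    intro o j hj
    rw [add_comm]
    exact (getD_flatMap_pair _ _ (ls o) hj).1
  have hdist : ∀ o j (hj : j < (ls o).length),
      (b o).getD (2 + 2 * j) 0 = G.dist (vertex hn o) (ls o)[j] := by
    intro o j hj
    rw [show 2 + 2 * j = 2 * j + 1 + 1 by ring]
    exact (getD_flatMap_pair _ _ (ls o) hj).2
  have hW1 : ∀ o < 2 * n, ∀ j (hj : j < (ls o).length), (n :: (List.range (2 * n)).flatMap b).getD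
      (1 + ((List.range o).flatMap b).length + 1 + 2 * j) 0 = (ls o)[j].val := by
    intro o ho j hj
    rw [add_assoc _ 1, hget o ho _ (by rw [hblen]; omega), hmem o j hj]
  refine ⟨fun o => 1 + ((List.range o).flatMap b).length, fun o => (ls o).length, ?_⟩
  refine ⟨rfl, ?_, rfl, ?_, ?_, fun o _ => (hlen o).trans hk, ?_, ?_, ?_⟩
  · have hall : ∀ x ∈ n :: (List.range (2 * n)).flatMap b, x ≤ n := by
      intro x hx
      rcases List.mem_cons.1 hx with rfl | hx
      · exact le_rfl
      obtain ⟨o, -, hx⟩ := List.mem_flatMap.1 hx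
      rcases List.mem_cons.1 hx with rfl | hx
      · exact hlenn o
      obtain ⟨y, -, hx⟩ := List.mem_flatMap.1 hx
      have hD : G.diam < n := by simpa using SimpleGraph.diam_lt_card hG
      have := hG.dist_le_diam (vertex hn o) y
      have := y.2
      simp at hx
      omega
    intro i
    rcases lt_or_ge i (n :: (List.range (2 * n)).flatMap b).length with h | h
    · simp only [List.getD_eq_getElem _ _ h]
      exact hall _ (List.getElem_mem h)
    · simp only [List.getD_eq_default _ _ h]
      exact Nat.zero_le _
  · intro o
    simp only [List.range_succ, List.flatMap_append, List.length_append, List.flatMap_cons,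
      List.flatMap_nil, List.append_nil, hblen]
    ring
  · intro o ho
    exact hget o ho 0 (by rw [hblen]; omega)
  · intro o ho j hj
    simp only [hW1 o ho j hj]
    rw [← hfin]
    exact Finset.mem_map.2 ⟨_, List.mem_toFinset.2 (List.getElem_mem hj), rfl⟩
  · intro o ho j hj
    simp only [hW1 o ho j hj]
    have := hget o ho (2 + 2 * j) (by rw [hblen]; omega)
    rw [← add_assoc] at this
    simp only [this, hdist o j hj, toHubData]
    congr 1
    exact Fin.ext (Nat.mod_eq_of_lt (Fin.is_lt _)).symm
  · intro o ho x hx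
    rw [← hfin] at hx
    obtain ⟨y, hy, rfl⟩ := Finset.mem_map.1 hx
    obtain ⟨j, hj, rfl⟩ := List.getElem_of_mem (List.mem_toFinset.1 hy)
    exact ⟨j, hj, hW1 o ho j hj⟩

theorem card_lab_toHubData_le (L : HubLabeling G) (hG : G.Connected) (o : ℕ) :
    ((L.toHubData hG).lab o).card ≤ L.maxLabelSize := by
  simp only [toHubData, Finset.card_map]
  split_ifs
  exacts [L.card_out_le _, L.card_inn_le _]

theorem pairSum_toHubData (L : HubLabeling G) (hG : G.Connected) (k X : ℕ) :
    pairSum (fun o o' => X ^ (L.toHubData hG).T o o') (RAM.initTask n k).items =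
      ∑ e ∈ Finset.range (G.diam + 1), G.distCount e * X ^ e := by
  rw [pairSum_initTask]
  simp only [toHubData, vertex_two_mul, vertex_two_mul_add_one]
  exact SimpleGraph.sum_dist_eq_sum_distCount hG (fun e => X ^ e)

theorem maxLabelSize_pos (L : HubLabeling G) (hG : G.Connected) : 0 < L.maxLabelSize := by
  obtain ⟨v⟩ := hG.nonempty
  obtain ⟨x, hx, -⟩ := (L.isLeast_dist v v).1
  exact (Finset.card_pos.2 ⟨x, hx⟩).trans_le (L.card_out_le v)

end HubLabeling

namespace RAM

variable {n D : ℕ} {H : HubData n D}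

/-- The read position is stored in a register, so the length of the word enters the bound for the
memory. -/
theorem InputOK.pos_le {W pos len : ℕ → ℕ} {k : ℕ} (hW : InputOK H W pos len k) :
    ∀ o ≤ 2 * n, pos o ≤ 1 + o * (1 + 2 * k) := by
  intro o
  induction o with
  | zero => intro _; simp [hW.pos_zero]
  | succ o ih =>
    intro ho
    have h1 := ih (by omega)
    have h2 := hW.len_le o (by omega)
    have h3 : (o + 1) * (1 + 2 * k) = o * (1 + 2 * k) + (1 + 2 * k) := by ring
    rw [hW.pos_succ]
    omega

end RAM

/-! ### The running time -/

namespace RAM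

variable {n : ℕ} {G : SimpleGraph (Fin n)}

theorem bdd_init {K : ℕ} {w : List ℕ} (hK : 0 < K) (hw : ∀ i, w.getD i 0 < K) :
    Bdd K (init w) := by
  refine ⟨fun _ => hK, fun a i => ?_⟩
  simp only [init]
  split_ifs
  exacts [hw i, hK]

theorem indexProgram_exec {a k M : ℕ} {δ : ℝ} (hδ : 0 < δ)
    (ha : (2 : ℝ) ^ (-δ) + 3 / (2 : ℝ) ^ a ≤ 1) (L : HubLabeling G) {w : List ℕ}
    (hG : G.Connected) (hk : L.maxLabelSize ≤ k) (hw : L.Encodes w)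
    (hM : ((2 : ℝ) ^ a) ^ (6 * k + 3) * ((2 * n : ℕ) : ℝ) ^ (1 + δ) ≤ M)
    (hM' : M ≤ 2 ^ (a * (6 * k + 3)) * (4 * (n * n))) :
    ∃ t s, Exec indexProgram (init w) t s ∧
      t ≤ (2 * n * ((k + 1) * (6 * k + 9) + 10) + (3 * G.diam + 10 * (n.size + 3) + 101) * M +
        10 * G.diam + 24) * (indexProgram.weight *
          (a * (6 * k + 3) + 2 * n.size * (G.diam + 3) + k + 20) ^ 2) ∧
      s.var 1 ≠ 0 ∧ hararyIndex G = (s.var 0 : ℚ) / (s.var 1 : ℚ) ∧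
      s.var 3 ≠ 0 ∧ rcwIndex G = (s.var 2 : ℚ) / (s.var 3 : ℚ) := by
  obtain ⟨pos, len, hW⟩ := L.exists_inputOK hG hk hw
  have hn := HubLabeling.connected_pos hG
  have hDn : G.diam < n := by simpa using SimpleGraph.diam_lt_card hG
  set D := G.diam with hD
  -- The summands of `B` provide for the factor `Y` of the potential, for $X^D$ with $X\le q$, for
  -- three spare factors `q` that cover powers of `n`, for the label size, and for numerical
  -- constants.
  set B := a * (6 * k + 3) + 2 * n.size * (D + 3) + k + 20 with hB
  set Y := 2 ^ (a * (6 * k + 3)) with hY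
  set q := 2 ^ (2 * n.size) with hq
  set Z := q ^ D with hZ
  set Q := Y * Z * q ^ 3 * 2 ^ k with hQ
  have hK : 2 ^ B = Q * 1048576 := by
    rw [hB, hQ, hY, hZ, hq]
    simp only [← pow_mul, ← pow_add]
    rw [show (1048576 : ℕ) = 2 ^ 20 by norm_num, ← pow_add]
    congr 1
    ring
  have hnq : n * n + 1 ≤ q := by
    have h1 := Nat.lt_size_self n
    rw [hq, mul_comm 2, pow_mul]
    nlinarith
  have hY1 : 1 ≤ Y := Nat.one_le_two_pow
  have hq1 : 1 ≤ q := Nat.one_le_two_pow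
  have hZ1 : 1 ≤ Z := Nat.one_le_pow _ _ hq1
  have hk1 : k < 2 ^ k := Nat.lt_two_pow_self
  have hk2 : 1 ≤ 2 ^ k := Nat.one_le_two_pow
  have hq3 : q ≤ q ^ 3 := Nat.le_self_pow (by omega) q
  have hQ1 : Y * Z * q ≤ Q := by
    rw [hQ]
    calc Y * Z * q ≤ Y * Z * q ^ 3 := Nat.mul_le_mul_left _ hq3
      _ ≤ _ := Nat.le_mul_of_pos_right _ hk2
  have hQ2 : q * 2 ^ k ≤ Q := by
    rw [hQ]
    refine Nat.mul_le_mul_right _ (hq3.trans ?_)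
    exact Nat.le_mul_of_pos_left _ (Nat.mul_pos hY1 hZ1)
  have hQ3 : Y * q ≤ Y * Z * q := Nat.mul_le_mul_right _ (Nat.le_mul_of_pos_right _ hZ1)
  have hQ4 : Z * q ≤ Y * Z * q := Nat.mul_le_mul_right _ (Nat.le_mul_of_pos_left _ hY1)
  have hQ5 : q ≤ q * 2 ^ k := Nat.le_mul_of_pos_right _ hk2
  have hQ6 : 2 ^ k ≤ q * 2 ^ k := Nat.le_mul_of_pos_left _ hq1
  have hQ7 : q ≤ Y * q := Nat.le_mul_of_pos_left _ hY1
  have hnn : n ≤ n * n := Nat.le_mul_self n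
  have hMq : M ≤ 4 * (Y * q) := hM'.trans (by
    calc Y * (4 * (n * n)) ≤ Y * (4 * q) := by gcongr; omega
      _ = _ := by ring)
  have hXD : (n * n + 1) ^ D ≤ Z := Nat.pow_le_pow_left hnq D
  have hB1 : 1 ≤ B := by omega
  have hbdd : Bdd (2 ^ B) (init w) := bdd_init (by positivity) fun i =>
    (hW.le i).trans_lt (by omega)
  -- The bisection needs `4 * n + 1 < 2 ^ d`, which `d = n.size + 3` satisfies because `n < 2 ^
  -- n.size`.
  have hrun := indexProgram_runs (H := L.toHubData hG) (K := 2 ^ B) (d := n.size + 3) (M := M)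
    (S := n * n) (A := (2 : ℝ) ^ a) (N := G.distCount) hδ (by positivity) ha hW
    (fun o _ => (L.card_lab_toHubData_le hG o).trans hk) (s := init w) rfl (fun _ => rfl)
    ?_ hM (L.pairSum_toHubData hG k _) ?_ ?_ ?_ ?_ ?_ ?_ ?_ ?_ ?_
  · obtain ⟨N, s, hs, hN, h1, h0, h3, h2⟩ := hrun hbdd
    obtain ⟨t, ht, htN⟩ := hs.exec hB1 hbdd le_rfl
    refine ⟨t, s, ht, htN.trans (Nat.mul_le_mul_right _ hN), h1, ?_, h3, ?_⟩
    · rw [hararyIndex_eq_sum_distCount hG, h0, mul_div_cancel_left₀ _ (by exact_mod_cast h1)]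
    · rw [rcwIndex_eq_sum_distCount hG, h2, mul_div_cancel_left₀ _ (by exact_mod_cast h3)]
  · have := Nat.lt_size_self n
    rw [pow_add]
    omega
  · intro e
    have := G.distCount_le e
    simp only [Fintype.card_fin] at this
    omega
  · have := hG.nonempty
    exact G.distCount_diam_ne_zero
  · simpa using SimpleGraph.sum_distCount_succ_le hG
  · omega
  · omega
  · have h1 := hW.pos_le (2 * n) le_rfl
    have h2 : 2 * n * (1 + 2 * k) ≤ 6 * (q * 2 ^ k) := by
      calc 2 * n * (1 + 2 * k) ≤ 2 * q * (3 * 2 ^ k) := by gcongr <;> omega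
        _ = _ := by ring
    omega
  · have h1 : (M + 1) * (n * n + 1) ^ D ≤ 5 * (Y * Z * q) := by
      calc (M + 1) * (n * n + 1) ^ D ≤ (5 * (Y * q)) * Z := by gcongr; omega
        _ = _ := by ring
    rw [← hD]
    omega
  · rw [pairSum_initTask]
    have h1 : ∑ p : Fin n × Fin n, (n * n + 1) ^ (L.toHubData hG).T (2 * p.1) (2 * p.2 + 1) ≤
        ∑ p : Fin n × Fin n, (n * n + 1) ^ D := Finset.sum_le_sum fun p _ =>
      Nat.pow_le_pow_right (by omega) ((L.toHubData hG).T_le (by omega) (by omega) (by omega)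
        (by omega))
    simp only [Finset.sum_const, Finset.card_univ, Fintype.card_prod, Fintype.card_fin,
      smul_eq_mul] at h1
    have h2 : n * n * (n * n + 1) ^ D ≤ Z * q := by
      rw [mul_comm Z]
      gcongr
      omega
    omega
  · have h1 : (n * n + 1) * (D + 1) ^ D ≤ Z * q := by
      rw [mul_comm Z]
      exact Nat.mul_le_mul hnq ((Nat.pow_le_pow_left (by omega) D).trans hXD)
    rw [← hD]
    omega

end RAM

/-! ### Absorbing logarithmic and polynomial factors. -/

theorem exists_size_le_rpow {η : ℝ} (hη : 0 < η) :
    ∃ c : ℝ, 0 < c ∧ ∀ n : ℕ, 0 < n → (n.size : ℝ) ≤ c * (n : ℝ) ^ η := by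
  refine ⟨1 + 2 / η, by positivity, fun n hn => ?_⟩
  have hs : 0 < n.size := Nat.size_pos.2 hn
  have h1 : 2 ^ (n.size - 1) ≤ n := Nat.lt_size.1 (by omega)
  have hn1 : (1 : ℝ) ≤ n := by exact_mod_cast hn
  have h2 : ((n.size - 1 : ℕ) : ℝ) * Real.log 2 ≤ Real.log n := by
    rw [← Real.log_pow]
    exact Real.log_le_log (by positivity) (by exact_mod_cast h1)
  have h3 := Real.log_le_rpow_div (x := n) (by positivity) hη
  have h4 := Real.log_two_gt_d9
  have h5 : (1 : ℝ) ≤ (n : ℝ) ^ η := Real.one_le_rpow hn1 hη.le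
  rw [Nat.cast_sub hs, Nat.cast_one] at h2
  have h6 : (0 : ℝ) ≤ (n.size : ℝ) - 1 := by
    have : (1 : ℝ) ≤ n.size := by exact_mod_cast hs
    linarith
  have h7 : ((n.size : ℝ) - 1) * (1 / 2) ≤ (n : ℝ) ^ η / η :=
    (mul_le_mul_of_nonneg_left (by linarith) h6).trans (h2.trans h3)
  have h8 : 2 / η * (n : ℝ) ^ η = 2 * ((n : ℝ) ^ η / η) := by ring
  nlinarith

theorem exists_two_pow_ge (x : ℝ) : ∃ a : ℕ, x ≤ (2 : ℝ) ^ a := by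
  obtain ⟨a, ha⟩ := pow_unbounded_of_one_lt x (one_lt_two)
  exact ⟨a, ha.le⟩

/-- As $2^{-\delta}<1$, some room is left for $3/A$. A power of two is taken for $A$ so that
$A^{6k+3}$ is a power of two with an exponent linear in $k$. -/
theorem exists_branching_constant {δ : ℝ} (hδ : 0 < δ) :
    ∃ a : ℕ, (2 : ℝ) ^ (-δ) + 3 / (2 : ℝ) ^ a ≤ 1 := by
  have h : (2 : ℝ) ^ (-δ) < 1 := Real.rpow_lt_one_of_one_lt_of_neg one_lt_two (by linarith)
  obtain ⟨a, ha⟩ := exists_two_pow_ge (3 / (1 - (2 : ℝ) ^ (-δ)))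
  refine ⟨a, ?_⟩
  rw [div_le_iff₀ (by linarith)] at ha
  have : 3 / (2 : ℝ) ^ a ≤ 1 - (2 : ℝ) ^ (-δ) := by
    rw [div_le_iff₀ (by positivity)]
    linarith
  linarith

/-- The number of steps and the word length, as a product of powers of the parameters. -/
theorem time_le_product {a k M σ D n W : ℕ} (hk : 1 ≤ k) (hσ : 1 ≤ σ) (hn : 1 ≤ n)
    (hM : 2 * n ≤ M) :
    (2 * n * ((k + 1) * (6 * k + 9) + 10) + (3 * D + 10 * (σ + 3) + 101) * M + 10 * D + 24) *
      (W * (a * (6 * k + 3) + 2 * σ * (D + 3) + k + 20) ^ 2) ≤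
    218 * W * (9 * a + 29) ^ 2 * M * k ^ 4 * (D + 1) ^ 3 * σ ^ 3 := by
  have hk2 : k ≤ k ^ 2 := Nat.le_self_pow (by omega) k
  have hDσ : D + 1 ≤ (D + 1) * σ := Nat.le_mul_of_pos_right _ hσ
  have hσD : σ ≤ (D + 1) * σ := Nat.le_mul_of_pos_left _ (by omega)
  have hB : a * (6 * k + 3) + 2 * σ * (D + 3) + k + 20 ≤ (9 * a + 29) * (k * ((D + 1) * σ)) := by
    have h1 : k ≤ k * ((D + 1) * σ) := Nat.le_mul_of_pos_right _ (by positivity)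
    have h2 : (D + 1) * σ ≤ k * ((D + 1) * σ) := Nat.le_mul_of_pos_left _ hk
    have h3 : a * (6 * k + 3) ≤ a * (9 * (k * ((D + 1) * σ))) := Nat.mul_le_mul_left _ (by omega)
    have h4 : 2 * σ * (D + 3) = 2 * ((D + 1) * σ) + 4 * σ := by ring
    have h5 : (9 * a + 29) * (k * ((D + 1) * σ)) =
      a * (9 * (k * ((D + 1) * σ))) + 29 * (k * ((D + 1) * σ)) := by ring
    omega
  -- The constant is `40` for reading the input, `144 = 3 + 10 + 131` for the loop over the tasks
  -- and `34 = 10 + 24` for the rest.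
  have hN : 2 * n * ((k + 1) * (6 * k + 9) + 10) + (3 * D + 10 * (σ + 3) + 101) * M + 10 * D + 24 ≤
      218 * (M * (k ^ 2 * ((D + 1) * σ))) := by
    have h1 : (k + 1) * (6 * k + 9) + 10 ≤ 40 * k ^ 2 := by nlinarith
    have h2 : k ^ 2 ≤ k ^ 2 * ((D + 1) * σ) := Nat.le_mul_of_pos_right _ (by positivity)
    have h3 : (D + 1) * σ ≤ k ^ 2 * ((D + 1) * σ) := Nat.le_mul_of_pos_left _ (by positivity)
    have h4 : 2 * n * ((k + 1) * (6 * k + 9) + 10) ≤ M * (40 * (k ^ 2 * ((D + 1) * σ))) :=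
      Nat.mul_le_mul hM (by omega)
    have h5 : (3 * D + 10 * (σ + 3) + 101) * M ≤ M * (144 * (k ^ 2 * ((D + 1) * σ))) := by
      rw [mul_comm]
      exact Nat.mul_le_mul_left _ (by omega)
    have h6 : k ^ 2 * ((D + 1) * σ) ≤ M * (k ^ 2 * ((D + 1) * σ)) :=
      Nat.le_mul_of_pos_left _ (by omega)
    have h7 : M * (40 * (k ^ 2 * ((D + 1) * σ))) = 40 * (M * (k ^ 2 * ((D + 1) * σ))) := by ring
    have h8 : M * (144 * (k ^ 2 * ((D + 1) * σ))) = 144 * (M * (k ^ 2 * ((D + 1) * σ))) := by ring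
    omega
  calc _ ≤ 218 * (M * (k ^ 2 * ((D + 1) * σ))) * (W * ((9 * a + 29) * (k * ((D + 1) * σ))) ^ 2) :=
        Nat.mul_le_mul hN (Nat.mul_le_mul_left _ (Nat.pow_le_pow_left hB 2))
    _ = _ := by ring

theorem mainTheorem7 :
    ∃ P : RAM.Prog, ∀ ε : ℝ, 0 < ε → ∃ C : ℕ,
      ∀ (n k : ℕ) (G : SimpleGraph (Fin n)) (L : HubLabeling G) (w : List ℕ),
        G.Connected → L.maxLabelSize ≤ k → L.Encodes w →
        ∃ (t : ℕ) (s : RAM.State), RAM.Exec P (RAM.init w) t s ∧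
          (t : ℝ) ≤ (2 : ℝ) ^ (C * k) * (n : ℝ) ^ (1 + ε) ∧
          s.var 1 ≠ 0 ∧ hararyIndex G = (s.var 0 : ℚ) / (s.var 1 : ℚ) ∧
          s.var 3 ≠ 0 ∧ rcwIndex G = (s.var 2 : ℚ) / (s.var 3 : ℚ) := by
  refine ⟨RAM.indexProgram, fun ε hε => ?_⟩
  -- One `δ` is spent in the potential and one on the cube of the bit length of `n`. The bound `δ ≤
  -- 1` allows integral estimates of the potential.
  obtain ⟨δ, hδ, hδ1, hδε⟩ : ∃ δ : ℝ, 0 < δ ∧ δ ≤ 1 ∧ 2 * δ ≤ ε :=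
    ⟨min 1 (ε / 2), by positivity, min_le_left _ _, by linarith [min_le_right 1 (ε / 2)]⟩
  obtain ⟨a, ha⟩ := exists_branching_constant hδ
  obtain ⟨c, hc, hsize⟩ := exists_size_le_rpow (η := δ / 3) (by positivity)
  obtain ⟨γ, hγ⟩ := exists_two_pow_ge
    (((218 * RAM.indexProgram.weight * (9 * a + 29) ^ 2 : ℕ) : ℝ) * 8 * c ^ 3)
  -- Here `γ` covers the constant factors, `9 * a` the power $A^{6k+3}\le A^{9k}$, and `19 = 4 + 15`
  -- the factors $k^4\le2^{4k}$ and $(D+1)^3\le2^{15k}$.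
  refine ⟨γ + 9 * a + 19, fun n k G L w hG hk hw => ?_⟩
  have hn := HubLabeling.connected_pos hG
  have hk1 : 1 ≤ k := (L.maxLabelSize_pos hG).trans_le hk
  have hn1 : (1 : ℝ) ≤ n := by exact_mod_cast hn
  have h2n : (1 : ℝ) ≤ (2 * n : ℕ) := by exact_mod_cast (by omega : 1 ≤ 2 * n)
  set F : ℝ := ((2 : ℝ) ^ a) ^ (6 * k + 3) * ((2 * n : ℕ) : ℝ) ^ (1 + δ) with hF
  have hp1 : (1 : ℝ) ≤ ((2 : ℝ) ^ a) ^ (6 * k + 3) := one_le_pow₀ (one_le_pow₀ one_le_two)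
  have hFn : ((2 * n : ℕ) : ℝ) ≤ F := by
    have : ((2 * n : ℕ) : ℝ) ≤ ((2 * n : ℕ) : ℝ) ^ (1 + δ) :=
      Real.self_le_rpow_of_one_le h2n (by linarith)
    rw [hF]
    nlinarith
  have hM' : ⌈F⌉₊ ≤ 2 ^ (a * (6 * k + 3)) * (4 * (n * n)) := by
    refine Nat.ceil_le.2 ?_
    have : ((2 * n : ℕ) : ℝ) ^ (1 + δ) ≤ ((2 * n : ℕ) : ℝ) ^ (2 : ℝ) :=
      Real.rpow_le_rpow_of_exponent_le h2n (by linarith)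
    rw [Real.rpow_two] at this
    calc F ≤ ((2 : ℝ) ^ a) ^ (6 * k + 3) * ((2 * n : ℕ) : ℝ) ^ 2 := by rw [hF]; gcongr
      _ = _ := by push_cast; rw [pow_mul]; ring
  obtain ⟨t, s, hex, ht, hout⟩ := RAM.indexProgram_exec hδ ha L hG hk hw (Nat.le_ceil F) hM'
  refine ⟨t, s, hex, ?_, hout⟩
  have ht' := ht.trans (time_le_product hk1 (Nat.size_pos.2 hn) hn
    (by exact_mod_cast hFn.trans (Nat.le_ceil F)))
  -- The factor `8` is `2` for rounding up and `4` for $2^{1+\delta}\le4$.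
  have hMF : (⌈F⌉₊ : ℝ) ≤ (2 : ℝ) ^ (9 * a * k) * 8 * (n : ℝ) ^ (1 + δ) := by
    have h1 : (⌈F⌉₊ : ℝ) ≤ 2 * F := by
      have := Nat.ceil_lt_add_one (zero_le_one.trans (h2n.trans hFn))
      linarith
    have h2 : ((2 : ℝ) ^ a) ^ (6 * k + 3) ≤ (2 : ℝ) ^ (9 * a * k) := by
      rw [← pow_mul]
      refine pow_le_pow_right₀ one_le_two ?_
      rw [mul_comm 9 a, mul_assoc]
      exact Nat.mul_le_mul_left _ (by omega)
    have h3 : ((2 * n : ℕ) : ℝ) ^ (1 + δ) ≤ 4 * (n : ℝ) ^ (1 + δ) := by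
      push_cast
      rw [Real.mul_rpow (by norm_num) (by positivity)]
      have : (2 : ℝ) ^ (1 + δ) ≤ (2 : ℝ) ^ (2 : ℝ) :=
        Real.rpow_le_rpow_of_exponent_le one_le_two (by linarith)
      rw [Real.rpow_two] at this
      gcongr
      linarith
    calc (⌈F⌉₊ : ℝ) ≤ 2 * F := h1
      _ ≤ 2 * ((2 : ℝ) ^ (9 * a * k) * (4 * (n : ℝ) ^ (1 + δ))) := by rw [hF]; gcongr
      _ = _ := by ring
  have hk4 : (k : ℝ) ^ 4 ≤ (2 : ℝ) ^ (4 * k) := by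
    rw [mul_comm, pow_mul]
    gcongr
    exact_mod_cast Nat.lt_two_pow_self.le
  have hD3 : ((G.diam : ℝ) + 1) ^ 3 ≤ (2 : ℝ) ^ (15 * k) := by
    rw [show 15 * k = 5 * k * 3 by ring, pow_mul]
    gcongr
    have h1 : G.diam + 1 ≤ 2 ^ (5 * k) :=
      (L.diam_lt_two_pow hG hk).trans_le (Nat.pow_le_pow_right (by omega) (by omega))
    exact_mod_cast h1
  have hσ3 : (n.size : ℝ) ^ 3 ≤ c ^ 3 * (n : ℝ) ^ δ := by
    calc (n.size : ℝ) ^ 3 ≤ (c * (n : ℝ) ^ (δ / 3)) ^ 3 := by gcongr; exact hsize n hn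
      _ = c ^ 3 * (n : ℝ) ^ δ := by
        rw [mul_pow, ← Real.rpow_natCast ((n : ℝ) ^ (δ / 3)), ← Real.rpow_mul (by positivity)]
        congr 2
        push_cast
        ring
  have hnε : (n : ℝ) ^ (1 + δ) * (n : ℝ) ^ δ ≤ (n : ℝ) ^ (1 + ε) := by
    rw [← Real.rpow_add (by linarith)]
    exact Real.rpow_le_rpow_of_exponent_le hn1 (by linarith)
  have hγk : (2 : ℝ) ^ γ ≤ (2 : ℝ) ^ (γ * k) :=
    pow_le_pow_right₀ one_le_two (Nat.le_mul_of_pos_right _ hk1)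
  set c₁ := 218 * RAM.indexProgram.weight * (9 * a + 29) ^ 2 with hc₁
  clear_value c₁
  calc (t : ℝ) ≤ (c₁ : ℝ) * ⌈F⌉₊ * (k : ℝ) ^ 4 * ((G.diam : ℝ) + 1) ^ 3 * (n.size : ℝ) ^ 3 := by
        exact_mod_cast ht'
    _ ≤ (c₁ : ℝ) * ((2 : ℝ) ^ (9 * a * k) * 8 * (n : ℝ) ^ (1 + δ)) * (2 : ℝ) ^ (4 * k) *
        (2 : ℝ) ^ (15 * k) * (c ^ 3 * (n : ℝ) ^ δ) := by gcongr
    _ = ((c₁ : ℝ) * 8 * c ^ 3) * (2 : ℝ) ^ (9 * a * k + 4 * k + 15 * k) *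
        ((n : ℝ) ^ (1 + δ) * (n : ℝ) ^ δ) := by rw [pow_add, pow_add]; ring
    _ ≤ (2 : ℝ) ^ (γ * k) * (2 : ℝ) ^ (9 * a * k + 4 * k + 15 * k) * (n : ℝ) ^ (1 + ε) := by
        gcongr
        exact hγ.trans hγk
    _ = (2 : ℝ) ^ ((γ + 9 * a + 19) * k) * (n : ℝ) ^ (1 + ε) := by
        rw [← pow_add]
        congr 2
        ring
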